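/- Consider the six Painlevé equations, as real ODEs with real constants $\alpha,\beta,\gamma,\delta$: - PI: $y''=6y^2+x$; - PII: $y''=2y^3+xy+\alpha$; - PIII: $y''=\frac{1}{y}y'^2-\frac1x y'+\alpha\frac{y^2}{x}+\frac{\beta}{x}+\gamma y^3+\frac{\delta}{y}$; - PIV: $y''=\frac{1}{2y}y'^2+\frac32y^3+4xy^2+2(x^2-\alpha)y+\frac{\beta}{y}$; - PV: $y''=\left(\frac1{2y}+\frac1{y-1}\right)y'^2-\frac1xy'+\frac{(y-1)^2}{x^2}\left(\alpha y+\frac{\beta}{y}\right)+\gamma\frac yx+\delta\frac{y(y+1)}{y-1}$; - PVI: $y''=\frac12\left(\frac1y+\frac1{y-1}+\frac1{y-x}\right)y'^2-\left(\frac1x+\frac1{x-1}+\frac1{y-x}\right)y'+\frac{y(y-1)(y-x)}{x^2(x-1)^2}\left[\alpha+\beta\frac{x}{y^2}+\gamma\frac{x-1}{(y-1)^2}+\delta\frac{x(x-1)}{(y-x)^2}\right]$. The domain of each equation is the open set of points $(x,y)\in\mathbb R^2$ at which no denominator on its right-hand side vanishes: all of $\mathbb R^2$ for PI and PII; $x,y\ne0$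 for PIII; $y\neq 0$ for PIV; $x\ne0$, $y\ne0,1$ for PV; $x\ne0,1$, $y\neq 0,1,x$ for PVI. An equation is metrisable near a point $p$ of its domain if on some neighbourhood $U$ of $p$ there is a smooth Riemannian or pseudo-Riemannian metric such that the integral curves $x\mapsto(x,y(x))$ of the equation in $U$ are the unparametrised geodesics of its Levi-Civita connection (among $C^2$ curves that are graphs over intervals of the $x$-axis). The projective structure defined by the equation is flat near $p$ if on some neighbourhood of $p$ there is a smooth change of coordinates $(x,y)\mapsto(X(x,y),Y(x,y))$ that transforms the equation into $d^2Y/dX^2=0$, i.e. takes its integral curves to straight lines. Then, for every choice of the real parameters and every point $p$ of the domain of the equation in question: 1. PI, PII and PIV are not metrisable near $p$. 2. PIII is metrisable near $p$ if and only if $\alpha=\gamma=0$ or $\beta=\delta=0$. 3. PV is metrisable near $p$ if and only if $\gamma=\delta=0$. 4. PVI is metrisable near $p$ if and only if $\alpha=\beta=\gamma=0$ and $\delta=\frac12$. 5. If $\alpha=\beta=\gamma=\delta=0$, the projective structures defined by PIII and PV are flat near $p$. The projective structure defined by PVI with $\alpha=\beta=\gamma=0$, $\delta=\frac12$ is flat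 near $p$. -/

import Mathlib

open Set
open scoped ContDiff Matrix

/-- The `(x, y)`-plane; coordinate `0` is the independent variable `x`, coordinate `1` is the
dependent variable `y`. -/
abbrev Plane : Type := Fin 2 → ℝ

/-- A second order ODE `y'' = rhs x y y'`, together with the set `dom` of points `(x, y)` at which
its right-hand side is regular. -/
structure SecondOrderODE where
  rhs : ℝ → ℝ → ℝ → ℝ
  dom : Set Plane

/-- `y` is a (twice continuously differentiable) solution of the ODE on the open set `I`. -/
def SecondOrderODE.IsSolution (R : SecondOrderODE) (I : Set ℝ) (y : ℝ → ℝ) : Prop :=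
  ContDiffOn ℝ 2 y I ∧ ∀ x ∈ I, deriv (deriv y) x = R.rhs x (y x) (deriv y x)

/-- The graph of `y`, as the curve `x ↦ (x, y x)`; for a solution `y` this is an integral curve. -/
def graphCurve (y : ℝ → ℝ) : ℝ → Plane := fun x => ![x, y x]

/-- The partial derivative `∂f/∂xⁱ`. -/
noncomputable def partialDeriv (i : Fin 2) (f : Plane → ℝ) (p : Plane) : ℝ :=
  fderiv ℝ f p (Pi.single i 1)

/-- `g` is a smooth Riemannian or pseudo-Riemannian metric on the open set `U` (no restriction on
the signature), given by its matrix of components `g_{ij}` in the coordinates `(x, y)`. -/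
structure IsPseudoRiemannianMetricOn (U : Set Plane) (g : Plane → Matrix (Fin 2) (Fin 2) ℝ) :
    Prop where
  smooth : ∀ i j, ContDiffOn ℝ ∞ (fun p => g p i j) U
  symm : ∀ p ∈ U, (g p).IsSymm
  nondegenerate : ∀ p ∈ U, (g p).det ≠ 0

/-- The Christoffel symbols of the Levi-Civita connection of `g`:
`Γᵏᵢⱼ = ½ gᵏˡ (∂ᵢ gⱼₗ + ∂ⱼ gᵢₗ - ∂ₗ gᵢⱼ)`. -/
noncomputable def christoffel (g : Plane → Matrix (Fin 2) (Fin 2) ℝ) (k i j : Fin 2)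
    (p : Plane) : ℝ :=
  (1 / 2) * ∑ l, (g p)⁻¹ k l *
    (partialDeriv i (fun q => g q j l) p + partialDeriv j (fun q => g q i l) p
      - partialDeriv l (fun q => g q i j) p)

/-- The regular curve `c`, defined on the open set `I`, is an unparametrised geodesic of `g`: its
covariant acceleration `∇_ċ ċ` is everywhere proportional to its velocity `ċ`, that is, `c`
satisfies the geodesic equation up to reparametrisation. -/
def IsUnparametrisedGeodesic (g : Plane → Matrix (Fin 2) (Fin 2) ℝ) (I : Set ℝ)
    (c : ℝ → Plane) : Prop :=
  ContDiffOn ℝ 2 c I ∧ ∀ t ∈ I, deriv c t ≠ 0 ∧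
    ∃ μ : ℝ, ∀ k, deriv (deriv c) t k
        + ∑ i, ∑ j, christoffel g k i j (c t) * deriv c t i * deriv c t j
      = μ * deriv c t k

/-- The ODE is metrisable near `p`: there is a (pseudo-)Riemannian metric on a neighbourhood `U` of
`p` such that the integral curves of the ODE in `U` are the unparametrised geodesics of its
Levi-Civita connection (among the curves which are graphs over an open interval of the
`x`-axis). -/
def SecondOrderODE.IsMetrisableAt (R : SecondOrderODE) (p : Plane) : Prop :=
  ∃ (U : Set Plane) (g : Plane → Matrix (Fin 2) (Fin 2) ℝ),
    IsOpen U ∧ p ∈ U ∧ U ⊆ R.dom ∧ IsPseudoRiemannianMetricOn U g ∧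
    ∀ (a b : ℝ) (y : ℝ → ℝ), ContDiffOn ℝ 2 y (Ioo a b) →
      (∀ x ∈ Ioo a b, graphCurve y x ∈ U) →
      (R.IsSolution (Ioo a b) y ↔ IsUnparametrisedGeodesic g (Ioo a b) (graphCurve y))

/-- The projective structure defined by the ODE is flat near `p`: there is a smooth change of
coordinates `Φ = (X, Y)` on a neighbourhood `U` of `p` (a point transformation) which turns the ODE
into `d²Y/dX² = 0`, that is, the integral curves in `U` are the curves that `Φ` takes into a
straight line `n₀ X + n₁ Y = r`. -/
def SecondOrderODE.IsFlatAt (R : SecondOrderODE) (p : Plane) : Prop :=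
  ∃ (U : Set Plane) (Φ : Plane → Plane),
    IsOpen U ∧ p ∈ U ∧ U ⊆ R.dom ∧
    ContDiffOn ℝ ∞ Φ U ∧ InjOn Φ U ∧ (∀ q ∈ U, (fderiv ℝ Φ q).det ≠ 0) ∧
    ∀ (a b : ℝ) (y : ℝ → ℝ), ContDiffOn ℝ 2 y (Ioo a b) →
      (∀ x ∈ Ioo a b, graphCurve y x ∈ U) →
      (R.IsSolution (Ioo a b) y ↔
        ∃ (n : Plane) (r : ℝ), n ≠ 0 ∧
          ∀ x ∈ Ioo a b, n 0 * Φ (graphCurve y x) 0 + n 1 * Φ (graphCurve y x) 1 = r)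

/-- The first Painlevé equation. -/
noncomputable def painleveI : SecondOrderODE where
  rhs x y _ := 6 * y ^ 2 + x
  dom := univ

/-- The second Painlevé equation. -/
noncomputable def painleveII (α : ℝ) : SecondOrderODE where
  rhs x y _ := 2 * y ^ 3 + x * y + α
  dom := univ

/-- The third Painlevé equation. -/
noncomputable def painleveIII (α β γ δ : ℝ) : SecondOrderODE where
  rhs x y y' := 1 / y * y' ^ 2 - 1 / x * y' + α * (y ^ 2 / x) + β / x + γ * y ^ 3 + δ / y
  dom := {p | p 0 ≠ 0 ∧ p 1 ≠ 0}

/-- The fourth Painlevé equation. -/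
noncomputable def painleveIV (α β : ℝ) : SecondOrderODE where
  rhs x y y' :=
    1 / (2 * y) * y' ^ 2 + 3 / 2 * y ^ 3 + 4 * x * y ^ 2 + 2 * (x ^ 2 - α) * y + β / y
  dom := {p | p 1 ≠ 0}

/-- The fifth Painlevé equation. -/
noncomputable def painleveV (α β γ δ : ℝ) : SecondOrderODE where
  rhs x y y' :=
    (1 / (2 * y) + 1 / (y - 1)) * y' ^ 2 - 1 / x * y'
      + (y - 1) ^ 2 / x ^ 2 * (α * y + β / y) + γ * (y / x) + δ * (y * (y + 1) / (y - 1))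
  dom := {p | p 0 ≠ 0 ∧ p 1 ≠ 0 ∧ p 1 ≠ 1}

/-- The sixth Painlevé equation. -/
noncomputable def painleveVI (α β γ δ : ℝ) : SecondOrderODE where
  rhs x y y' :=
    1 / 2 * (1 / y + 1 / (y - 1) + 1 / (y - x)) * y' ^ 2
      - (1 / x + 1 / (x - 1) + 1 / (y - x)) * y'
      + y * (y - 1) * (y - x) / (x ^ 2 * (x - 1) ^ 2)
        * (α + β * (x / y ^ 2) + γ * ((x - 1) / (y - 1) ^ 2)
          + δ * (x * (x - 1) / (y - x) ^ 2))
  dom := {p | p 0 ≠ 0 ∧ p 0 ≠ 1 ∧ p 1 ≠ 0 ∧ p 1 ≠ 1 ∧ p 1 ≠ p 0}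

/-! All six equations have the form `y'' = P B - (3ρ + N) y' + (P_y / 2P) y'²` with `ρ = ρ(x)` and
`P_x = -N P`. Geodesics leave every point with every slope, so a metric whose geodesics are the
solutions has a geodesic equation with the same right-hand side, as polynomials in `y'`
(`IsMetrisableAt.exists_metric`). Following Liouville, the resulting conditions on the metric become
linear once its components are scaled by `Δ^(-2/3)`, `Δ` being the determinant; extra powers of `P`
lead to the unknowns `a`, `σ`, `τ` of `LiouvilleSystem`. The `y'³` condition says that `a` depends
on `x` alone, hence so does `k`, and `σ` satisfies `2P σ_y + P_y σ = k + N a`.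

Equating the mixed derivatives of `τ` gives an equation of second order in `x` for `σ`
(`LiouvilleSystem.compat`). The operator `2P ∂_y + P_y` turns the `x`-derivatives of `σ` into known
terms, and what remains is an algebraic relation `Q σ + R = 0`, with `R` linear in `a, k, k_x, k_xx`
(`LiouvilleSystem.obstruction`). For PI and PII, where `P = 1`, differentiating it in `y` already
kills `k`, `σ` and `a`. For the others, on a vertical line and after clearing denominators, `Q` and
`R` are polynomials in `y`. If `Q ≠ 0`, then `σ` is a rational solution of `2pσ' + p'σ = w`. The
homogeneous solutions are the multiples of `p^(-1/2)`, and degrees and pole orders leave almost no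
rational solutions: they vanish when `p` has odd degree and `w = 0`, a double root of `p` forces a
constant `w` to be zero, and for the PVI cubic even `w = K + A/(y - x)` must vanish. Outside the
listed parameters this forces `a = σ = 0` somewhere, that is `G = F = 0`, contradicting
nondegeneracy.

Conversely, suppose that coordinates `X(x)`, `Y(x, y)` bring the equation to `d²Y/dX² = f(Y)`.
Conservation of energy, `(dY/dX)² + h(Y) = const` with `h' = -2f`, is what the Clairaut integral of
`dX²/h + dY²/h²` expresses, so this metric has the right geodesics (`isMetrisableAt_of_coframe`).
For PIII take `X = log x` and `Y = log (y/x)` or `log (xy)`; for PV take `X = log x` and `dY = dy /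
(√|y| (y - 1))`. When `f = 0` the same coordinates straighten the equation. The special PVI says,
after Picard and Fuchs, that an elliptic integral `∫ dt / √(t(t-1)(t-x))` up to `y(x)` satisfies the
hypergeometric equation of the periods; dividing by a period gives straightening coordinates
(`exists_coordinates_painleveVI`). -/

open TopologicalSpace (Opens)

set_option linter.unusedSimpArgs false

/-! ### The differential ring of smooth functions on an open set of the plane -/

/-- The algebra of smooth functions on an open set of the plane. -/
def smoothSubalgebra (U : Opens Plane) : Subalgebra ℝ (U → ℝ) where
  carrier := {f | ∃ F : Plane → ℝ, ContDiffOn ℝ ∞ F U ∧ ∀ q : U, f q = F q}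
  mul_mem' := by
    rintro f g ⟨F, hF, hf⟩ ⟨G, hG, hg⟩
    exact ⟨fun p => F p * G p, hF.mul hG, fun q => by simp [hf, hg]⟩
  add_mem' := by
    rintro f g ⟨F, hF, hf⟩ ⟨G, hG, hg⟩
    exact ⟨fun p => F p + G p, hF.add hG, fun q => by simp [hf, hg]⟩
  algebraMap_mem' := fun c => ⟨fun _ => c, contDiffOn_const, fun q => rfl⟩

/-- The ring of smooth functions on an open set of the plane. -/
def smoothFunctions (U : Opens Plane) : Type := smoothSubalgebra U

namespace smoothFunctions

variable {U : Opens Plane}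

instance : CommRing (smoothFunctions U) := inferInstanceAs (CommRing (smoothSubalgebra U))

instance : Algebra ℝ (smoothFunctions U) := inferInstanceAs (Algebra ℝ (smoothSubalgebra U))

/-- The smooth function on `U` given by the values of a function that is smooth on `U`. -/
def mk (F : Plane → ℝ) (hF : ContDiffOn ℝ ∞ F U) : smoothFunctions U :=
  ⟨fun q => F q, F, hF, fun _ => rfl⟩

/-- Evaluation at a point. -/
def eval (q : U) : smoothFunctions U →ₐ[ℝ] ℝ :=
  (Pi.evalAlgHom ℝ (fun _ : U => ℝ) q).comp (smoothSubalgebra U).val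

theorem eval_mk (F : Plane → ℝ) (hF : ContDiffOn ℝ ∞ F U) (q : U) : eval q (mk F hF) = F q := rfl

theorem ext_eval {f g : smoothFunctions U} (h : ∀ q, eval q f = eval q g) : f = g :=
  Subtype.ext (funext h)

/-- The extension by zero. -/
noncomputable def extend (f : smoothFunctions U) : Plane → ℝ :=
  Function.extend Subtype.val f.1 0

theorem extend_apply (f : smoothFunctions U) (q : U) : extend f q = eval q f :=
  Subtype.val_injective.extend_apply _ _ q

theorem contDiffOn_extend (f : smoothFunctions U) : ContDiffOn ℝ ∞ (extend f) U := by
  obtain ⟨F, hF, hf⟩ := f.2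
  exact hF.congr fun q hq => (extend_apply f ⟨q, hq⟩).trans (hf ⟨q, hq⟩)

theorem mk_extend (f : smoothFunctions U) : mk (extend f) (contDiffOn_extend f) = f :=
  ext_eval fun q => extend_apply f q

theorem mk_surj (f : smoothFunctions U) : ∃ F hF, f = mk F hF := ⟨_, _, (mk_extend f).symm⟩

theorem mk_congr {F G : Plane → ℝ} (hF : ContDiffOn ℝ ∞ F U) (hG : ContDiffOn ℝ ∞ G U)
    (h : ∀ q ∈ U, F q = G q) : mk F hF = mk G hG :=
  ext_eval fun q => h q q.2

end smoothFunctions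

theorem ContDiffOn.partialDeriv {U : Set Plane} (hU : IsOpen U) {F : Plane → ℝ}
    (hF : ContDiffOn ℝ ∞ F U) (i : Fin 2) : ContDiffOn ℝ ∞ (partialDeriv i F) U := by
  have := hF.fderiv_of_isOpen hU (m := ∞) (by simp)
  exact this.clm_apply contDiffOn_const

theorem ContDiffOn.differentiableAt_of_mem {U : Set Plane} (hU : IsOpen U) {F : Plane → ℝ}
    (hF : ContDiffOn ℝ ∞ F U) {q : Plane} (hq : q ∈ U) : DifferentiableAt ℝ F q :=
  (hF.differentiableOn (by simp)).differentiableAt (hU.mem_nhds hq)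

theorem partialDeriv_congr {U : Set Plane} (hU : IsOpen U) {F G : Plane → ℝ}
    (h : ∀ q ∈ U, F q = G q) (i : Fin 2) {q : Plane} (hq : q ∈ U) :
    partialDeriv i F q = partialDeriv i G q := by
  have : F =ᶠ[nhds q] G := Filter.eventuallyEq_of_mem (hU.mem_nhds hq) h
  simp only [partialDeriv, this.fderiv_eq]

theorem partialDeriv_comm {U : Set Plane} (hU : IsOpen U) {F : Plane → ℝ}
    (hF : ContDiffOn ℝ ∞ F U) (i j : Fin 2) {q : Plane} (hq : q ∈ U) :
    partialDeriv i (partialDeriv j F) q = partialDeriv j (partialDeriv i F) q := by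
  have h2 : ContDiffAt ℝ 2 F q := (hF.contDiffAt (hU.mem_nhds hq)).of_le (by norm_cast)
  have hd : DifferentiableAt ℝ (fderiv ℝ F) q :=
    (h2.fderiv_right (m := 1) (by norm_num)).differentiableAt (by norm_num)
  have hs := h2.isSymmSndFDerivAt (by simp)
  have key : ∀ k l : Fin 2, partialDeriv k (partialDeriv l F) q
      = fderiv ℝ (fderiv ℝ F) q (Pi.single k 1) (Pi.single l 1) := by
    intro k l
    have : partialDeriv l F = fun p => fderiv ℝ F p (Pi.single l 1) := rfl
    rw [partialDeriv, this, fderiv_clm_apply hd (differentiableAt_const _)]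
    simp
  rw [key, key, hs]

namespace smoothFunctions

variable {U : Opens Plane}

/-- The partial derivative as an operator on smooth functions. -/
noncomputable def pderiv (i : Fin 2) (f : smoothFunctions U) : smoothFunctions U :=
  mk (partialDeriv i (extend f)) ((contDiffOn_extend f).partialDeriv U.isOpen i)

theorem pderiv_mk (i : Fin 2) (F : Plane → ℝ) (hF : ContDiffOn ℝ ∞ F U) :
    pderiv i (mk F hF) = mk (partialDeriv i F) (hF.partialDeriv U.isOpen i) :=
  mk_congr _ _ fun _ hq => partialDeriv_congr U.isOpen
    (fun q hq => extend_apply (mk F hF) ⟨q, hq⟩) i hq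

theorem pderiv_comm (i j : Fin 2) (f : smoothFunctions U) :
    pderiv i (pderiv j f) = pderiv j (pderiv i f) := by
  obtain ⟨F, hF, rfl⟩ := mk_surj f
  simp only [pderiv_mk]
  exact mk_congr _ _ fun q hq => partialDeriv_comm U.isOpen hF i j hq

theorem mk_add (F G : Plane → ℝ) (hF : ContDiffOn ℝ ∞ F U) (hG : ContDiffOn ℝ ∞ G U) :
    mk F hF + mk G hG = mk (fun p => F p + G p) (hF.add hG) := rfl

theorem mk_mul (F G : Plane → ℝ) (hF : ContDiffOn ℝ ∞ F U) (hG : ContDiffOn ℝ ∞ G U) :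
    mk F hF * mk G hG = mk (fun p => F p * G p) (hF.mul hG) := rfl

theorem pderiv_add (i : Fin 2) (f g : smoothFunctions U) :
    pderiv i (f + g) = pderiv i f + pderiv i g := by
  obtain ⟨F, hF, rfl⟩ := mk_surj f
  obtain ⟨G, hG, rfl⟩ := mk_surj g
  simp only [pderiv_mk, mk_add]
  refine mk_congr _ _ fun q hq => ?_
  have h1 := hF.differentiableAt_of_mem U.isOpen hq
  have h2 := hG.differentiableAt_of_mem U.isOpen hq
  simp only [partialDeriv, fderiv_fun_add h1 h2, add_apply]

theorem pderiv_mul (i : Fin 2) (f g : smoothFunctions U) :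
    pderiv i (f * g) = f * pderiv i g + g * pderiv i f := by
  obtain ⟨F, hF, rfl⟩ := mk_surj f
  obtain ⟨G, hG, rfl⟩ := mk_surj g
  simp only [pderiv_mk, mk_mul, mk_add]
  refine mk_congr _ _ fun q hq => ?_
  have h1 := hF.differentiableAt_of_mem U.isOpen hq
  have h2 := hG.differentiableAt_of_mem U.isOpen hq
  simp [partialDeriv, fderiv_fun_mul h1 h2]

theorem pderiv_algebraMap (i : Fin 2) (c : ℝ) :
    pderiv i (algebraMap ℝ (smoothFunctions U) c) = 0 := by
  have : algebraMap ℝ (smoothFunctions U) c = mk (fun _ => c) contDiffOn_const := rfl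
  rw [this, pderiv_mk]
  refine ext_eval fun q => ?_
  rw [eval_mk, map_zero]
  simp [partialDeriv]

/-- The partial derivative as a derivation of the algebra of smooth functions. -/
noncomputable def der (i : Fin 2) : Derivation ℝ (smoothFunctions U) (smoothFunctions U) :=
  Derivation.mk'
    { toFun := pderiv i
      map_add' := pderiv_add i
      map_smul' := fun c f => by
        rw [Algebra.smul_def, pderiv_mul, pderiv_algebraMap, mul_zero, add_zero, RingHom.id_apply,
          Algebra.smul_def] }
    (fun f g => by simpa using pderiv_mul i f g)

theorem der_mk (i : Fin 2) (F : Plane → ℝ) (hF : ContDiffOn ℝ ∞ F U) :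
    der i (mk F hF) = mk (partialDeriv i F) (hF.partialDeriv U.isOpen i) := pderiv_mk i F hF

theorem eval_der_mk (i : Fin 2) (F : Plane → ℝ) (hF : ContDiffOn ℝ ∞ F U) (q : U) :
    eval q (der i (mk F hF)) = partialDeriv i F q := by rw [der_mk, eval_mk]

theorem der_comm (i j : Fin 2) (f : smoothFunctions U) : der i (der j f) = der j (der i f) :=
  pderiv_comm i j f

end smoothFunctions

/-! ### The linearised metrisability system and its algebraic obstruction -/

theorem Derivation.apply_ofNat {R : Type*} [CommRing R] [Algebra ℝ R] (D : Derivation ℝ R R)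
    (n : ℕ) [n.AtLeastTwo] : D (ofNat(n) : R) = 0 := by
  rw [← Nat.cast_ofNat]; exact D.map_natCast n

/-- The linearised metrisability equations of `y'' = P B - (3ρ + N) y' + (∂P/∂y) / (2P) y'²`, for
suitably weighted components `a`, `σ`, `τ` of the metric; `k` is a weighted derivative of `a`. -/
structure LiouvilleSystem {R : Type*} [CommRing R] [Algebra ℝ R] (X Y : Derivation ℝ R R)
    (P N ρ B a k σ τ : R) : Prop where
  comm : ∀ f, X (Y f) = Y (X f)
  hP : X P = -(N * P)
  hρ : Y ρ = 0
  ya : Y a = 0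
  yk : Y k = 0
  xa : X a = 4 * ρ * a - k
  yσ : 2 * P * Y σ + Y P * σ = k + N * a
  xτ : X τ = -(2 * ρ * τ) - 2 * P * B * σ
  yτ : Y τ = -(2 * X σ) + 2 * N * σ + 2 * ρ * σ - 2 * B * a

namespace LiouvilleSystem

variable {R : Type*} [CommRing R] [Algebra ℝ R] {X Y : Derivation ℝ R R} {P N ρ B a k σ τ : R}

/-- The compatibility condition of the two equations for `τ`. -/
theorem compat (h : LiouvilleSystem X Y P N ρ B a k σ τ) :
    2 * X (X σ) - 2 * (N - ρ) * X σ - 2 * (X N + 2 * ρ * N + X ρ + 2 * ρ ^ 2) * σ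
      = (2 * P * Y B + Y P * B) * σ + 3 * B * k + (N * B - 2 * X B - 12 * ρ * B) * a := by
  -- The mixed derivatives of `τ`, computed from `xτ` and from `yτ`, must agree.
  have e := h.comm τ
  rw [h.xτ, h.yτ] at e
  simp only [map_add, map_sub, map_neg, Derivation.leibniz, smul_eq_mul, Derivation.apply_ofNat,
    h.hρ, mul_zero, add_zero] at e
  linear_combination 2 * ρ * h.yτ + B * h.yσ - 2 * B * h.xa - e

/-- Since `D f = 2√P ∂_y(√P f)` and `D σ = k + N a`, applying `D` to `compat` removes every
derivative of `σ`. Here `T = X(k + N a) + N(k + N a)`. The result is linear in `σ` with all other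
unknowns independent of `y`, so it can be solved for `σ` wherever the coefficient is nonzero. -/
theorem obstruction (h : LiouvilleSystem X Y P N ρ B a k σ τ) {D : R → R} {T : R}
    (hD : ∀ f, D f = 2 * P * Y f + Y P * f)
    (hT : T = X k + X N * a + N * (4 * ρ * a - k) + N * (k + N * a)) :
    2 * P * Y (D B) * σ + 4 * k * D B + a * (N * D B + D (N * B - 2 * X B - 12 * ρ * B))
      = 2 * X T + 2 * ρ * T - 2 * (X N + 2 * ρ * N + X ρ + 2 * ρ ^ 2) * (k + N * a)
        - 2 * P * σ * (X (Y N) + N * Y N + 3 * ρ * Y N) := by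
  have e := congrArg Y h.compat
  -- `D` commutes with `X` up to terms in `N`, because `P_x = -N P`; this computes `D σ_x`, and the
  -- next step `D σ_xx`. The term `2 P N_y σ_x` appearing there cancels in the end against the
  -- `y`-derivative of the coefficient `N - ρ` of `σ_x` in `compat`.
  have yxσ : 2 * P * Y (X σ) + Y P * X σ = T + P * Y N * σ := by
    have e1 := congrArg X h.yσ
    simp only [map_add, map_sub, map_neg, Derivation.leibniz, smul_eq_mul, Derivation.apply_ofNat,
      h.comm, h.hP, h.xa, mul_zero, add_zero] at e1
    rw [hT]
    linear_combination e1 + N * h.yσ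
  have yxxσ : 2 * P * Y (X (X σ)) + Y P * X (X σ)
      = X T + N * T + P * X (Y N) * σ + 2 * P * Y N * X σ := by
    have e1 := congrArg X yxσ
    simp only [map_add, map_sub, map_neg, Derivation.leibniz, smul_eq_mul, Derivation.apply_ofNat,
      h.comm, h.hP, mul_zero, add_zero] at e1
    rw [h.comm N]
    linear_combination e1 + N * yxσ
  have yxρ : Y (X ρ) = 0 := by rw [← h.comm, h.hρ, map_zero]
  simp only [map_add, map_sub, map_neg, Derivation.leibniz, Derivation.leibniz_pow,
    smul_eq_mul, Derivation.apply_ofNat, h.hρ, h.ya, h.yk, yxρ, mul_zero, add_zero, zero_add,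
    smul_zero] at e
  rw [h.comm N] at yxxσ ⊢
  simp only [hD, map_add, map_sub, map_neg, Derivation.leibniz, Derivation.leibniz_pow,
    smul_eq_mul, Derivation.apply_ofNat, h.hρ, mul_zero, add_zero, zero_add, smul_zero]
  linear_combination -2 * P * e - Y P * h.compat + 2 * yxxσ - 2 * (N - ρ) * yxσ
    - 2 * (X N + 2 * ρ * N + X ρ + 2 * ρ ^ 2) * h.yσ - (2 * P * Y B + Y P * B) * h.yσ

end LiouvilleSystem

/-! ### Local existence for second order equations -/

/-- Local solvability of the smooth second order equation `y'' = F (x, y, y')`. -/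
theorem exists_solution_second_order {W : Set (ℝ × ℝ × ℝ)} (hW : IsOpen W) {F : ℝ × ℝ × ℝ → ℝ}
    (hF : ContDiffOn ℝ ∞ F W) {x₀ y₀ v₀ : ℝ} (h₀ : (x₀, y₀, v₀) ∈ W) :
    ∃ (y : ℝ → ℝ) (ε : ℝ), 0 < ε ∧ y x₀ = y₀ ∧ deriv y x₀ = v₀ ∧
      ContDiffOn ℝ ∞ y (Ioo (x₀ - ε) (x₀ + ε)) ∧
      ∀ x ∈ Ioo (x₀ - ε) (x₀ + ε), (x, y x, deriv y x) ∈ W ∧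
        deriv (deriv y) x = F (x, y x, deriv y x) := by
  -- The equation as an autonomous first order system, with time as the first coordinate.
  set V : ℝ × ℝ × ℝ → ℝ × ℝ × ℝ := fun p => (1, p.2.2, F p) with hVdef
  have hV : ContDiffOn ℝ ∞ V W :=
    contDiffOn_const.prodMk ((contDiff_snd.comp contDiff_snd).contDiffOn.prodMk hF)
  obtain ⟨γ, hγ₀, ε, hε, hγ⟩ :=
    ((hV.contDiffAt (hW.mem_nhds h₀)).of_le (by norm_cast)
      : ContDiffAt ℝ 1 V _).exists_forall_mem_closedBall_exists_eq_forall_mem_Ioo_hasDerivAt₀ x₀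
  have hx₀ : x₀ ∈ Ioo (x₀ - ε) (x₀ + ε) := ⟨by linarith, by linarith⟩
  have hnear : ∀ᶠ t in nhds x₀, γ t ∈ W := by
    have hc : ContinuousAt γ x₀ := (hγ x₀ hx₀).continuousAt
    exact hc.eventually (by rw [hγ₀]; exact hW.mem_nhds h₀)
  obtain ⟨ε₁, hε₁, hball⟩ := Metric.eventually_nhds_iff.1 hnear
  -- Half of the minimum, so that the closed interval lies in both open ones; the regularity result
  -- works on closed intervals.
  set δ := min ε ε₁ / 2 with hδ
  have hm : 0 < min ε ε₁ := lt_min hε hε₁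
  have hδ0 : 0 < δ := by positivity
  have hδε : δ < ε := by have := min_le_left ε ε₁; rw [hδ]; linarith
  have hδε₁ : δ < ε₁ := by have := min_le_right ε ε₁; rw [hδ]; linarith
  have hsub : Icc (x₀ - δ) (x₀ + δ) ⊆ Ioo (x₀ - ε) (x₀ + ε) :=
    fun t ht => ⟨by linarith [ht.1], by linarith [ht.2]⟩
  have hmem : ∀ t ∈ Icc (x₀ - δ) (x₀ + δ), γ t ∈ W := fun t ht => hball (by
    rw [Real.dist_eq, abs_lt]; constructor <;> linarith [ht.1, ht.2])
  have hsm : ContDiffOn ℝ ∞ γ (Icc (x₀ - δ) (x₀ + δ)) := by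
    refine ODE.contDiffOn_enat_Icc_of_hasDerivWithinAt (n := ⊤) (f := fun _ => V) (u := W) ?_
      (fun t ht => (hγ t (hsub ht)).hasDerivWithinAt) hmem
    exact hV.comp contDiff_snd.contDiffOn fun p hp => hp.2
  have h1 : ∀ t ∈ Ioo (x₀ - ε) (x₀ + ε), HasDerivAt (fun t => (γ t).1) 1 t := fun t ht => by
    exact (hasFDerivAt_fst (p := γ t)).comp_hasDerivAt t (hγ t ht)
  have h2 : ∀ t ∈ Ioo (x₀ - ε) (x₀ + ε), HasDerivAt (fun t => (γ t).2.1) (γ t).2.2 t := by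
    intro t ht
    have := (hasFDerivAt_snd (p := γ t)).comp_hasDerivAt t (hγ t ht)
    exact (hasFDerivAt_fst (𝕜 := ℝ) (p := (γ t).2)).comp_hasDerivAt t this
  have h3 : ∀ t ∈ Ioo (x₀ - ε) (x₀ + ε), HasDerivAt (fun t => (γ t).2.2) (F (γ t)) t := by
    intro t ht
    have := (hasFDerivAt_snd (p := γ t)).comp_hasDerivAt t (hγ t ht)
    exact (hasFDerivAt_snd (𝕜 := ℝ) (p := (γ t).2)).comp_hasDerivAt t this
  -- The time coordinate moves with unit speed, so the trajectory is a graph over the `x`-axis.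
  have hfst : ∀ t ∈ Ioo (x₀ - ε) (x₀ + ε), (γ t).1 = t := by
    intro t ht
    have hd : ∀ s ∈ Ioo (x₀ - ε) (x₀ + ε), HasDerivAt (fun s => (γ s).1 - s) 0 s := fun s hs => by
      simpa using (h1 s hs).fun_sub (hasDerivAt_id' s)
    have := isOpen_Ioo.is_const_of_deriv_eq_zero isPreconnected_Ioo
      (fun s hs => (hd s hs).differentiableAt.differentiableWithinAt)
      (fun s hs => (hd s hs).deriv) ht hx₀
    simp [hγ₀] at this
    linarith
  have hder : ∀ t ∈ Ioo (x₀ - ε) (x₀ + ε), deriv (fun t => (γ t).2.1) t = (γ t).2.2 :=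
    fun t ht => (h2 t ht).deriv
  have hpt : ∀ t ∈ Ioo (x₀ - ε) (x₀ + ε),
      (t, (γ t).2.1, deriv (fun t => (γ t).2.1) t) = γ t := fun t ht => by
    rw [hder t ht]
    exact Prod.ext (hfst t ht).symm rfl
  refine ⟨fun t => (γ t).2.1, δ, hδ0, by simp [hγ₀], by rw [hder _ hx₀, hγ₀], ?_, ?_⟩
  · exact ((contDiff_fst.comp contDiff_snd).comp_contDiffOn hsm).mono Ioo_subset_Icc_self
  · intro t ht
    have ht' := hsub (Ioo_subset_Icc_self ht)
    rw [hpt t ht']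
    refine ⟨hmem t (Ioo_subset_Icc_self ht), ?_⟩
    have : deriv (fun t => (γ t).2.1) =ᶠ[nhds t] fun t => (γ t).2.2 :=
      Filter.eventuallyEq_of_mem (isOpen_Ioo.mem_nhds ht') hder
    rw [this.deriv_eq, (h3 t ht').deriv]

/-! ### Unparametrised geodesics as solutions of a second order equation -/

theorem hasDerivAt_graphCurve {y : ℝ → ℝ} {v x : ℝ} (h : HasDerivAt y v x) :
    HasDerivAt (graphCurve y) ![1, v] x := by
  rw [hasDerivAt_pi]
  intro i
  fin_cases i
  · simpa [graphCurve] using hasDerivAt_id' x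
  · simpa [graphCurve] using h

theorem contDiffOn_graphCurve {n : WithTop ℕ∞} {y : ℝ → ℝ} {s : Set ℝ} (h : ContDiffOn ℝ n y s) :
    ContDiffOn ℝ n (graphCurve y) s := by
  rw [contDiffOn_pi]
  intro i
  fin_cases i
  · simpa [graphCurve] using contDiff_fun_id.contDiffOn
  · simpa [graphCurve] using h

section twice

variable {y : ℝ → ℝ} {s : Set ℝ}

theorem ContDiffOn.hasDerivAt_of_two (hs : IsOpen s) (h : ContDiffOn ℝ 2 y s) {x : ℝ} (hx : x ∈ s) :
    HasDerivAt y (deriv y x) x :=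
  ((h.differentiableOn (by norm_num)).differentiableAt (hs.mem_nhds hx)).hasDerivAt

theorem ContDiffOn.hasDerivAt_deriv_of_two (hs : IsOpen s) (h : ContDiffOn ℝ 2 y s) {x : ℝ}
    (hx : x ∈ s) : HasDerivAt (deriv y) (deriv (deriv y) x) x := by
  have h1 : ContDiffOn ℝ 1 (deriv y) s := by
    have : ContDiffOn ℝ (1 + 1) y s := by simpa [one_add_one_eq_two] using h
    exact ((contDiffOn_succ_iff_deriv_of_isOpen hs).1 this).2.2
  exact ((h1.differentiableOn (by norm_num)).differentiableAt (hs.mem_nhds hx)).hasDerivAt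

end twice

/-- The right-hand side of the equation `y'' = K(x, y, y')` of the unparametrised geodesics. -/
noncomputable def geodesicRHS (g : Plane → Matrix (Fin 2) (Fin 2) ℝ) (q : Plane) (v : ℝ) : ℝ :=
  v * ∑ i, ∑ j, christoffel g 0 i j q * ![1, v] i * ![1, v] j
    - ∑ i, ∑ j, christoffel g 1 i j q * ![1, v] i * ![1, v] j

/-- Along a graph the velocity is `(1, y')` and the acceleration `(0, y'')`. The first component of
the geodesic equation therefore determines `μ`, and substituting it in the second leaves one scalar
equation. -/
theorem isUnparametrisedGeodesic_graphCurve_iff (g : Plane → Matrix (Fin 2) (Fin 2) ℝ) {a b : ℝ}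
    {y : ℝ → ℝ} (hy : ContDiffOn ℝ 2 y (Ioo a b)) :
    IsUnparametrisedGeodesic g (Ioo a b) (graphCurve y) ↔
      ∀ x ∈ Ioo a b, deriv (deriv y) x = geodesicRHS g (graphCurve y x) (deriv y x) := by
  have hd : ∀ x ∈ Ioo a b, deriv (graphCurve y) x = ![1, deriv y x] := fun x hx =>
    (hasDerivAt_graphCurve (hy.hasDerivAt_of_two isOpen_Ioo hx)).deriv
  have hdd : ∀ x ∈ Ioo a b, deriv (deriv (graphCurve y)) x = ![0, deriv (deriv y) x] := by
    intro x hx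
    have : deriv (graphCurve y) =ᶠ[nhds x] fun x => ![1, deriv y x] :=
      Filter.eventuallyEq_of_mem (isOpen_Ioo.mem_nhds hx) hd
    rw [this.deriv_eq]
    apply HasDerivAt.deriv
    rw [hasDerivAt_pi]
    intro i
    fin_cases i
    · simpa using hasDerivAt_const x (1 : ℝ)
    · simpa using hy.hasDerivAt_deriv_of_two isOpen_Ioo hx
  unfold IsUnparametrisedGeodesic
  rw [and_iff_right (contDiffOn_graphCurve hy)]
  refine forall₂_congr fun x hx => ?_
  rw [hdd x hx, hd x hx, geodesicRHS]
  constructor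
  · rintro ⟨-, μ, hμ⟩
    have h0 := hμ 0
    have h1 := hμ 1
    simp only [Matrix.cons_val_zero, Matrix.cons_val_one, zero_add, mul_one] at h0 h1
    rw [h0]
    linear_combination h1
  · intro h
    refine ⟨fun h0 => by simpa using congrFun h0 0,
      ∑ i, ∑ j, christoffel g 0 i j (graphCurve y x) * ![1, deriv y x] i * ![1, deriv y x] j,
      fun k => ?_⟩
    fin_cases k
    · simp
    · simp only [Fin.mk_one, Matrix.cons_val_one, Matrix.cons_val_zero]
      linear_combination h

theorem Matrix.inv_fin_two_apply (A : Matrix (Fin 2) (Fin 2) ℝ) (k l : Fin 2) :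
    A⁻¹ k l = (A.det)⁻¹ * !![A 1 1, -A 0 1; -A 1 0, A 0 0] k l := by
  rw [Matrix.inv_def, Matrix.adjugate_fin_two, Matrix.smul_apply, Ring.inverse_eq_inv', smul_eq_mul]

namespace IsPseudoRiemannianMetricOn

variable {U : Set Plane} {g : Plane → Matrix (Fin 2) (Fin 2) ℝ}

theorem contDiffOn_det (hg : IsPseudoRiemannianMetricOn U g) :
    ContDiffOn ℝ ∞ (fun p => (g p).det) U := by
  simp only [Matrix.det_fin_two]
  exact ((hg.smooth 0 0).mul (hg.smooth 1 1)).sub ((hg.smooth 0 1).mul (hg.smooth 1 0))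

theorem contDiffOn_inv (hg : IsPseudoRiemannianMetricOn U g) (k l : Fin 2) :
    ContDiffOn ℝ ∞ (fun p => (g p)⁻¹ k l) U := by
  simp only [Matrix.inv_fin_two_apply]
  refine (hg.contDiffOn_det.inv hg.nondegenerate).mul ?_
  fin_cases k <;> fin_cases l
  · exact hg.smooth 1 1
  · exact (hg.smooth 0 1).neg
  · exact (hg.smooth 1 0).neg
  · exact hg.smooth 0 0

theorem contDiffOn_christoffel (hU : IsOpen U) (hg : IsPseudoRiemannianMetricOn U g)
    (k i j : Fin 2) : ContDiffOn ℝ ∞ (christoffel g k i j) U := by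
  unfold christoffel
  refine contDiffOn_const.mul (ContDiffOn.sum fun l _ => (hg.contDiffOn_inv k l).mul ?_)
  exact (((hg.smooth j l).partialDeriv hU i).add ((hg.smooth i l).partialDeriv hU j)).sub
    ((hg.smooth i j).partialDeriv hU l)

/-- Multiplying by the determinant clears the inverse metric, so that the right-hand side is
polynomial in the slope `v`, in the components and in their first derivatives. Named values let this
be applied with either partial derivatives or evaluations in the ring of smooth functions. -/
theorem geodesicRHS_mul_det (hU : IsOpen U) (hg : IsPseudoRiemannianMetricOn U g) {q : Plane}
    (hq : q ∈ U) {E F G Ex Ey Fx Fy Gx Gy : ℝ} (hE : g q 0 0 = E) (hF : g q 0 1 = F)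
    (hG : g q 1 1 = G)
    (hEx : _root_.partialDeriv 0 (fun p => g p 0 0) q = Ex)
    (hEy : _root_.partialDeriv 1 (fun p => g p 0 0) q = Ey)
    (hFx : _root_.partialDeriv 0 (fun p => g p 0 1) q = Fx)
    (hFy : _root_.partialDeriv 1 (fun p => g p 0 1) q = Fy)
    (hGx : _root_.partialDeriv 0 (fun p => g p 1 1) q = Gx)
    (hGy : _root_.partialDeriv 1 (fun p => g p 1 1) q = Gy) (v : ℝ) :
    E * G - F ^ 2 ≠ 0 ∧
    geodesicRHS g q v * (E * G - F ^ 2)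
      = v * (G * (Ex / 2 + Ey * v + (Fy - Gx / 2) * v ^ 2)
          - F * (Fx - Ey / 2 + Gx * v + Gy / 2 * v ^ 2))
        - (E * (Fx - Ey / 2 + Gx * v + Gy / 2 * v ^ 2)
          - F * (Ex / 2 + Ey * v + (Fy - Gx / 2) * v ^ 2)) := by
  have hs : ∀ p ∈ U, g p 1 0 = g p 0 1 := fun p hp => (hg.symm p hp).apply 0 1
  have hp : ∀ i, _root_.partialDeriv i (fun p => g p 1 0) q
      = _root_.partialDeriv i (fun p => g p 0 1) q :=
    fun i => partialDeriv_congr hU hs i hq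
  have hdet : (g q).det = E * G - F ^ 2 := by
    rw [Matrix.det_fin_two, hs q hq, hE, hF, hG]; ring
  have h0 : E * G - F ^ 2 ≠ 0 := hdet ▸ hg.nondegenerate q hq
  refine ⟨h0, ?_⟩
  simp only [geodesicRHS, christoffel, Fin.sum_univ_two, Matrix.inv_fin_two_apply, hdet, hp, hs q hq,
    hE, hF, hG, hEx, hEy, hFx, hFy, hGx, hGy, Matrix.of_apply, Matrix.cons_val_zero,
    Matrix.cons_val_one]
  generalize E * G - F ^ 2 = d at h0 ⊢
  field_simp
  ring

end IsPseudoRiemannianMetricOn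

theorem continuous_plane : Continuous fun p : ℝ × ℝ × ℝ => (![p.1, p.2.1] : Plane) := by
  refine continuous_pi fun i => ?_
  fin_cases i
  · exact continuous_fst
  · exact continuous_fst.comp continuous_snd

theorem contDiff_plane : ContDiff ℝ ∞ fun p : ℝ × ℝ × ℝ => (![p.1, p.2.1] : Plane) := by
  refine contDiff_pi.2 fun i => ?_
  fin_cases i
  · exact contDiff_fst
  · exact contDiff_fst.comp contDiff_snd

namespace SecondOrderODE

/-- A metric whose unparametrised geodesics are the solutions of an equation determines the
right-hand side of the equation. -/
theorem IsMetrisableAt.exists_metric {R : SecondOrderODE} {p : Plane} (h : R.IsMetrisableAt p) :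
    ∃ (U : Opens Plane) (g : Plane → Matrix (Fin 2) (Fin 2) ℝ), p ∈ U ∧ (U : Set Plane) ⊆ R.dom ∧
      IsPseudoRiemannianMetricOn U g ∧
      ∀ q ∈ U, ∀ v, R.rhs (q 0) (q 1) v = geodesicRHS g q v := by
  obtain ⟨U, g, hU, hp, hdom, hg, hiff⟩ := h
  refine ⟨⟨U, hU⟩, g, hp, hdom, hg, fun q hq v => ?_⟩
  have hq' : (![q 0, q 1] : Plane) = q := by ext i; fin_cases i <;> rfl
  have hpl : ∀ f : Plane → ℝ, ContDiffOn ℝ ∞ f U → ContDiffOn ℝ ∞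
      (fun p : ℝ × ℝ × ℝ => f ![p.1, p.2.1]) {p : ℝ × ℝ × ℝ | ![p.1, p.2.1] ∈ U} :=
    fun f hf => hf.comp contDiff_plane.contDiffOn fun p hp => hp
  have hv : ∀ i : Fin 2, ContDiff ℝ ∞ fun p : ℝ × ℝ × ℝ => (![1, p.2.2] : Fin 2 → ℝ) i := by
    intro i
    fin_cases i
    · exact contDiff_const
    · exact contDiff_snd.comp contDiff_snd
  have hsum : ∀ k, ContDiffOn ℝ ∞ (fun p : ℝ × ℝ × ℝ => ∑ i, ∑ j,
      christoffel g k i j ![p.1, p.2.1] * ![1, p.2.2] i * ![1, p.2.2] j)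
      {p : ℝ × ℝ × ℝ | ![p.1, p.2.1] ∈ U} := fun k =>
    ContDiffOn.sum fun i _ => ContDiffOn.sum fun j _ =>
      ((hpl _ (hg.contDiffOn_christoffel hU k i j)).mul (hv i).contDiffOn).mul (hv j).contDiffOn
  -- The geodesic equation is the one solved, since nothing is known about the regularity of
  -- `R.rhs`. The solution with slope `v` at `q` is a geodesic, hence a solution for `R`, and its
  -- second derivative at `q 0` compares the two right-hand sides.
  obtain ⟨y, ε, hε, hy₀, hv₀, hy, hsol⟩ := exists_solution_second_order
    (W := {p : ℝ × ℝ × ℝ | ![p.1, p.2.1] ∈ U})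
    (F := fun p => geodesicRHS g ![p.1, p.2.1] p.2.2) (hU.preimage continuous_plane)
    (((contDiff_snd.comp contDiff_snd).contDiffOn.mul (hsum 0)).sub (hsum 1))
    (x₀ := q 0) (y₀ := q 1) (v₀ := v) (by simpa [hq'] using hq)
  have hy2 : ContDiffOn ℝ 2 y (Ioo (q 0 - ε) (q 0 + ε)) := hy.of_le (by norm_cast)
  have h1 := (hiff _ _ y hy2 fun x hx => (hsol x hx).1).2
    ((isUnparametrisedGeodesic_graphCurve_iff g hy2).2 fun x hx => (hsol x hx).2)
  have hx₀ : q 0 ∈ Ioo (q 0 - ε) (q 0 + ε) := ⟨by linarith, by linarith⟩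
  have h2 := h1.2 _ hx₀
  rw [(hsol _ hx₀).2, hy₀, hv₀, hq'] at h2
  exact h2.symm

theorem IsMetrisableAt.of_geodesicRHS {R : SecondOrderODE} {p : Plane} {U : Set Plane}
    (hU : IsOpen U) (hp : p ∈ U) (hdom : U ⊆ R.dom) {g : Plane → Matrix (Fin 2) (Fin 2) ℝ}
    (hg : IsPseudoRiemannianMetricOn U g)
    (h : ∀ q ∈ U, ∀ v, R.rhs (q 0) (q 1) v = geodesicRHS g q v) : R.IsMetrisableAt p := by
  refine ⟨U, g, hU, hp, hdom, hg, fun a b y hy hyU => ?_⟩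
  rw [isUnparametrisedGeodesic_graphCurve_iff g hy, IsSolution, and_iff_right hy]
  refine forall₂_congr fun x hx => ?_
  rw [← h _ (hyU x hx)]
  rfl

end SecondOrderODE

/-! ### From a metric to the linear system -/

/-- The linearisation of the metrisability equations: `E`, `F`, `G` are the components of a metric
with determinant `Δ` and `L` stands for `P ^ (1/3) Δ ^ (-2/3)`. -/
theorem liouvilleSystem_of_metric {R : Type*} [CommRing R] [Algebra ℝ R] {X Y : Derivation ℝ R R}
    {P I N ρ B E F G L Δ : R} (comm : ∀ f, X (Y f) = Y (X f)) (hpx : X P = -(N * P))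
    (hry : Y ρ = 0) (hpi : P * I = 1) (hcan : ∀ f, 3 * P * P * Δ * f = 0 → f = 0)
    (hDr : Δ = E * G - F * F)
    (hLx : 3 * P * Δ * X L = L * (Δ * X P - 2 * P * X Δ))
    (hLy : 3 * P * Δ * Y L = L * (Δ * Y P - 2 * P * Y Δ))
    (hg0 : 2 * P * B * Δ = F * X E - E * (2 * X F - Y E))
    (hg1 : -(2 * (3 * ρ + N) * Δ)
      = G * X E - F * (2 * X F - Y E) - 2 * E * X G + 2 * F * Y E)
    (hg2 : Y P * Δ = P * (2 * G * Y E - 3 * F * X G - E * Y G + 2 * F * Y F))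
    (hg3 : G * (2 * Y F - X G) = F * Y G) :
    LiouvilleSystem X Y P N ρ B (L * G) (4 * ρ * (L * G) - X (L * G)) (L * F * I) (L * E * I) := by
  have hDx : X Δ = E * X G + G * X E - 2 * F * X F := by
    rw [hDr, map_sub, Derivation.leibniz, Derivation.leibniz]
    simp only [smul_eq_mul]
    ring
  have hDy : Y Δ = E * Y G + G * Y E - 2 * F * Y F := by
    rw [hDr, map_sub, Derivation.leibniz, Derivation.leibniz]
    simp only [smul_eq_mul]
    ring
  have hI : ∀ M, L * M * I * P = L * M := fun M => by rw [mul_assoc, mul_comm I, hpi, mul_one]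
  have hIσ : ∀ (Z : Derivation ℝ R R) M,
      Z (L * M * I) * P + L * M * I * Z P = Z L * M + L * Z M := by
    intro Z M
    have h2 := congrArg Z (hI M)
    rw [Derivation.leibniz _ (L * M * I), Derivation.leibniz _ L M] at h2
    simp only [smul_eq_mul] at h2
    linear_combination h2
  have ya : Y (L * G) = 0 := by
    -- All the identities are proved after multiplication by `3 P² Δ`, which `hcan` allows to be
    -- cancelled; this makes the logarithmic derivative of `L` and the inverse `I` of `P`
    -- polynomial.
    refine hcan _ ?_
    simp only [Derivation.leibniz, smul_eq_mul]
    linear_combination P * G * hLy + P * L * G * hg2 - 2 * P ^ 2 * L * G * hDy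
      + 3 * P ^ 2 * L * F * hg3 + 3 * P ^ 2 * L * Y G * hDr
  refine ⟨comm, hpx, hry, ya, ?_, by ring, ?_, ?_, ?_⟩
  · rw [map_sub, ← comm, ya, map_zero, Derivation.leibniz, ya, Derivation.leibniz, hry]
    simp [Derivation.apply_ofNat]
  · rw [← sub_eq_zero]
    refine hcan _ ?_
    have e := hIσ Y F
    have eσ := hI F
    rw [Derivation.leibniz X L G]
    simp only [smul_eq_mul]
    generalize Y (L * F * I) = σy at *
    generalize L * F * I = σ at *
    linear_combination 6 * P ^ 2 * Δ * e - 3 * P * Δ * Y P * eσ + 2 * P * F * hLy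
      + P * G * hLx + P * L * G * Δ * hpx
      - P * L * F * hg2 + 2 * P ^ 2 * L * G * hg1 - 2 * P ^ 2 * L * G * hDx
      - 4 * P ^ 2 * L * F * hDy + (3 * P ^ 2 * L * X G + 6 * P ^ 2 * L * Y F) * hDr
      + 3 * P ^ 2 * L * E * hg3
  · rw [← sub_eq_zero]
    refine hcan _ ?_
    have e := hIσ X E
    have eσ := hI F
    have eτ := hI E
    generalize X (L * E * I) = τx at *
    generalize L * E * I = τ at *
    generalize L * F * I = σ at *
    linear_combination 3 * P * Δ * e + 6 * P * Δ * ρ * eτ + 6 * P ^ 2 * Δ * B * eσ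
      - 3 * P * Δ * τ * hpx + 3 * P * Δ * N * eτ + E * hLx + L * E * Δ * hpx
      - P * L * E * hg1 + 3 * P * L * F * hg0 + 3 * P * L * X E * hDr - 2 * P * L * E * hDx
  · rw [← sub_eq_zero]
    refine hcan _ ?_
    have e := hIσ Y E
    have e' := hIσ X F
    have eσ := hI F
    have eτ := hI E
    generalize Y (L * E * I) = τy at *
    generalize X (L * F * I) = σx at *
    generalize L * E * I = τ at *
    generalize L * F * I = σ at *
    linear_combination 3 * P * Δ * e + 6 * P * Δ * e' - 6 * P * Δ * σ * hpx
      - 6 * P * Δ * ρ * eσ - 3 * Δ * Y P * eτ + E * hLy + 2 * F * hLx + 2 * L * F * Δ * hpx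
      - 2 * L * E * hg2 + P * L * F * hg1 + 3 * P * L * G * hg0
      + (3 * P * L * Y E + 6 * P * L * X F) * hDr - 2 * P * L * E * hDy - 4 * P * L * F * hDx

set_option maxHeartbeats 1000000 in
open smoothFunctions in
/-- The metric components of a metrisable equation, suitably weighted, satisfy the linearised
metrisability equations. -/
theorem exists_liouvilleSystem_of_isMetrisableAt {R : SecondOrderODE} {p : Plane}
    (h : R.IsMetrisableAt p) {P N ρ B : Plane → ℝ} (hP : ContDiffOn ℝ ∞ P R.dom)
    (hN : ContDiffOn ℝ ∞ N R.dom) (hρ : ContDiffOn ℝ ∞ ρ R.dom) (hB : ContDiffOn ℝ ∞ B R.dom)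
    (hP0 : ∀ q ∈ R.dom, P q ≠ 0) (hPx : ∀ q ∈ R.dom, partialDeriv 0 P q = -(N q * P q))
    (hρy : ∀ q ∈ R.dom, partialDeriv 1 ρ q = 0)
    (hR : ∀ q ∈ R.dom, ∀ v, R.rhs (q 0) (q 1) v
      = P q * B q - (3 * ρ q + N q) * v + partialDeriv 1 P q / (2 * P q) * v ^ 2) :
    ∃ (U : Opens Plane) (hU : (U : Set Plane) ⊆ R.dom) (a k σ τ : smoothFunctions U), p ∈ U ∧
      LiouvilleSystem (der 0) (der 1) (mk P (hP.mono hU)) (mk N (hN.mono hU)) (mk ρ (hρ.mono hU))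
        (mk B (hB.mono hU)) a k σ τ ∧
      ∀ q, ¬ (eval q a = 0 ∧ eval q σ = 0) := by
  obtain ⟨U, g, hpU, hdom, hg, hrhs⟩ := h.exists_metric
  set D : Plane → ℝ := fun q => (g q).det with hDdef
  have hD : ContDiffOn ℝ ∞ D U := hg.contDiffOn_det
  -- `Real.log` is the logarithm of the absolute value, so this is `|P|^(1/3) |D|^(-2/3)`: positive
  -- and smooth whatever the signs of `P` and of the determinant.
  set l : Plane → ℝ := fun q => Real.exp (1 / 3 * Real.log (P q) - 2 / 3 * Real.log (D q)) with hldef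
  have hP' := hP.mono hdom
  have hl : ContDiffOn ℝ ∞ l U :=
    ((contDiffOn_const.mul (hP'.log fun q hq => hP0 q (hdom hq))).sub
      (contDiffOn_const.mul (hD.log hg.nondegenerate))).exp
  have hlder : ∀ q ∈ U, ∀ i, 3 * P q * D q * partialDeriv i l q
      = l q * (D q * partialDeriv i P q - 2 * P q * partialDeriv i D q) := by
    intro q hq i
    have h1 : P q ≠ 0 := hP0 q (hdom hq)
    have h2 : D q ≠ 0 := hg.nondegenerate q hq
    have d1 := (hP'.differentiableAt_of_mem U.isOpen hq).hasFDerivAt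
    have d2 := (hD.differentiableAt_of_mem U.isOpen hq).hasFDerivAt
    have d3 := (((d1.log h1).const_mul (1 / 3)).sub ((d2.log h2).const_mul (2 / 3))).exp
    have : partialDeriv i l q = l q * (1 / 3 * ((P q)⁻¹ * partialDeriv i P q)
        - 2 / 3 * ((D q)⁻¹ * partialDeriv i D q)) := by
      have e : fderiv ℝ l q = _ := d3.fderiv
      unfold partialDeriv
      rw [e]
      simp [hldef]
    rw [this]
    field_simp
  have hi : ContDiffOn ℝ ∞ (fun q => (P q)⁻¹) U := hP'.inv fun q hq => hP0 q (hdom hq)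
  have hgeo : ∀ q ∈ U, ∀ v : ℝ, (P q * B q - (3 * ρ q + N q) * v
      + partialDeriv 1 P q / (2 * P q) * v ^ 2) * (g q 0 0 * g q 1 1 - g q 0 1 ^ 2)
      = v * (g q 1 1 * (partialDeriv 0 (fun p => g p 0 0) q / 2
            + partialDeriv 1 (fun p => g p 0 0) q * v
            + (partialDeriv 1 (fun p => g p 0 1) q - partialDeriv 0 (fun p => g p 1 1) q / 2) * v ^ 2)
          - g q 0 1 * (partialDeriv 0 (fun p => g p 0 1) q - partialDeriv 1 (fun p => g p 0 0) q / 2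
            + partialDeriv 0 (fun p => g p 1 1) q * v
            + partialDeriv 1 (fun p => g p 1 1) q / 2 * v ^ 2))
        - (g q 0 0 * (partialDeriv 0 (fun p => g p 0 1) q - partialDeriv 1 (fun p => g p 0 0) q / 2
            + partialDeriv 0 (fun p => g p 1 1) q * v
            + partialDeriv 1 (fun p => g p 1 1) q / 2 * v ^ 2)
          - g q 0 1 * (partialDeriv 0 (fun p => g p 0 0) q / 2
            + partialDeriv 1 (fun p => g p 0 0) q * v
            + (partialDeriv 1 (fun p => g p 0 1) q
              - partialDeriv 0 (fun p => g p 1 1) q / 2) * v ^ 2)) := by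
    intro q hq v
    have h1 := (hg.geodesicRHS_mul_det U.isOpen hq rfl rfl rfl rfl rfl rfl rfl rfl rfl v).2
    rw [← hrhs q hq v, hR q (hdom hq)] at h1
    exact h1
  have hdet : ∀ q ∈ U, D q = g q 0 0 * g q 1 1 - g q 0 1 ^ 2 := fun q hq => by
    simp only [hDdef]
    rw [Matrix.det_fin_two, show g q 1 0 = g q 0 1 from (hg.symm q hq).apply 0 1]
    ring
  have sys := liouvilleSystem_of_metric (X := der 0) (Y := der 1) (P := mk P hP')
    (N := mk N (hN.mono hdom)) (ρ := mk ρ (hρ.mono hdom)) (B := mk B (hB.mono hdom))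
    (I := mk _ hi) (E := mk _ (hg.smooth 0 0)) (F := mk _ (hg.smooth 0 1))
    (G := mk _ (hg.smooth 1 1)) (L := mk l hl) (Δ := mk D hD) (der_comm 0 1)
    (ext_eval fun q => by
      rw [eval_der_mk, map_neg, map_mul, eval_mk, eval_mk, hPx q (hdom q.2)])
    (ext_eval fun q => by rw [eval_der_mk, map_zero, hρy q (hdom q.2)])
    (ext_eval fun q => by
      rw [map_mul, map_one, eval_mk, eval_mk]; exact mul_inv_cancel₀ (hP0 q (hdom q.2)))
    (fun f hf => ext_eval fun q => by
      have := congrArg (eval q) hf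
      simp only [map_mul, map_ofNat, map_zero, eval_mk] at this ⊢
      have h1 : P q ≠ 0 := hP0 q (hdom q.2)
      have h2 : D q ≠ 0 := hg.nondegenerate q q.2
      simpa [h1, h2] using this)
    (ext_eval fun q => by
      simp only [map_sub, map_mul, eval_mk]
      rw [hdet q q.2]
      ring)
    (ext_eval fun q => by
      simp only [map_mul, map_sub, map_ofNat, eval_der_mk, eval_mk]
      exact hlder q q.2 0)
    (ext_eval fun q => by
      simp only [map_mul, map_sub, map_ofNat, eval_der_mk, eval_mk]
      exact hlder q q.2 1)
    -- The next four arguments are the coefficients of `1, v, v², v³` in `hgeo`, an identity between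
    -- polynomials of degree at most three in `v`. They are extracted by interpolation at `v = 0, 1,
    -- -1, 2`.
    (ext_eval fun q => by
      have h0 := hgeo q q.2 0
      simp only [map_mul, map_sub, map_ofNat, eval_der_mk, eval_mk, hdet q q.2]
      linear_combination 2 * h0)
    (ext_eval fun q => by
      have h0 := hgeo q q.2 0
      have h1 := hgeo q q.2 1
      have h2 := hgeo q q.2 (-1)
      have h3 := hgeo q q.2 2
      simp only [map_mul, map_sub, map_ofNat, map_neg, map_add, eval_der_mk, eval_mk, hdet q q.2]
      linear_combination - h0 + 2 * h1 - 2 / 3 * h2 - h3 / 3)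
    (ext_eval fun q => by
      have h0 := hgeo q q.2 0
      have h1 := hgeo q q.2 1
      have h2 := hgeo q q.2 (-1)
      have hne : P q ≠ 0 := hP0 q (hdom q.2)
      have h4 : partialDeriv 1 P q = partialDeriv 1 P q / (2 * P q) * (2 * P q) := by
        field_simp
      simp only [map_mul, map_sub, map_ofNat, map_neg, map_add, eval_der_mk, eval_mk, hdet q q.2]
      linear_combination (g q 0 0 * g q 1 1 - g q 0 1 ^ 2) * h4 + P q * (- 2 * h0 + h1 + h2))
    (ext_eval fun q => by
      have h0 := hgeo q q.2 0
      have h1 := hgeo q q.2 1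
      have h2 := hgeo q q.2 (-1)
      have h3 := hgeo q q.2 2
      simp only [map_mul, map_sub, map_ofNat, eval_der_mk, eval_mk]
      linear_combination - h0 + h1 + h2 / 3 - h3 / 3)
  refine ⟨U, hdom, _, _, _, _, hpU, sys, ?_⟩
  rintro q ⟨h1, h2⟩
  have hl0 : l q ≠ 0 := (Real.exp_pos _).ne'
  have hi0 : (P q)⁻¹ ≠ 0 := inv_ne_zero (hP0 q (hdom q.2))
  simp only [map_mul, eval_mk, mul_eq_zero, hl0, hi0, false_or, or_false] at h1 h2
  -- As `l` and `1/P` do not vanish, `a = σ = 0` means `G = F = 0`, and then `E G - F² = 0`.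
  apply hg.nondegenerate q q.2
  change D q = 0
  rw [hdet q q.2, h1, h2]
  ring

/-! ### Rational solutions of `2pσ' + p'σ = w` -/

namespace Polynomial

variable {K : Type*} [Field K]

/-- The combination `2p(Q'R - QR') - p'QR`: if `Q σ + R = 0` then `2pσ' + p'σ` is this combination
divided by `Q²`. -/
noncomputable def halfWronskian (p Q R : K[X]) : K[X] :=
  2 * p * (derivative Q * R - Q * derivative R) - derivative p * Q * R

theorem coeff_X_mul_derivative (Q : K[X]) (n : ℕ) :
    (X * derivative Q).coeff n = n * Q.coeff n := by
  cases n with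
  | zero => simp
  | succ n => rw [coeff_X_mul, coeff_derivative]; push_cast; ring

theorem natDegree_X_mul_derivative_le (Q : K[X]) : (X * derivative Q).natDegree ≤ Q.natDegree := by
  rw [natDegree_le_iff_coeff_eq_zero]
  intro n hn
  rw [coeff_X_mul_derivative, coeff_eq_zero_of_natDegree_lt hn, mul_zero]

/-- The Euler operator `X d/dX` multiplies a leading coefficient by the degree, so the extreme
coefficient is the product of the leading ones times `2 deg Q - 2 deg R - deg p`. When `deg p` is
odd this factor cannot vanish. -/
theorem coeff_X_mul_halfWronskian (p Q R : K[X]) :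
    (X * halfWronskian p Q R).coeff (p.natDegree + Q.natDegree + R.natDegree)
      = (2 * Q.natDegree - 2 * R.natDegree - p.natDegree)
        * (p.leadingCoeff * Q.leadingCoeff * R.leadingCoeff) := by
  have h3 : ∀ a b c : K[X], a.natDegree ≤ p.natDegree → b.natDegree ≤ Q.natDegree →
      c.natDegree ≤ R.natDegree →
      (a * b * c).coeff (p.natDegree + Q.natDegree + R.natDegree)
        = a.coeff p.natDegree * b.coeff Q.natDegree * c.coeff R.natDegree := by
    intro a b c ha hb hc
    rw [coeff_mul_add_eq_of_natDegree_le (natDegree_mul_le_of_le ha hb) hc,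
      coeff_mul_add_eq_of_natDegree_le ha hb]
  have e : X * halfWronskian p Q R = C 2 * (p * (X * derivative Q) * R)
      - C 2 * (p * Q * (X * derivative R)) - X * derivative p * Q * R := by
    rw [halfWronskian, show (C 2 : K[X]) = 2 from rfl]
    ring
  rw [e, coeff_sub, coeff_sub, coeff_C_mul, coeff_C_mul,
    h3 _ _ _ le_rfl (natDegree_X_mul_derivative_le Q) le_rfl,
    h3 _ _ _ le_rfl le_rfl (natDegree_X_mul_derivative_le R),
    h3 _ _ _ (natDegree_X_mul_derivative_le p) le_rfl le_rfl]
  simp only [coeff_X_mul_derivative, leadingCoeff]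
  ring

theorem le_natDegree_halfWronskian [CharZero K] {p Q R : K[X]} (hp : Odd p.natDegree) (hQ : Q ≠ 0)
    (hR : R ≠ 0) : halfWronskian p Q R ≠ 0 ∧
      p.natDegree + Q.natDegree + R.natDegree ≤ (halfWronskian p Q R).natDegree + 1 := by
  have h := coeff_X_mul_halfWronskian p Q R
  have h0 : (2 * Q.natDegree - 2 * R.natDegree - p.natDegree : K) ≠ 0 := by
    intro h
    have : (2 * Q.natDegree - 2 * R.natDegree - p.natDegree : ℤ) = 0 := by exact_mod_cast h
    obtain ⟨n, hn⟩ := hp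
    omega
  have hp0 : p ≠ 0 := by rintro rfl; simp at hp
  have hne : (X * halfWronskian p Q R).coeff (p.natDegree + Q.natDegree + R.natDegree) ≠ 0 := by
    rw [h]; simp [h0, hQ, hR, hp0]
  have hW : halfWronskian p Q R ≠ 0 := by rintro hz; simp [hz] at hne
  refine ⟨hW, ?_⟩
  rw [← natDegree_X_mul hW]
  exact le_natDegree_of_ne_zero hne

/-- The homogeneous equation is solved by the multiples of `p^(-1/2)`, and a nonzero one is not
rational when `p` has odd degree. -/
theorem eq_zero_of_halfWronskian_eq_zero [CharZero K] {p Q R : K[X]} (hp : Odd p.natDegree)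
    (hQ : Q ≠ 0) (h : halfWronskian p Q R = 0) : R = 0 := by
  by_contra hR
  exact (le_natDegree_halfWronskian hp hQ hR).1 h

theorem exists_eq_X_sub_C_pow_mul {Q : K[X]} (hQ : Q ≠ 0) (c : K) :
    ∃ (m : ℕ) (q : K[X]), Q = (X - C c) ^ m * q ∧ q.eval c ≠ 0 := by
  obtain ⟨q, h1, h2⟩ := exists_eq_pow_rootMultiplicity_mul_and_not_dvd Q hQ c
  exact ⟨_, q, h1, fun h => h2 (dvd_iff_isRoot.2 h)⟩

theorem X_sub_C_mul_derivative_pow_mul (c : K) (m : ℕ) (q : K[X]) :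
    (X - C c) * derivative ((X - C c) ^ m * q)
      = (X - C c) ^ m * (C (m : K) * q + (X - C c) * derivative q) := by
  rw [derivative_mul, derivative_pow, derivative_sub, derivative_X, derivative_C]
  cases m with
  | zero => simp
  | succ m => simp; ring

/-- At a double zero of `p`, the values of `2pσ' + p'σ` at regular points vanish. -/
theorem eq_zero_of_C_mul_eq_halfWronskian [CharZero K] {p₁ Q R : K[X]} {c w : K}
    (hp : p₁.eval c ≠ 0) (hQ : Q ≠ 0)
    (h : C w * Q ^ 2 = halfWronskian ((X - C c) ^ 2 * p₁) Q R) : w = 0 := by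
  by_contra hw
  have hR : R ≠ 0 := by
    rintro rfl
    simp [halfWronskian, hw, hQ] at h
  obtain ⟨m, q, rfl, hq⟩ := exists_eq_X_sub_C_pow_mul hQ c
  obtain ⟨n, r, rfl, hr⟩ := exists_eq_X_sub_C_pow_mul hR c
  have eq := X_sub_C_mul_derivative_pow_mul c m q
  have er := X_sub_C_mul_derivative_pow_mul c n r
  have ep : derivative ((X - C c) ^ 2 * p₁)
      = (X - C c) * (2 * p₁ + (X - C c) * derivative p₁) := by
    rw [derivative_mul, derivative_pow, derivative_sub, derivative_X, derivative_C]
    simp [show (C 2 : K[X]) = 2 from rfl]; ring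
  set t : K[X] := X - C c with ht
  have ht0 : t ≠ 0 := X_sub_C_ne_zero c
  have htc : t.eval c = 0 := by simp [ht]
  set H : K[X] := 2 * p₁ * ((C (m : K) * q + t * derivative q) * r
    - q * (C (n : K) * r + t * derivative r)) - (2 * p₁ + t * derivative p₁) * q * r with hH
  have key : C w * q ^ 2 * t ^ (2 * m) = t ^ (m + n + 1) * H := by
    have : C w * (t ^ m * q) ^ 2 = C w * q ^ 2 * t ^ (2 * m) := by ring
    rw [← this, h, halfWronskian, ep]
    have e1 : 2 * (t ^ 2 * p₁) * (derivative (t ^ m * q) * (t ^ n * r)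
        - t ^ m * q * derivative (t ^ n * r))
        = 2 * t * p₁ * ((t * derivative (t ^ m * q)) * (t ^ n * r)
        - t ^ m * q * (t * derivative (t ^ n * r))) := by ring
    rw [e1, eq, er, hH]
    ring
  have hHc : H.eval c = 2 * p₁.eval c * q.eval c * r.eval c * (m - n - 1) := by
    simp [hH, htc]; ring
  -- Orders at `c` in `key` are compared. If the left side has the smaller order, its leading value
  -- `w q(c)²` would vanish. If the orders agree, then `m = n + 1` and `H(c) = 0`. If the left side
  -- has the larger order, `H(c)` must vanish although `m ≠ n + 1`.
  rcases lt_trichotomy (2 * m) (m + n + 1) with hlt | heq | hgt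
  · obtain ⟨d, hd⟩ := Nat.exists_eq_add_of_lt hlt
    rw [show m + n + 1 = 2 * m + (d + 1) by omega, pow_add, mul_comm, mul_assoc] at key
    have := congrArg (eval c) (mul_left_cancel₀ (pow_ne_zero _ ht0) key)
    simp [htc, hw, hq] at this
  · rw [← heq, mul_comm] at key
    have := congrArg (eval c) (mul_left_cancel₀ (pow_ne_zero _ ht0) key)
    have hm : (m : K) = n + 1 := by
      have : m = n + 1 := by omega
      exact_mod_cast this
    rw [hHc, hm] at this
    simp [hw, hq] at this
  · obtain ⟨d, hd⟩ := Nat.exists_eq_add_of_lt hgt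
    rw [show 2 * m = (m + n + 1) + (d + 1) by omega, pow_add, mul_left_comm] at key
    have := congrArg (eval c) (mul_left_cancel₀ (pow_ne_zero _ ht0) key)
    rw [hHc] at this
    have hm : (m - n - 1 : K) ≠ 0 := by
      intro h0
      have : (m - n - 1 : ℤ) = 0 := by exact_mod_cast h0
      omega
    simp [htc, hp, hq, hr, hm] at this

/-- Common factors of `Q` and `R` cancel from an identity `W Q² = V · halfWronskian p Q R`, so the
fraction may be reduced. -/
theorem halfWronskian_mul_mul (p g Q R : K[X]) :
    halfWronskian p (g * Q) (g * R) = g ^ 2 * halfWronskian p Q R := by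
  simp only [halfWronskian, derivative_mul]
  ring

/-- At a zero of `Q` where `R` does not vanish, `p` has no zero unless `V` has one. -/
theorem halfWronskian_local [CharZero K] {p V W q R : K[X]} {c : K} {m : ℕ} (hm : m ≠ 0)
    (hq : q.eval c ≠ 0) (hR : R.eval c ≠ 0) (hp : p.eval c ≠ 0 ∨ (derivative p).eval c ≠ 0)
    (h : W * ((X - C c) ^ m * q) ^ 2 = V * halfWronskian p ((X - C c) ^ m * q) R) :
    V.eval c = 0 := by
  by_contra hV
  have eq := X_sub_C_mul_derivative_pow_mul c m q
  set t : K[X] := X - C c with ht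
  have ht0 : t ≠ 0 := X_sub_C_ne_zero c
  have htc : t.eval c = 0 := by simp [ht]
  obtain ⟨d, rfl⟩ := Nat.exists_eq_succ_of_ne_zero hm
  have key : t ^ (d + 1) * (W * q ^ 2 * t ^ (d + 2)) = t ^ (d + 1) * (V * (2 * p *
      ((C ((d + 1 : ℕ) : K) * q + t * derivative q) * R - t * q * derivative R)
        - t * derivative p * q * R)) := by
    have e1 : t * (V * halfWronskian p (t ^ (d + 1) * q) R)
      = V * (2 * p * ((t * derivative (t ^ (d + 1) * q)) * R - t ^ (d + 1) * q * (t * derivative R))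
        - t * derivative p * (t ^ (d + 1) * q) * R) := by
      rw [halfWronskian]; ring
    have h' := congrArg (t * ·) h
    rw [Nat.succ_eq_add_one] at eq h'
    rw [e1, eq] at h'
    linear_combination h'
  have key' := mul_left_cancel₀ (pow_ne_zero _ ht0) key
  -- The leading term at a pole of order `d + 1` is `2 (d + 1) V p q R`, which forces `p(c) = 0`
  -- when `V(c) ≠ 0`.
  have e0 := congrArg (eval c) key'
  have hd : ((d : K) + 1) ≠ 0 := by exact_mod_cast Nat.succ_ne_zero d
  have hpc : p.eval c = 0 := by
    simp only [eval_mul, eval_pow, eval_sub, eval_add, eval_C, htc, eval_ofNat] at e0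
    simpa [hV, hd, hq, hR] using e0
  obtain ⟨p₁, hpt⟩ := dvd_iff_isRoot.2 hpc
  rw [← ht] at hpt
  subst hpt
  have hdt : derivative t = 1 := by rw [ht]; simp
  have hp1 : p₁.eval c ≠ 0 := by
    rcases hp with hp | hp
    · exact absurd hpc hp
    · simpa [derivative_mul, hdt, htc] using hp
  -- At a simple zero of `p` the leading factor becomes `2 (d + 1) - 1`, which is odd and so
  -- nonzero.
  have key2 : t * (W * q ^ 2 * t ^ (d + 1)) = t * (V * (2 * p₁ *
      ((C ((d + 1 : ℕ) : K) * q + t * derivative q) * R - t * q * derivative R)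
        - (p₁ + t * derivative p₁) * q * R)) := by
    have : derivative (t * p₁) = p₁ + t * derivative p₁ := by
      rw [derivative_mul, ht, derivative_sub, derivative_X, derivative_C]; ring
    rw [this] at key'
    linear_combination key'
  have e2 := congrArg (eval c) (mul_left_cancel₀ ht0 key2)
  simp only [eval_mul, eval_pow, eval_sub, eval_add, eval_C, htc, eval_ofNat] at e2
  have : V.eval c * p₁.eval c * q.eval c * R.eval c * (2 * d + 1) = 0 := by
    push_cast at e2
    rw [pow_succ] at e2
    linear_combination - e2
  have h2 : (2 * d + 1 : K) ≠ 0 := by exact_mod_cast Nat.succ_ne_zero (2 * d)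
  simp [hV, hp1, hq, hR, h2] at this

/-- If `V` and `p` both have a simple zero at a zero of `Q` where `R` does not vanish, then that
zero of `Q` is simple. -/
theorem halfWronskian_local_simple [CharZero K] {p₁ W q R : K[X]} {c : K} {m : ℕ}
    (hq : q.eval c ≠ 0) (hR : R.eval c ≠ 0) (hp : p₁.eval c ≠ 0)
    (h : W * ((X - C c) ^ m * q) ^ 2
      = (X - C c) * halfWronskian ((X - C c) * p₁) ((X - C c) ^ m * q) R) : m ≤ 1 := by
  by_contra! hm
  obtain ⟨d, rfl⟩ : ∃ d, m = d + 2 := ⟨m - 2, by omega⟩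
  have eq := X_sub_C_mul_derivative_pow_mul c (d + 2) q
  set t : K[X] := X - C c with ht
  have ht0 : t ≠ 0 := X_sub_C_ne_zero c
  have htc : t.eval c = 0 := by simp [ht]
  -- A zero of `Q` of order `d + 2` gives the left side order at least `2d + 4`, but the right side
  -- order `d + 3` with leading factor `2 (d + 2) - 1 ≠ 0`. For a simple zero the two orders could
  -- agree.
  have key : t ^ (d + 3) * (W * q ^ 2 * t ^ (d + 1)) = t ^ (d + 3) * (2 * p₁ *
      ((C ((d + 2 : ℕ) : K) * q + t * derivative q) * R - t * q * derivative R)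
        - (p₁ + t * derivative p₁) * q * R) := by
    have : derivative (t * p₁) = p₁ + t * derivative p₁ := by
      rw [derivative_mul, ht, derivative_sub, derivative_X, derivative_C]; ring
    have e1 : t * halfWronskian (t * p₁) (t ^ (d + 2) * q) R
      = t * (2 * p₁ * ((t * derivative (t ^ (d + 2) * q)) * R - t ^ (d + 2) * q * (t * derivative R))
        - (p₁ + t * derivative p₁) * (t ^ (d + 2) * q) * R) := by
      rw [halfWronskian, this]; ring
    rw [e1, eq] at h
    linear_combination h
  have e2 := congrArg (eval c) (mul_left_cancel₀ (pow_ne_zero _ ht0) key)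
  simp only [eval_mul, eval_pow, eval_sub, eval_add, eval_C, htc, eval_ofNat] at e2
  have : p₁.eval c * q.eval c * R.eval c * (2 * d + 3) = 0 := by
    push_cast at e2
    rw [pow_succ] at e2
    linear_combination - e2
  have h2 : (2 * d + 3 : K) ≠ 0 := by exact_mod_cast Nat.succ_ne_zero (2 * d + 2)
  simp [hp, hq, hR, h2] at this

/-- The differential equation `2pσ' + p'σ = W / (y - x)` of elliptic type, `p = y (y - 1) (y - x)`,
has no rational solution other than zero. -/
theorem eq_zero_of_halfWronskian_elliptic [CharZero K] [IsAlgClosed K] {x : K} (hx0 : x ≠ 0)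
    (hx1 : x ≠ 1) {W Q R : K[X]} (hW : W.natDegree ≤ 1) (hQ : Q ≠ 0)
    (h : W * Q ^ 2 = (X - C x) * halfWronskian ((X - C x) * (X * (X - C 1))) Q R) :
    W = 0 ∧ R = 0 := by
  induction hn : Q.natDegree using Nat.strong_induction_on generalizing Q R with
  -- Induction on the degree of `Q`: a common root of `Q` and `R` is divided out, so `R/Q` may be
  -- taken reduced.
  | _ n ih =>
  subst hn
  have hQ2 : Q ^ 2 ≠ 0 := pow_ne_zero _ hQ
  by_cases hR : R = 0
  · refine ⟨?_, hR⟩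
    simpa [hR, halfWronskian, hQ] using h
  exfalso
  have hdeg : ((X - C x) * (X * (X - C 1)) : K[X]).natDegree = 3 := by
    rw [natDegree_mul (X_sub_C_ne_zero _) (mul_ne_zero X_ne_zero (X_sub_C_ne_zero _)),
      natDegree_mul X_ne_zero (X_sub_C_ne_zero _), natDegree_X, natDegree_X_sub_C, natDegree_X_sub_C]
  obtain ⟨hH, hle⟩ := le_natDegree_halfWronskian (p := (X - C x) * (X * (X - C 1)))
    (by rw [hdeg]; decide) hQ hR
  rw [hdeg] at hle
  have hW0 : W ≠ 0 := by
    rintro rfl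
    rw [zero_mul] at h
    exact (mul_ne_zero (X_sub_C_ne_zero x) hH) h.symm
  have hd := congrArg natDegree h
  rw [natDegree_mul hW0 hQ2, natDegree_pow, natDegree_mul (X_sub_C_ne_zero x) hH,
    natDegree_X_sub_C] at hd
  -- From the degree bound, `deg W + 2 deg Q ≥ 3 + deg Q + deg R`, and `deg W ≤ 1`.
  have hQd : 2 ≤ Q.natDegree := by omega
  have hroot : ∀ c, Q.eval c = 0 → R.eval c ≠ 0 := by
    intro c hc hRc
    obtain ⟨Q', rfl⟩ := dvd_iff_isRoot.2 hc
    obtain ⟨R', rfl⟩ := dvd_iff_isRoot.2 hRc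
    have hQ' : Q' ≠ 0 := right_ne_zero_of_mul hQ
    refine hR ?_
    rw [(ih Q'.natDegree ?_ (R := R') hQ' ?_ rfl).2, mul_zero]
    · rw [natDegree_mul (X_sub_C_ne_zero c) hQ', natDegree_X_sub_C]; omega
    · rw [halfWronskian_mul_mul, mul_pow] at h
      have : (X - C c) ^ 2 ≠ 0 := pow_ne_zero 2 (X_sub_C_ne_zero c)
      exact mul_left_cancel₀ this (by linear_combination h)
  -- The roots of the cubic are simple, so poles of the fraction can lie only at the zero `x` of `V
  -- = X - C x`. There a pole is at most simple, which contradicts `2 ≤ deg Q`.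
  have honly : ∀ c, Q.eval c = 0 → c = x := by
    intro c hc
    obtain ⟨m, q, rfl, hq⟩ := exists_eq_X_sub_C_pow_mul hQ c
    have hm : m ≠ 0 := by rintro rfl; simp [hq] at hc
    have := halfWronskian_local hm hq (hroot c hc) ?_ h
    · simpa [sub_eq_zero] using this
    · by_contra! hcon
      obtain ⟨h1, h2⟩ := hcon
      simp only [eval_mul, eval_sub, eval_X, eval_C, mul_eq_zero, sub_eq_zero] at h1
      simp [derivative_mul] at h2
      rcases h1 with rfl | rfl | rfl
      · simp [hx0, sub_eq_zero, hx1] at h2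
      · simp [hx0] at h2
      · simp [sub_eq_zero, hx1.symm] at h2
  obtain ⟨m, q, rfl, hq⟩ := exists_eq_X_sub_C_pow_mul hQ x
  have hq0 : q ≠ 0 := right_ne_zero_of_mul hQ
  have hqc : q.natDegree = 0 := by
    by_contra hq1
    obtain ⟨c, hc⟩ := IsAlgClosed.exists_root q (by
      rw [degree_eq_natDegree hq0]; exact_mod_cast hq1)
    have := honly c (by rw [eval_mul, hc, mul_zero])
    exact hq (this ▸ hc)
  have hm2 : 2 ≤ m := by
    rw [natDegree_mul (pow_ne_zero _ (X_sub_C_ne_zero x)) hq0, natDegree_pow, natDegree_X_sub_C,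
      hqc] at hQd
    omega
  have hxr : ((X - C x) ^ m * q).eval x = 0 := by
    simp [show m ≠ 0 by omega]
  have := halfWronskian_local_simple hq (hroot x hxr)
    (by simp [hx0, sub_eq_zero, hx1]) h
  omega

/-- A solution of `V (2pσ' + p'σ) = W` that is a rational function `-R/Q` on an interval gives a
polynomial identity. -/
theorem mul_sq_eq_mul_halfWronskian {p V W Q R : ℝ[X]} {c d : ℝ} (hcd : c < d) {σ σ' : ℝ → ℝ}
    (hσ : ∀ y ∈ Ioo c d, HasDerivAt σ (σ' y) y)
    (hode : ∀ y ∈ Ioo c d,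
      V.eval y * (2 * p.eval y * σ' y + (derivative p).eval y * σ y) = W.eval y)
    (hQR : ∀ y ∈ Ioo c d, Q.eval y * σ y + R.eval y = 0) :
    W * Q ^ 2 = V * halfWronskian p Q R := by
  refine eq_of_infinite_eval_eq _ _ ((Ioo_infinite hcd).mono fun y hy => ?_)
  have hder : HasDerivAt (fun y => Q.eval y * σ y + R.eval y)
      ((derivative Q).eval y * σ y + Q.eval y * σ' y + (derivative R).eval y) y :=
    ((Q.hasDerivAt y).mul (hσ y hy)).add (R.hasDerivAt y)
  have h0 : (fun y => Q.eval y * σ y + R.eval y) =ᶠ[nhds y] fun _ => 0 :=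
    Filter.eventuallyEq_of_mem (isOpen_Ioo.mem_nhds hy) hQR
  have hd := (hder.congr_of_eventuallyEq h0.symm).unique (hasDerivAt_const y (0 : ℝ))
  have h1 := hode y hy
  have h2 := hQR y hy
  simp only [halfWronskian, mem_ofPred_eq, eval_mul, eval_pow, eval_sub, eval_ofNat]
  rw [← h1]
  generalize (derivative p).eval y = a at *
  generalize (derivative Q).eval y = b at *
  generalize (derivative R).eval y = e at *
  generalize p.eval y = f at *
  generalize Q.eval y = g at *
  generalize R.eval y = i at *
  generalize V.eval y = j at *
  linear_combination 2 * j * f * g * hd + (j * a * g - 2 * j * f * b) * h2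

theorem eq_zero_of_eval_eq_zero_on_Ioo {p : ℝ[X]} {c d : ℝ} (hcd : c < d)
    (h : ∀ y ∈ Ioo c d, p.eval y = 0) : p = 0 :=
  eq_zero_of_infinite_isRoot p ((Ioo_infinite hcd).mono h)

theorem exists_eval_ne_zero_on_Ioo {p : ℝ[X]} (hp : p ≠ 0) {c d : ℝ} (hcd : c < d) :
    ∃ y ∈ Ioo c d, p.eval y ≠ 0 := by
  by_contra! h
  exact hp (eq_zero_of_eval_eq_zero_on_Ioo hcd h)

theorem coeffs_eq_zero_of_forall_Ioo {c d : ℝ} (hcd : c < d) {a₀ a₁ a₂ a₃ a₄ a₅ : ℝ}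
    (h : ∀ y ∈ Ioo c d,
      a₀ + a₁ * y + a₂ * y ^ 2 + a₃ * y ^ 3 + a₄ * y ^ 4 + a₅ * y ^ 5 = 0) :
    a₀ = 0 ∧ a₁ = 0 ∧ a₂ = 0 ∧ a₃ = 0 ∧ a₄ = 0 ∧ a₅ = 0 := by
  have h0 : C a₀ + C a₁ * X ^ 1 + C a₂ * X ^ 2 + C a₃ * X ^ 3 + C a₄ * X ^ 4 + C a₅ * X ^ 5 = 0 :=
    eq_zero_of_eval_eq_zero_on_Ioo hcd fun y hy => by
      simp only [eval_add, eval_mul, eval_C, eval_pow, eval_X]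
      linear_combination h y hy
  refine ⟨?_, ?_, ?_, ?_, ?_, ?_⟩
  · simpa [coeff_X_pow, coeff_C, -map_mul] using congrArg (coeff · 0) h0
  · simpa [coeff_X, coeff_C] using congrArg (coeff · 1) h0
  · simpa [coeff_X, coeff_C] using congrArg (coeff · 2) h0
  · simpa [coeff_X, coeff_C] using congrArg (coeff · 3) h0
  · simpa [coeff_X, coeff_C] using congrArg (coeff · 4) h0
  · simpa [coeff_X, coeff_C] using congrArg (coeff · 5) h0

end Polynomial

/-! ### Partial derivatives and restriction to vertical lines -/

theorem Derivation.apply_of_mul_eq_one {R : Type*} [CommRing R] [Algebra ℝ R]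
    (D : Derivation ℝ R R) {f g : R} (h : g * f = 1) : D g = -(g ^ 2 * D f) := by
  rw [D.leibniz_of_mul_eq_one h, smul_eq_mul, neg_mul]

theorem hasDerivAt_vec_snd (x y : ℝ) :
    HasDerivAt (fun t => (![x, t] : Plane)) (Pi.single 1 1) y := by
  rw [hasDerivAt_pi]
  intro i
  fin_cases i
  · simpa using hasDerivAt_const y x
  · simpa using hasDerivAt_id' y

theorem hasDerivAt_vec_fst (x y : ℝ) :
    HasDerivAt (fun t => (![t, y] : Plane)) (Pi.single 0 1) x := by
  rw [hasDerivAt_pi]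
  intro i
  fin_cases i
  · simpa using hasDerivAt_id' x
  · simpa using hasDerivAt_const x y

theorem vec_eta (q : Plane) : (![q 0, q 1] : Plane) = q := by
  ext i; fin_cases i <;> rfl

theorem hasDerivAt_partialDeriv_one {F : Plane → ℝ} {x y : ℝ} (h : DifferentiableAt ℝ F ![x, y]) :
    HasDerivAt (fun t => F ![x, t]) (partialDeriv 1 F ![x, y]) y :=
  h.hasFDerivAt.comp_hasDerivAt y (hasDerivAt_vec_snd x y)

theorem hasDerivAt_partialDeriv_zero {F : Plane → ℝ} {x y : ℝ} (h : DifferentiableAt ℝ F ![x, y]) :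
    HasDerivAt (fun t => F ![t, y]) (partialDeriv 0 F ![x, y]) x :=
  h.hasFDerivAt.comp_hasDerivAt x (hasDerivAt_vec_fst x y)

theorem partialDeriv_one_eq {F : Plane → ℝ} {q : Plane} {d : ℝ} (hF : DifferentiableAt ℝ F q)
    (h : HasDerivAt (fun t => F ![q 0, t]) d (q 1)) : partialDeriv 1 F q = d := by
  rw [← vec_eta q] at hF
  have := (hasDerivAt_partialDeriv_one hF).unique h
  rwa [vec_eta] at this

theorem partialDeriv_zero_eq {F : Plane → ℝ} {q : Plane} {d : ℝ} (hF : DifferentiableAt ℝ F q)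
    (h : HasDerivAt (fun t => F ![t, q 1]) d (q 0)) : partialDeriv 0 F q = d := by
  rw [← vec_eta q] at hF
  have := (hasDerivAt_partialDeriv_zero hF).unique h
  rwa [vec_eta] at this

theorem exists_vertical_segment (U : Opens Plane) {q : Plane} (hq : q ∈ U) :
    ∃ ε > 0, ∀ y ∈ Ioo (q 1 - ε) (q 1 + ε), (![q 0, y] : Plane) ∈ U := by
  have hc : ContinuousAt (fun t => (![q 0, t] : Plane)) (q 1) :=
    (hasDerivAt_vec_snd (q 0) (q 1)).continuousAt
  have := hc.eventually (p := fun r => r ∈ U) (by simp only [vec_eta]; exact U.isOpen.mem_nhds hq)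
  obtain ⟨ε, hε, h⟩ := Metric.eventually_nhds_iff.1 this
  refine ⟨ε, hε, fun y hy => h ?_⟩
  rw [Real.dist_eq, abs_lt]
  constructor <;> linarith [hy.1, hy.2]

namespace smoothFunctions

variable {U : Opens Plane}

/-- The coordinate functions. -/
def coord (i : Fin 2) : smoothFunctions U := mk (fun q => q i) (contDiff_apply ℝ ℝ i).contDiffOn

theorem eval_coord (i : Fin 2) (q : U) : eval q (coord i) = (q : Plane) i := rfl

theorem der_coord (i j : Fin 2) : der i (coord j : smoothFunctions U) = if i = j then 1 else 0 :=
  ext_eval fun q => by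
    rw [coord, eval_der_mk]
    have : fderiv ℝ (fun p : Plane => p j) q = ContinuousLinearMap.proj j :=
      (ContinuousLinearMap.proj (R := ℝ) (φ := fun _ : Fin 2 => ℝ) j).fderiv
    rw [partialDeriv, this]
    fin_cases i <;> fin_cases j <;> simp

/-- The inverse of a nowhere vanishing function. -/
theorem exists_inv {f : smoothFunctions U} (hf : ∀ q, eval q f ≠ 0) :
    ∃ g : smoothFunctions U, (∀ q, eval q g = (eval q f)⁻¹) ∧
      ∀ D : Derivation ℝ (smoothFunctions U) (smoothFunctions U), D g = -(g ^ 2 * D f) := by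
  obtain ⟨F, hF, rfl⟩ := mk_surj f
  have hF0 : ∀ q ∈ (U : Set Plane), F q ≠ 0 := fun q hq => hf ⟨q, hq⟩
  refine ⟨mk (fun q => (F q)⁻¹) (hF.inv hF0), fun q => rfl, fun D => ?_⟩
  have h1 : mk (fun q => (F q)⁻¹) (hF.inv hF0) * mk F hF = 1 := ext_eval fun q => by
    rw [map_mul, map_one]
    exact inv_mul_cancel₀ (hF0 q q.2)
  exact D.apply_of_mul_eq_one h1

theorem hasDerivAt_extend (f : smoothFunctions U) {x y : ℝ} (h : (![x, y] : Plane) ∈ U) :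
    HasDerivAt (fun t => extend f ![x, t]) (eval ⟨_, h⟩ (der 1 f)) y :=
  hasDerivAt_partialDeriv_one ((contDiffOn_extend f).differentiableAt_of_mem U.isOpen h)

theorem eval_eq_of_der_eq_zero {f : smoothFunctions U} (hf : der 1 f = 0) {x c d : ℝ}
    (h : ∀ y ∈ Ioo c d, (![x, y] : Plane) ∈ U) {y z : ℝ} (hy : y ∈ Ioo c d) (hz : z ∈ Ioo c d) :
    eval ⟨_, h y hy⟩ f = eval ⟨_, h z hz⟩ f := by
  have hd : ∀ t ∈ Ioo c d, HasDerivAt (fun t => extend f ![x, t]) 0 t := fun t ht => by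
    simpa [hf] using hasDerivAt_extend f (h t ht)
  have := isOpen_Ioo.is_const_of_deriv_eq_zero isPreconnected_Ioo
    (fun t ht => (hd t ht).differentiableAt.differentiableWithinAt)
    (fun t ht => (hd t ht).deriv) hy hz
  simpa only [extend_apply f ⟨_, h y hy⟩, extend_apply f ⟨_, h z hz⟩] using this

end smoothFunctions

open smoothFunctions in
/-- The restriction of a solution of the linearised metrisability equations to a vertical line. -/
theorem LiouvilleSystem.exists_line {U : Opens Plane} {P N ρ B a k σ τ : smoothFunctions U}
    (sys : LiouvilleSystem (der 0) (der 1) P N ρ B a k σ τ) {p : Plane} (hp : p ∈ U) :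
    ∃ (c d : ℝ) (hseg : ∀ y ∈ Ioo c d, (![p 0, y] : Plane) ∈ U) (s s' : ℝ → ℝ)
      (A K K₁ K₂ : ℝ), c < d ∧ ∀ y (hy : y ∈ Ioo c d), HasDerivAt s (s' y) y ∧
        eval ⟨_, hseg y hy⟩ σ = s y ∧ eval ⟨_, hseg y hy⟩ (der 1 σ) = s' y ∧
        eval ⟨_, hseg y hy⟩ a = A ∧ eval ⟨_, hseg y hy⟩ k = K ∧
        eval ⟨_, hseg y hy⟩ (der 0 k) = K₁ ∧ eval ⟨_, hseg y hy⟩ (der 0 (der 0 k)) = K₂ := by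
  obtain ⟨ε, hε, hseg⟩ := exists_vertical_segment U hp
  have hpm : p 1 ∈ Ioo (p 1 - ε) (p 1 + ε) := ⟨by linarith, by linarith⟩
  -- Since the partial derivatives commute, `k_x` and `k_xx` are also constant on the vertical line.
  have e1 : der 1 (der 0 k) = 0 := by rw [← sys.comm, sys.yk, map_zero]
  have e2 : der 1 (der 0 (der 0 k)) = 0 := by rw [← sys.comm, e1, map_zero]
  have hd : ∀ y (hy : y ∈ Ioo (p 1 - ε) (p 1 + ε)),
      HasDerivAt (fun t => extend σ ![p 0, t]) (eval ⟨_, hseg y hy⟩ (der 1 σ)) y :=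
    fun y hy => hasDerivAt_extend σ (hseg y hy)
  refine ⟨p 1 - ε, p 1 + ε, hseg, fun t => extend σ ![p 0, t],
    deriv (fun t => extend σ ![p 0, t]), _, _, _, _, by linarith, fun y hy =>
    ⟨(hd y hy).differentiableAt.hasDerivAt, (extend_apply σ ⟨_, hseg y hy⟩).symm,
      (hd y hy).deriv.symm, eval_eq_of_der_eq_zero sys.ya hseg hy hpm,
      eval_eq_of_der_eq_zero sys.yk hseg hy hpm, eval_eq_of_der_eq_zero e1 hseg hy hpm,
      eval_eq_of_der_eq_zero e2 hseg hy hpm⟩⟩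

/-! ### The fourth Painlevé equation -/

open Polynomial (X C) in
open scoped Polynomial in
open smoothFunctions in
-- Here `P = y` and `N = ρ = 0`. The obstruction makes `σ` rational on vertical lines, whereas
-- nonzero homogeneous solutions are multiples of `y^(-1/2)`.
theorem not_isMetrisableAt_painleveIV (α β : ℝ) {p : Plane} :
    ¬ (painleveIV α β).IsMetrisableAt p := by
  intro h
  have hdom : ∀ q ∈ (painleveIV α β).dom, q 1 ≠ 0 := fun q hq => hq
  have hc : ∀ i, ContDiff ℝ ∞ fun q : Plane => q i := fun i => contDiff_apply ℝ ℝ i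
  obtain ⟨U, hU, a, k, σ, τ, hp, sys, nd⟩ := exists_liouvilleSystem_of_isMetrisableAt h
    (P := fun q => q 1) (N := fun _ => 0) (ρ := fun _ => 0)
    (B := fun q => 3 / 2 * q 1 ^ 2 + 4 * q 0 * q 1 + 2 * (q 0 ^ 2 - α) + β * (q 1)⁻¹ ^ 2)
    (hc 1).contDiffOn contDiffOn_const contDiffOn_const
    (((by fun_prop : ContDiff ℝ ∞ fun q : Plane =>
      3 / 2 * q 1 ^ 2 + 4 * q 0 * q 1 + 2 * (q 0 ^ 2 - α)).contDiffOn).add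
      (contDiffOn_const.mul (((hc 1).contDiffOn.inv hdom).pow 2)))
    hdom
    (fun q hq => partialDeriv_zero_eq ((hc 1).differentiable (by simp) q)
      (by simpa using hasDerivAt_const (q 0) (q 1)))
    (fun q hq => by simp [partialDeriv])
    (fun q hq v => by
      rw [partialDeriv_one_eq (d := 1) ((hc 1).differentiable (by simp) q)
        (by simpa using hasDerivAt_id' (q 1))]
      have := hdom q hq
      simp only [painleveIV]
      field_simp
      ring)
  have hy0 : ∀ q : U, eval q (coord 1) ≠ 0 := fun q => hdom q (hU q.2)
  obtain ⟨iy, eiy, diy⟩ := exists_inv hy0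
  have eP : ∀ h, mk (fun q : Plane => q 1) h = (coord 1 : smoothFunctions U) := fun _ => rfl
  have e0 : ∀ h, mk (fun _ : Plane => (0 : ℝ)) h = (0 : smoothFunctions U) := fun _ => rfl
  have eB : ∀ h, mk (fun q : Plane => 3 / 2 * q 1 ^ 2 + 4 * q 0 * q 1 + 2 * (q 0 ^ 2 - α)
      + β * (q 1)⁻¹ ^ 2) h = (algebraMap ℝ (smoothFunctions U) (3 / 2) * coord 1 ^ 2
        + 4 * coord 0 * coord 1 + 2 * (coord 0 ^ 2 - algebraMap ℝ _ α)
        + algebraMap ℝ _ β * iy ^ 2) := fun _ => ext_eval fun q => by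
    simp [eval_mk, eval_coord, eiy, map_ofNat]
  rw [eP, e0, eB] at sys
  have obs := sys.obstruction (D := fun f => 2 * coord 1 * der 1 f + der 1 (coord 1) * f)
    (fun _ => rfl) rfl
  obtain ⟨c, d, hseg, s, s', A, K, K₁, K₂, hcd, line⟩ := sys.exists_line hp
  have d00 : der 0 (coord 0 : smoothFunctions U) = 1 := der_coord 0 0
  have d01 : der 0 (coord 1 : smoothFunctions U) = 0 := der_coord 0 1
  have d10 : der 1 (coord 0 : smoothFunctions U) = 0 := der_coord 1 0
  have d11 : der 1 (coord 1 : smoothFunctions U) = 1 := der_coord 1 1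
  simp [diy, d00, d01, d10, d11, pow_succ, Derivation.apply_ofNat] at obs
  have key : ∀ y ∈ Ioo c d, (30 * y ^ 4 + 24 * p 0 * y ^ 3 + 12 * β) * s y
      + (K * (30 * y ^ 4 + 48 * p 0 * y ^ 3 + 8 * (p 0 ^ 2 - α) * y ^ 2 - 12 * β)
        - A * (24 * y ^ 3 + 8 * p 0 * y ^ 2) - 2 * K₂ * y ^ 2) = 0 := by
    intro y hy
    have e := congrArg (eval ⟨_, hseg y hy⟩) obs
    have hyne : y ≠ 0 := hdom _ (hU (hseg y hy))
    obtain ⟨-, l1, l2, l3, l4, l5, l6⟩ := line y hy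
    simp only [eval_coord, eiy, l1, l2, l3, l4, l5, l6, map_add, map_sub, map_neg, map_mul,
      map_ofNat, AlgHom.commutes, Algebra.algebraMap_self, RingHom.id_apply, map_zero, map_one,
      Matrix.cons_val_zero, Matrix.cons_val_one] at e
    linear_combination (norm := (field_simp; ring)) y ^ 2 * e
  have hode : ∀ y ∈ Ioo c d, 2 * y * s' y + s y = K := by
    intro y hy
    have e := congrArg (eval ⟨_, hseg y hy⟩) sys.yσ
    obtain ⟨-, l1, l2, l3, l4, l5, l6⟩ := line y hy
    simpa [d11, eval_coord, l1, l2, l3, l4, map_ofNat] using e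
  set Q : ℝ[X] := C 30 * X ^ 4 + C (24 * p 0) * X ^ 3 + C (12 * β) with hQ
  set R : ℝ[X] := C (60 * K) * X ^ 4 + C (72 * p 0 * K - 24 * A) * X ^ 3
    + C (8 * (p 0 ^ 2 - α) * K - 8 * p 0 * A - 2 * K₂) * X ^ 2 with hR
  have hQ0 : Q ≠ 0 := fun h => by
    have := (Polynomial.coeffs_eq_zero_of_forall_Ioo hcd (a₀ := 12 * β) (a₁ := 0) (a₂ := 0)
      (a₃ := 24 * p 0) (a₄ := 30) (a₅ := 0) fun y _ => by
        have := congrArg (Polynomial.eval y) h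
        simp [hQ] at this
        linear_combination this).2.2.2.2.1
    norm_num at this
  -- The constant `K` is a particular solution of `2yσ' + σ = K`, so `σ - K` is a rational solution
  -- of the homogeneous equation. The term `K Q` has been absorbed into `R`.
  have hW := Polynomial.mul_sq_eq_mul_halfWronskian (p := X) (V := C 1) (W := 0) (Q := Q) (R := R)
    hcd (σ := fun y => s y - K) (σ' := s') (fun y hy => (line y hy).1.sub_const K)
    (fun y hy => by simp; linear_combination hode y hy)
    (fun y hy => by simp [hQ, hR]; linear_combination key y hy)
  have hR0 : R = 0 := Polynomial.eq_zero_of_halfWronskian_eq_zero (p := X) (by simp) hQ0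
    (by simpa using hW.symm)
  obtain ⟨-, -, -, c3, c4, -⟩ := Polynomial.coeffs_eq_zero_of_forall_Ioo hcd (a₀ := 0) (a₁ := 0)
    (a₂ := 8 * (p 0 ^ 2 - α) * K - 8 * p 0 * A - 2 * K₂)
    (a₃ := 72 * p 0 * K - 24 * A) (a₄ := 60 * K) (a₅ := 0) fun y _ => by
      have := congrArg (Polynomial.eval y) hR0
      simp [hR] at this
      linear_combination this
  have hK : K = 0 := by linarith
  subst hK
  obtain ⟨y, hy, hQy⟩ := Polynomial.exists_eval_ne_zero_on_Ioo hQ0 hcd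
  obtain ⟨-, l1, -, l3, -⟩ := line y hy
  refine nd ⟨_, hseg y hy⟩ ⟨by rw [l3]; linarith, ?_⟩
  rw [l1]
  have h1 := key y hy
  have h2 := congrArg (Polynomial.eval y) hR0
  simp [hR] at h2
  have h3 : Q.eval y * s y = 0 := by
    simp only [hQ, Polynomial.eval_add, Polynomial.eval_mul, Polynomial.eval_C, Polynomial.eval_pow,
      Polynomial.eval_X]
    linear_combination h1 - h2
  exact (mul_eq_zero.1 h3).resolve_left hQy

/-! ### The first and second Painlevé equations -/

open smoothFunctions in
-- With `P = 1` the obstruction reads `48σ + 96 y k = 2 k_xx`. Its `y`-derivative, with `2σ_y = k`,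
-- gives `120 k = 0`; then `σ = 0`, and `compat` reduces to `a = 0`.
theorem not_isMetrisableAt_painleveI {p : Plane} : ¬ painleveI.IsMetrisableAt p := by
  intro h
  obtain ⟨U, hU, a, k, σ, τ, hp, sys, nd⟩ := exists_liouvilleSystem_of_isMetrisableAt h
    (P := fun _ => 1) (N := fun _ => 0) (ρ := fun _ => 0) (B := fun q => 6 * q 1 ^ 2 + q 0)
    contDiffOn_const contDiffOn_const contDiffOn_const
    (by fun_prop) (by simp) (by simp [partialDeriv]) (by simp [partialDeriv])
    (fun q hq v => by simp [painleveI, partialDeriv])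
  have eP : ∀ h, mk (fun _ : Plane => (1 : ℝ)) h = (1 : smoothFunctions U) := fun _ => rfl
  have e0 : ∀ h, mk (fun _ : Plane => (0 : ℝ)) h = (0 : smoothFunctions U) := fun _ => rfl
  have eB : ∀ h, mk (fun q : Plane => 6 * q 1 ^ 2 + q 0) h
      = (6 * coord 1 ^ 2 + coord 0 : smoothFunctions U) := fun _ => ext_eval fun q => by
    simp [eval_mk, eval_coord, map_ofNat]
  rw [eP, e0, eB] at sys
  have obs := sys.obstruction (D := fun f => 2 * 1 * der 1 f + der 1 1 * f) (fun _ => rfl) rfl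
  have com := sys.compat
  have d00 : der 0 (coord 0 : smoothFunctions U) = 1 := der_coord 0 0
  have d01 : der 0 (coord 1 : smoothFunctions U) = 0 := der_coord 0 1
  have d10 : der 1 (coord 0 : smoothFunctions U) = 0 := der_coord 1 0
  have d11 : der 1 (coord 1 : smoothFunctions U) = 1 := der_coord 1 1
  have yσ := sys.yσ
  have yk2 : der 1 (der 0 (der 0 k)) = 0 := by
    rw [← sys.comm, ← sys.comm, sys.yk, map_zero, map_zero]
  simp [d00, d01, d10, d11, pow_succ, Derivation.apply_ofNat] at obs com yσ
  have obs' := congrArg (der 1) obs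
  simp [d11, sys.yk, yk2, Derivation.apply_ofNat] at obs'
  have hk : k = 0 := ext_eval fun q => by
    have e1 := congrArg (eval q) obs'
    have e2 := congrArg (eval q) yσ
    simp [map_ofNat] at e1 e2 ⊢
    linarith
  have hσ : σ = 0 := ext_eval fun q => by
    have e1 := congrArg (eval q) obs
    simp [map_ofNat, hk] at e1 ⊢
    linarith
  refine nd ⟨p, hp⟩ ⟨?_, by simp [hσ]⟩
  have e1 := congrArg (eval ⟨p, hp⟩) com
  simpa [map_ofNat, hk, hσ] using e1

open smoothFunctions in
-- Now the coefficient of `σ` in the obstruction is `48 y`, so two `y`-derivatives are needed. With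
-- `σ_yy = 0` and `2σ_y = k` the second one gives `k = 0`; the first derivative then gives `σ = 0`,
-- and the obstruction itself `a = 0`.
theorem not_isMetrisableAt_painleveII (α : ℝ) {p : Plane} :
    ¬ (painleveII α).IsMetrisableAt p := by
  intro h
  obtain ⟨U, hU, a, k, σ, τ, hp, sys, nd⟩ := exists_liouvilleSystem_of_isMetrisableAt h
    (P := fun _ => 1) (N := fun _ => 0) (ρ := fun _ => 0)
    (B := fun q => 2 * q 1 ^ 3 + q 0 * q 1 + α)
    contDiffOn_const contDiffOn_const contDiffOn_const
    (by fun_prop) (by simp) (by simp [partialDeriv]) (by simp [partialDeriv])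
    (fun q hq v => by simp [painleveII, partialDeriv])
  have eP : ∀ h, mk (fun _ : Plane => (1 : ℝ)) h = (1 : smoothFunctions U) := fun _ => rfl
  have e0 : ∀ h, mk (fun _ : Plane => (0 : ℝ)) h = (0 : smoothFunctions U) := fun _ => rfl
  have eB : ∀ h, mk (fun q : Plane => 2 * q 1 ^ 3 + q 0 * q 1 + α) h
      = (2 * coord 1 ^ 3 + coord 0 * coord 1 + algebraMap ℝ (smoothFunctions U) α) :=
    fun _ => ext_eval fun q => by simp [eval_mk, eval_coord, map_ofNat]
  rw [eP, e0, eB] at sys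
  have obs := sys.obstruction (D := fun f => 2 * 1 * der 1 f + der 1 1 * f) (fun _ => rfl) rfl
  have d00 : der 0 (coord 0 : smoothFunctions U) = 1 := der_coord 0 0
  have d01 : der 0 (coord 1 : smoothFunctions U) = 0 := der_coord 0 1
  have d10 : der 1 (coord 0 : smoothFunctions U) = 0 := der_coord 1 0
  have d11 : der 1 (coord 1 : smoothFunctions U) = 1 := der_coord 1 1
  have yσ := sys.yσ
  have yk2 : der 1 (der 0 (der 0 k)) = 0 := by
    rw [← sys.comm, ← sys.comm, sys.yk, map_zero, map_zero]
  simp [d00, d01, d10, d11, pow_succ, Derivation.apply_ofNat] at obs yσ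
  have obs' := congrArg (der 1) obs
  simp [d10, d11, sys.yk, sys.ya, yk2, Derivation.apply_ofNat] at obs'
  have yσ' := congrArg (der 1) yσ
  simp [sys.yk, Derivation.apply_ofNat] at yσ'
  have obs'' := congrArg (der 1) obs'
  simp [d10, d11, sys.yk, sys.ya, yk2, Derivation.apply_ofNat] at obs''
  have hk : k = 0 := ext_eval fun q => by
    have e1 := congrArg (eval q) obs''
    have e2 := congrArg (eval q) yσ
    have e3 := congrArg (eval q) yσ'
    simp only [map_add, map_sub, map_neg, map_mul, map_ofNat, map_zero, eval_coord, map_one]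
      at e1 e2 e3 ⊢
    have e4 : eval q (der 1 (der 1 σ)) = 0 := by linarith
    rw [e4] at e1
    linarith
  have hσ : σ = 0 := ext_eval fun q => by
    have e1 := congrArg (eval q) obs'
    have e2 := congrArg (eval q) yσ
    simp [map_ofNat, hk] at e1 e2 ⊢
    rw [e2] at e1
    linarith
  refine nd ⟨p, hp⟩ ⟨?_, by simp [hσ]⟩
  have e1 := congrArg (eval ⟨p, hp⟩) obs
  simp [map_ofNat, hk, hσ] at e1
  linarith

/-! ### The third Painlevé equation: necessary conditions -/

theorem partialDeriv_one_pow_two (q : Plane) : partialDeriv 1 (fun q => q 1 ^ 2) q = 2 * q 1 :=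
  partialDeriv_one_eq (((contDiff_apply ℝ ℝ 1).pow 2).differentiable (n := 1) (by simp) q)
    (by simpa using (hasDerivAt_id' (q 1)).fun_pow 2)

open Polynomial (X C) in
open scoped Polynomial in
open smoothFunctions in
-- Here `P = y²`, of even degree, so the homogeneous solutions `b / y` are rational and survive. The
-- double root forces `K = 0`; inserting `σ = b / y` in the obstruction leaves `x b - A` times `α,
-- γ` and `x b + A` times `β, δ`. Unless one pair of parameters vanishes, both factors do.
theorem painleveIII_of_isMetrisableAt {α β γ δ : ℝ} {p : Plane}
    (h : (painleveIII α β γ δ).IsMetrisableAt p) : (α = 0 ∧ γ = 0) ∨ (β = 0 ∧ δ = 0) := by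
  have hx0 : ∀ q ∈ (painleveIII α β γ δ).dom, q 0 ≠ 0 := fun q hq => hq.1
  have hy0 : ∀ q ∈ (painleveIII α β γ δ).dom, q 1 ≠ 0 := fun q hq => hq.2
  have hc : ∀ i, ContDiff ℝ ∞ fun q : Plane => q i := fun i => contDiff_apply ℝ ℝ i
  have hix := (hc 0).contDiffOn.inv hx0
  have hiy := (hc 1).contDiffOn.inv hy0
  obtain ⟨U, hU, a, k, σ, τ, hp, sys, nd⟩ := exists_liouvilleSystem_of_isMetrisableAt h
    (P := fun q => q 1 ^ 2) (N := fun _ => 0) (ρ := fun q => 1 / 3 * (q 0)⁻¹)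
    (B := fun q => α * (q 0)⁻¹ + β * (q 0)⁻¹ * (q 1)⁻¹ ^ 2 + γ * q 1 + δ * (q 1)⁻¹ ^ 3)
    ((hc 1).pow 2).contDiffOn contDiffOn_const (contDiffOn_const.mul hix)
    ((((contDiffOn_const.mul hix).add ((contDiffOn_const.mul hix).mul (hiy.pow 2))).add
      (contDiffOn_const.mul (hc 1).contDiffOn)).add (contDiffOn_const.mul (hiy.pow 3)))
    (fun q hq => pow_ne_zero 2 (hy0 q hq))
    (fun q hq => partialDeriv_zero_eq (((hc 1).pow 2).differentiable (by simp) q)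
      (by simpa using hasDerivAt_const (q 0) (q 1 ^ 2)))
    (fun q hq => partialDeriv_one_eq
      (((contDiffOn_const.mul hix).contDiffAt ((isOpen_ne_fun (continuous_apply 0)
        continuous_const).inter (isOpen_ne_fun (continuous_apply 1) continuous_const) |>.mem_nhds
          hq)).differentiableAt (by simp))
      (by simpa using hasDerivAt_const (q 1) (1 / 3 * (q 0)⁻¹)))
    (fun q hq v => by
      have h1 := hx0 q hq
      have h2 := hy0 q hq
      rw [partialDeriv_one_pow_two]
      simp only [painleveIII]
      field_simp
      ring)
  obtain ⟨iy, eiy, diy⟩ := exists_inv (f := (coord 1 : smoothFunctions U))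
    fun q => hy0 q (hU q.2)
  obtain ⟨ix, eix, dix⟩ := exists_inv (f := (coord 0 : smoothFunctions U))
    fun q => hx0 q (hU q.2)
  have eP : ∀ h, mk (fun q : Plane => q 1 ^ 2) h = (coord 1 ^ 2 : smoothFunctions U) :=
    fun _ => rfl
  have e0 : ∀ h, mk (fun _ : Plane => (0 : ℝ)) h = (0 : smoothFunctions U) := fun _ => rfl
  have eρ : ∀ h, mk (fun q : Plane => 1 / 3 * (q 0)⁻¹) h
      = (algebraMap ℝ (smoothFunctions U) (1 / 3) * ix) := fun _ => ext_eval fun q => by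
    simp [eval_mk, eval_coord, eix, map_ofNat]
  have eB : ∀ h, mk (fun q : Plane => α * (q 0)⁻¹ + β * (q 0)⁻¹ * (q 1)⁻¹ ^ 2 + γ * q 1
      + δ * (q 1)⁻¹ ^ 3) h = (algebraMap ℝ (smoothFunctions U) α * ix
        + algebraMap ℝ _ β * ix * iy ^ 2 + algebraMap ℝ _ γ * coord 1
        + algebraMap ℝ _ δ * iy ^ 3) := fun _ => ext_eval fun q => by
    simp [eval_mk, eval_coord, eiy, eix, map_ofNat]
  rw [eP, e0, eρ, eB] at sys
  have obs := sys.obstruction (D := fun f => 2 * coord 1 ^ 2 * der 1 f + der 1 (coord 1 ^ 2) * f)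
    (fun _ => rfl) rfl
  obtain ⟨c, d, hseg, s, s', A, K, K₁, K₂, hcd, line⟩ := sys.exists_line hp
  have d00 : der 0 (coord 0 : smoothFunctions U) = 1 := der_coord 0 0
  have d01 : der 0 (coord 1 : smoothFunctions U) = 0 := der_coord 0 1
  have d10 : der 1 (coord 0 : smoothFunctions U) = 0 := der_coord 1 0
  have d11 : der 1 (coord 1 : smoothFunctions U) = 1 := der_coord 1 1
  simp [dix, diy, d00, d01, d10, d11, pow_succ, Derivation.apply_ofNat] at obs
  obtain ⟨x, hx⟩ : ∃ x, p 0 = x := ⟨_, rfl⟩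
  have hxne : x ≠ 0 := hx ▸ hx0 _ (hU hp)
  -- `e` gathers the terms coming from `k`, `k_x`, `k_xx` without a factor `B`; only its
  -- independence of `y` matters.
  obtain ⟨e, key⟩ : ∃ e : ℝ, ∀ y ∈ Ioo c d, (4 * α * x * y ^ 4 + 4 * β * x * y ^ 2
      + 16 * γ * x ^ 2 * y ^ 5 + 16 * δ * x ^ 2 * y) * s y
      + (K * (8 * α * x * y ^ 3 - 8 * β * x * y + 16 * γ * x ^ 2 * y ^ 4 - 16 * δ * x ^ 2)
        + A * (-4 * α * y ^ 3 + 4 * β * y - 16 * γ * x * y ^ 4 + 16 * δ * x) - e * y ^ 2) = 0 := by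
    refine ⟨x ^ 2 * (2 * K₂ + 2 * (1 / 3 * x⁻¹) * K₁
      - 2 * (-(1 / 3 * x⁻¹ ^ 2) + 2 * (1 / 3 * x⁻¹) ^ 2) * K), fun y hy => ?_⟩
    have e := congrArg (eval ⟨_, hseg y hy⟩) obs
    have hyne : y ≠ 0 := hy0 _ (hU (hseg y hy))
    obtain ⟨-, l1, l2, l3, l4, l5, l6⟩ := line y hy
    simp only [eval_coord, eiy, eix, l1, l2, l3, l4, l5, l6, map_add, map_sub, map_neg, map_mul,
      map_ofNat, AlgHom.commutes, Algebra.algebraMap_self, RingHom.id_apply, map_zero, map_one,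
      Matrix.cons_val_zero, Matrix.cons_val_one] at e
    simp only [hx] at e
    linear_combination (norm := (field_simp; ring)) x ^ 2 * y ^ 2 * e
  have hode : ∀ y ∈ Ioo c d, 2 * y ^ 2 * s' y + 2 * y * s y = K := by
    intro y hy
    have e := congrArg (eval ⟨_, hseg y hy⟩) sys.yσ
    obtain ⟨-, l1, l2, l3, l4, l5, l6⟩ := line y hy
    simpa [d11, eval_coord, l1, l2, l3, l4, map_ofNat] using e
  by_contra! hcon
  obtain ⟨hag, hbd⟩ := hcon
  set Q : ℝ[X] := C (4 * α * x) * X ^ 4 + C (4 * β * x) * X ^ 2 + C (16 * γ * x ^ 2) * X ^ 5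
    + C (16 * δ * x ^ 2) * X with hQ
  set R : ℝ[X] := C K * (C (8 * α * x) * X ^ 3 - C (8 * β * x) * X + C (16 * γ * x ^ 2) * X ^ 4
    - C (16 * δ * x ^ 2)) + C A * (C (-4 * α) * X ^ 3 + C (4 * β) * X - C (16 * γ * x) * X ^ 4
    + C (16 * δ * x)) - C e * X ^ 2 with hR
  have hQ0 : Q ≠ 0 := fun h => by
    obtain ⟨-, -, -, -, h1, h2⟩ := Polynomial.coeffs_eq_zero_of_forall_Ioo hcd (a₀ := 0)
      (a₁ := 16 * δ * x ^ 2) (a₂ := 4 * β * x) (a₃ := 0) (a₄ := 4 * α * x)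
      (a₅ := 16 * γ * x ^ 2) fun y _ => by
        have := congrArg (Polynomial.eval y) h
        simp [hQ] at this
        linear_combination this
    have h1' : α = 0 := by simpa [hxne] using h1
    have h2' : γ = 0 := by simpa [hxne] using h2
    exact hag h1' h2'
  have hW := Polynomial.mul_sq_eq_mul_halfWronskian (p := X ^ 2) (V := C 1) (W := C K) (Q := Q)
    (R := R) hcd (σ := s) (σ' := s') (fun y hy => (line y hy).1)
    (fun y hy => by simp; linear_combination hode y hy)
    (fun y hy => by simp [hQ, hR]; linear_combination key y hy)
  have hK : K = 0 := Polynomial.eq_zero_of_C_mul_eq_halfWronskian (p₁ := 1) (c := 0) (by simp) hQ0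
    (by simpa using hW)
  subst hK
  -- With `K = 0` the equation for `s` is `2y (y s)' = 0`.
  have hder : ∀ y ∈ Ioo c d, HasDerivAt (fun y => y * s y) 0 y := fun y hy => by
    have h1 := (hasDerivAt_id' y).mul (line y hy).1
    have hyne : y ≠ 0 := hy0 _ (hU (hseg y hy))
    have h2 : 2 * y * (1 * s y + y * s' y) = 0 := by linear_combination hode y hy
    rwa [(mul_eq_zero.1 h2).resolve_left (by simpa using hyne)] at h1
  have hmid : (c + d) / 2 ∈ Ioo c d := ⟨by linarith, by linarith⟩
  set b := (c + d) / 2 * s ((c + d) / 2) with hb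
  have hconst : ∀ y ∈ Ioo c d, y * s y = b := fun y hy =>
    isOpen_Ioo.is_const_of_deriv_eq_zero isPreconnected_Ioo
      (fun t ht => (hder t ht).differentiableAt.differentiableWithinAt)
      (fun t ht => (hder t ht).deriv) hy hmid
  obtain ⟨h0, h1, -, h3, h4, -⟩ := Polynomial.coeffs_eq_zero_of_forall_Ioo hcd
    (a₀ := 16 * δ * x * (x * b + A)) (a₁ := 4 * β * (x * b + A)) (a₂ := -e)
    (a₃ := 4 * α * (x * b - A)) (a₄ := 16 * γ * x * (x * b - A)) (a₅ := 0) fun y hy => by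
      rw [← hconst y hy]
      linear_combination key y hy
  have hA1 : x * b - A = 0 := by
    by_contra hne
    exact hag (by simpa [hne] using h3) (by simpa [hne, hxne] using h4)
  have hA2 : x * b + A = 0 := by
    by_contra hne
    exact hbd (by simpa [hne] using h1) (by simpa [hne, hxne] using h0)
  have hb0 : b = 0 := by
    have : x * b = 0 := by linarith
    simpa [hxne] using this
  obtain ⟨-, l1, -, l3, -⟩ := line _ hmid
  refine nd ⟨_, hseg _ hmid⟩ ⟨by rw [l3]; linarith [hA1, hA2], ?_⟩
  rw [l1]
  have hyne : (c + d) / 2 ≠ 0 := hy0 _ (hU (hseg _ hmid))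
  rw [hb] at hb0
  exact (mul_eq_zero.1 hb0).resolve_left hyne

/-! ### The fifth Painlevé equation: necessary conditions -/

theorem isOpen_dom_painleveV (α β γ δ : ℝ) : IsOpen (painleveV α β γ δ).dom :=
  (isOpen_ne_fun (continuous_apply 0) continuous_const).inter
    ((isOpen_ne_fun (continuous_apply 1) continuous_const).inter
      (isOpen_ne_fun (continuous_apply 1) continuous_const))

theorem partialDeriv_one_mul_sub_one_sq (q : Plane) :
    partialDeriv 1 (fun q => q 1 * (q 1 - 1) ^ 2) q = (q 1 - 1) * (3 * q 1 - 1) :=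
  partialDeriv_one_eq (((contDiff_apply ℝ ℝ 1).mul
      (((contDiff_apply ℝ ℝ 1).sub contDiff_const).pow 2)).differentiable (n := 1) (by simp) q) (by
    have := (hasDerivAt_id' (q 1)).fun_mul (((hasDerivAt_id' (q 1)).sub_const 1).fun_pow 2)
    simp only [Matrix.cons_val_one, Matrix.cons_val_fin_one]
    exact this.congr_deriv (by push_cast; ring))

open Polynomial (X C) in
open scoped Polynomial in
open smoothFunctions in
-- Here `P = y (y - 1)²`: the double root at `1` forces `K = 0`, and the odd degree then forces `R =
-- 0`. The coefficients of `A` in `R` vanish only for `γ = δ = 0`, so otherwise `A = 0`, and then `σ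
-- = 0` wherever `Q ≠ 0`.
theorem painleveV_of_isMetrisableAt {α β γ δ : ℝ} {p : Plane}
    (h : (painleveV α β γ δ).IsMetrisableAt p) : γ = 0 ∧ δ = 0 := by
  have hx0 : ∀ q ∈ (painleveV α β γ δ).dom, q 0 ≠ 0 := fun q hq => hq.1
  have hy0 : ∀ q ∈ (painleveV α β γ δ).dom, q 1 ≠ 0 := fun q hq => hq.2.1
  have hz0 : ∀ q ∈ (painleveV α β γ δ).dom, q 1 - 1 ≠ 0 := fun q hq => sub_ne_zero.2 hq.2.2
  have hc : ∀ i, ContDiff ℝ ∞ fun q : Plane => q i := fun i => contDiff_apply ℝ ℝ i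
  have hz := (hc 1).sub (contDiff_const (c := (1 : ℝ)))
  have hix := (hc 0).contDiffOn.inv hx0
  have hiy := (hc 1).contDiffOn.inv hy0
  have hiz := hz.contDiffOn.inv hz0
  have hP := (hc 1).mul (hz.pow 2)
  obtain ⟨U, hU, a, k, σ, τ, hp, sys, nd⟩ := exists_liouvilleSystem_of_isMetrisableAt h
    (P := fun q => q 1 * (q 1 - 1) ^ 2) (N := fun _ => 0) (ρ := fun q => 1 / 3 * (q 0)⁻¹)
    (B := fun q => α * (q 0)⁻¹ ^ 2 + β * (q 1)⁻¹ ^ 2 * (q 0)⁻¹ ^ 2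
      + γ * (q 0)⁻¹ * (q 1 - 1)⁻¹ ^ 2 + δ * (q 1 + 1) * (q 1 - 1)⁻¹ ^ 3)
    hP.contDiffOn contDiffOn_const (contDiffOn_const.mul hix)
    ((((contDiffOn_const.mul (hix.pow 2)).add ((contDiffOn_const.mul (hiy.pow 2)).mul
      (hix.pow 2))).add ((contDiffOn_const.mul hix).mul (hiz.pow 2))).add
      ((contDiffOn_const.mul ((hc 1).add contDiff_const).contDiffOn).mul (hiz.pow 3)))
    (fun q hq => mul_ne_zero (hy0 q hq) (pow_ne_zero 2 (hz0 q hq)))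
    (fun q hq => partialDeriv_zero_eq (hP.differentiable (by simp) q)
      (by simpa using hasDerivAt_const (q 0) (q 1 * (q 1 - 1) ^ 2)))
    (fun q hq => partialDeriv_one_eq
      (((contDiffOn_const.mul hix).contDiffAt ((isOpen_dom_painleveV α β γ δ).mem_nhds
          hq)).differentiableAt (by simp))
      (by simpa using hasDerivAt_const (q 1) (1 / 3 * (q 0)⁻¹)))
    (fun q hq v => by
      have h1 := hx0 q hq
      have h2 := hy0 q hq
      have h3 := hz0 q hq
      rw [partialDeriv_one_mul_sub_one_sq]
      simp only [painleveV]
      field_simp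
      ring)
  obtain ⟨iy, eiy, diy⟩ := exists_inv (f := (coord 1 : smoothFunctions U))
    fun q => hy0 q (hU q.2)
  obtain ⟨ix, eix, dix⟩ := exists_inv (f := (coord 0 : smoothFunctions U))
    fun q => hx0 q (hU q.2)
  obtain ⟨iz, eiz, diz⟩ := exists_inv (f := (coord 1 - 1 : smoothFunctions U))
    fun q => by simpa [eval_coord] using hz0 q (hU q.2)
  have eP : ∀ h, mk (fun q : Plane => q 1 * (q 1 - 1) ^ 2) h
      = (coord 1 * (coord 1 - 1) ^ 2 : smoothFunctions U) := fun _ => rfl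
  have e0 : ∀ h, mk (fun _ : Plane => (0 : ℝ)) h = (0 : smoothFunctions U) := fun _ => rfl
  have eρ : ∀ h, mk (fun q : Plane => 1 / 3 * (q 0)⁻¹) h
      = (algebraMap ℝ (smoothFunctions U) (1 / 3) * ix) := fun _ => ext_eval fun q => by
    simp [eval_mk, eval_coord, eix, map_ofNat]
  have eB : ∀ h, mk (fun q : Plane => α * (q 0)⁻¹ ^ 2 + β * (q 1)⁻¹ ^ 2 * (q 0)⁻¹ ^ 2
      + γ * (q 0)⁻¹ * (q 1 - 1)⁻¹ ^ 2 + δ * (q 1 + 1) * (q 1 - 1)⁻¹ ^ 3) h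
      = (algebraMap ℝ (smoothFunctions U) α * ix ^ 2
        + algebraMap ℝ _ β * iy ^ 2 * ix ^ 2 + algebraMap ℝ _ γ * ix * iz ^ 2
        + algebraMap ℝ _ δ * (coord 1 + 1) * iz ^ 3) := fun _ => ext_eval fun q => by
    simp [eval_mk, eval_coord, eiy, eix, eiz, map_ofNat]
  rw [eP, e0, eρ, eB] at sys
  have obs := sys.obstruction (D := fun f => 2 * (coord 1 * (coord 1 - 1) ^ 2) * der 1 f
    + der 1 (coord 1 * (coord 1 - 1) ^ 2) * f) (fun _ => rfl) rfl
  obtain ⟨c, d, hseg, s, s', A, K, K₁, K₂, hcd, line⟩ := sys.exists_line hp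
  have d00 : der 0 (coord 0 : smoothFunctions U) = 1 := der_coord 0 0
  have d01 : der 0 (coord 1 : smoothFunctions U) = 0 := der_coord 0 1
  have d10 : der 1 (coord 0 : smoothFunctions U) = 0 := der_coord 1 0
  have d11 : der 1 (coord 1 : smoothFunctions U) = 1 := der_coord 1 1
  simp [dix, diy, diz, d00, d01, d10, d11, pow_succ, Derivation.apply_ofNat] at obs
  obtain ⟨x, hx⟩ : ∃ x, p 0 = x := ⟨_, rfl⟩
  have hxne : x ≠ 0 := hx ▸ hx0 _ (hU hp)
  obtain ⟨e, key⟩ : ∃ e : ℝ, ∀ y ∈ Ioo c d,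
      ((y - 1) * (2 * (α * (6 * y - 4) * y ^ 3 * (y - 1) ^ 3 + β * (6 - 4 * y) * (y - 1) ^ 3
        + 2 * γ * x * y ^ 3 * (y - 1) + 8 * δ * x ^ 2 * y ^ 3 * (y + 1)))) * s y
      + (4 * K * (α * ((y - 1) ^ 2 + 2 * y * (y - 1)) * y ^ 2 * (y - 1) ^ 2
          + β * (-3 * (y - 1) ^ 2 + 2 * y * (y - 1)) * (y - 1) ^ 2
          - γ * x * (y + 1) * y ^ 2 * (y - 1) - δ * x ^ 2 * y ^ 2 * ((y - 1) ^ 2 + 8 * y))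
        + A * (2 * γ * (y + 1) * y ^ 2 * (y - 1) + 4 * δ * x * y ^ 2 * ((y - 1) ^ 2 + 8 * y))
        - e * y ^ 2 * (y - 1) ^ 2) = 0 := by
    refine ⟨x ^ 2 * (2 * K₂ + 2 * (1 / 3 * x⁻¹) * K₁
      - 2 * (-(1 / 3 * x⁻¹ ^ 2) + 2 * (1 / 3 * x⁻¹) ^ 2) * K), fun y hy => ?_⟩
    have e := congrArg (eval ⟨_, hseg y hy⟩) obs
    have hyne : y ≠ 0 := hy0 _ (hU (hseg y hy))
    have hzne : y - 1 ≠ 0 := hz0 _ (hU (hseg y hy))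
    obtain ⟨-, l1, l2, l3, l4, l5, l6⟩ := line y hy
    simp only [eval_coord, eiy, eix, eiz, l1, l2, l3, l4, l5, l6, map_add, map_sub, map_neg,
      map_mul, map_ofNat, AlgHom.commutes, Algebra.algebraMap_self, RingHom.id_apply, map_zero,
      map_one, Matrix.cons_val_zero, Matrix.cons_val_one] at e
    simp only [hx] at e
    clear line obs sys diy dix diz eiy eix eiz
    linear_combination (norm := (field_simp; ring)) x ^ 2 * y ^ 2 * (y - 1) ^ 2 * e
  have hode : ∀ y ∈ Ioo c d, 2 * (y * (y - 1) ^ 2) * s' y + (y - 1) * (3 * y - 1) * s y = K := by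
    intro y hy
    have e := congrArg (eval ⟨_, hseg y hy⟩) sys.yσ
    obtain ⟨-, l1, l2, l3, l4, l5, l6⟩ := line y hy
    simp [d11, eval_coord, l1, l2, l3, l4, map_ofNat] at e
    linear_combination e
  by_contra hcon
  set Q₁ : ℝ[X] := C 2 * (C α * (C 6 * X - C 4) * X ^ 3 * (X - C 1) ^ 3
    + C β * (C 6 - C 4 * X) * (X - C 1) ^ 3 + C (2 * γ * x) * X ^ 3 * (X - C 1)
    + C (8 * δ * x ^ 2) * X ^ 3 * (X + C 1)) with hQ₁
  set R : ℝ[X] := C (4 * K) * (C α * ((X - C 1) ^ 2 + C 2 * X * (X - C 1)) * X ^ 2 * (X - C 1) ^ 2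
      + C β * (C (-3) * (X - C 1) ^ 2 + C 2 * X * (X - C 1)) * (X - C 1) ^ 2
      - C (γ * x) * (X + C 1) * X ^ 2 * (X - C 1)
      - C (δ * x ^ 2) * X ^ 2 * ((X - C 1) ^ 2 + C 8 * X))
    + C A * (C (2 * γ) * (X + C 1) * X ^ 2 * (X - C 1)
      + C (4 * δ * x) * X ^ 2 * ((X - C 1) ^ 2 + C 8 * X))
    - C e * X ^ 2 * (X - C 1) ^ 2 with hR
  have hz1 : (X - C 1 : ℝ[X]) ≠ 0 := Polynomial.X_sub_C_ne_zero 1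
  -- The value of `Q₁` at `1` detects `δ`; once `δ = 0`, a further factor `X - C 1` splits off and
  -- the value at `1` detects `γ`.
  have hQ0 : (X - C 1) * Q₁ ≠ 0 := fun h => by
    have h1 := (mul_eq_zero.1 h).resolve_left hz1
    have hδ : δ = 0 := by simpa [hQ₁, hxne] using congrArg (Polynomial.eval 1) h1
    have h2 : (X - C 1) * (C 2 * (C α * (C 6 * X - C 4) * X ^ 3 * (X - C 1) ^ 2
        + C β * (C 6 - C 4 * X) * (X - C 1) ^ 2 + C (2 * γ * x) * X ^ 3)) = 0 := by
      rw [← h1, hQ₁, hδ]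
      simp only [mul_zero, zero_mul, Polynomial.C_0]
      ring
    have h3 := (mul_eq_zero.1 h2).resolve_left hz1
    have hγ : γ = 0 := by simpa [hxne] using congrArg (Polynomial.eval 1) h3
    exact hcon ⟨hγ, hδ⟩
  have hp' : ∀ y, (X * (X - C 1) ^ 2 : ℝ[X]).derivative.eval y = (y - 1) * (3 * y - 1) := by
    intro y
    simp only [Polynomial.derivative_mul, Polynomial.derivative_X, Polynomial.derivative_pow,
      Polynomial.derivative_X_sub_C, Polynomial.eval_mul, Polynomial.eval_X, Polynomial.eval_sub,
      Polynomial.eval_C, Polynomial.eval_pow, Polynomial.eval_add, Polynomial.eval_one]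
    push_cast
    ring
  have hW := Polynomial.mul_sq_eq_mul_halfWronskian (p := X * (X - C 1) ^ 2) (V := C 1) (W := C K)
    (Q := (X - C 1) * Q₁) (R := R) hcd (σ := s) (σ' := s') (fun y hy => (line y hy).1)
    (fun y hy => by
      rw [hp']
      simp only [Polynomial.eval_mul, Polynomial.eval_X, Polynomial.eval_sub, Polynomial.eval_C,
        Polynomial.eval_pow]
      linear_combination hode y hy)
    (fun y hy => by
      simp only [hQ₁, hR, Polynomial.eval_mul, Polynomial.eval_X, Polynomial.eval_sub,
        Polynomial.eval_C, Polynomial.eval_pow, Polynomial.eval_add]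
      linear_combination key y hy)
  have hK : K = 0 := Polynomial.eq_zero_of_C_mul_eq_halfWronskian (p₁ := X) (c := 1)
    (by simp) hQ0 (by simpa [mul_comm X] using hW)
  have hdeg : Odd (X * (X - C 1) ^ 2 : ℝ[X]).natDegree := by
    rw [Polynomial.natDegree_X_mul (pow_ne_zero 2 hz1), Polynomial.natDegree_pow,
      Polynomial.natDegree_X_sub_C]
    exact ⟨1, rfl⟩
  have hR0 : R = 0 := Polynomial.eq_zero_of_halfWronskian_eq_zero hdeg hQ0 (by
    simpa [hK] using hW.symm)
  have hRe : ∀ y, A * (2 * γ * (y + 1) * y ^ 2 * (y - 1)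
      + 4 * δ * x * y ^ 2 * ((y - 1) ^ 2 + 8 * y)) - e * y ^ 2 * (y - 1) ^ 2 = 0 := fun y => by
    have := congrArg (Polynomial.eval y) hR0
    simp only [hR, hK, Polynomial.eval_mul, Polynomial.eval_X, Polynomial.eval_sub,
      Polynomial.eval_C, Polynomial.eval_pow, Polynomial.eval_add, Polynomial.eval_zero] at this
    linear_combination this
  have hA : A = 0 := by
    by_contra hA
    have h1 : δ = 0 := by simpa [hxne, hA] using hRe 1
    -- For `δ = 0`, the values at `2` and `-1` carry the same multiple of `e`, while the `γ`-term
    -- vanishes at `-1`; their difference isolates `A γ`.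
    have h2 := hRe 2
    have h3 := hRe (-1)
    have h4 : γ = 0 := by
      have : A * γ = 0 := by
        rw [h1] at h2 h3
        linear_combination (1 / 24) * h2 - (1 / 24) * h3
      exact (mul_eq_zero.1 this).resolve_left hA
    exact hcon ⟨h4, h1⟩
  obtain ⟨y, hy, hQy⟩ := Polynomial.exists_eval_ne_zero_on_Ioo hQ0 hcd
  obtain ⟨-, l1, -, l3, -⟩ := line y hy
  refine nd ⟨_, hseg y hy⟩ ⟨l3.trans hA, l1.trans ?_⟩
  have hs : ((X - C 1) * Q₁).eval y * s y = 0 := by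
    simp only [hQ₁, Polynomial.eval_mul, Polynomial.eval_X, Polynomial.eval_sub,
      Polynomial.eval_C, Polynomial.eval_pow, Polynomial.eval_add]
    have := key y hy
    rw [hK] at this
    linear_combination this - hRe y
  exact (mul_eq_zero.1 hs).resolve_left hQy

/-! ### The sixth Painlevé equation: necessary conditions -/

theorem Polynomial.halfWronskian_map {K L : Type*} [Field K] [Field L] (f : K →+* L)
    (p Q R : Polynomial K) :
    (halfWronskian p Q R).map f = halfWronskian (p.map f) (Q.map f) (R.map f) := by
  simp [halfWronskian]

open Polynomial (X C) in
open scoped Polynomial in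
-- Counting poles requires all the roots of `Q`, so the identity is moved to `ℂ`; the conclusion
-- returns by injectivity of the coefficient map.
theorem Polynomial.eq_zero_of_halfWronskian_elliptic_real {x : ℝ} (hx0 : x ≠ 0) (hx1 : x ≠ 1)
    {W Q R : ℝ[X]} (hW : W.natDegree ≤ 1) (hQ : Q ≠ 0)
    (h : W * Q ^ 2 = (X - C x) * halfWronskian ((X - C x) * (X * (X - C 1))) Q R) :
    W = 0 ∧ R = 0 := by
  have hinj := Polynomial.map_injective _ (algebraMap ℝ ℂ).injective
  have hC := congrArg (Polynomial.map (algebraMap ℝ ℂ)) h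
  simp only [Polynomial.map_mul, Polynomial.map_pow, Polynomial.halfWronskian_map,
    Polynomial.map_sub, Polynomial.map_X, Polynomial.map_C, map_one (algebraMap ℝ ℂ)] at hC
  have h0 : algebraMap ℝ ℂ x ≠ 0 := by simpa using hx0
  have h1 : algebraMap ℝ ℂ x ≠ 1 := by
    rw [← map_one (algebraMap ℝ ℂ)]
    exact fun h => hx1 ((algebraMap ℝ ℂ).injective h)
  have hQ' : Q.map (algebraMap ℝ ℂ) ≠ 0 := by
    rw [← Polynomial.map_zero (algebraMap ℝ ℂ)]
    exact hinj.ne hQ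
  obtain ⟨hW0, hR0⟩ := Polynomial.eq_zero_of_halfWronskian_elliptic h0 h1
    (Polynomial.natDegree_map_le.trans hW) hQ' hC
  exact ⟨hinj (by rw [hW0, Polynomial.map_zero]), hinj (by rw [hR0, Polynomial.map_zero])⟩

theorem isOpen_dom_painleveVI (α β γ δ : ℝ) : IsOpen (painleveVI α β γ δ).dom :=
  (isOpen_ne_fun (continuous_apply 0) continuous_const).inter
    ((isOpen_ne_fun (continuous_apply 0) continuous_const).inter
    ((isOpen_ne_fun (continuous_apply 1) continuous_const).inter
      ((isOpen_ne_fun (continuous_apply 1) continuous_const).inter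
        (isOpen_ne_fun (continuous_apply 1) (continuous_apply 0)))))

/-- The cubic `y (y - 1) (y - x)`. -/
noncomputable def painleveCubic (q : Plane) : ℝ := q 1 * (q 1 - 1) * (q 1 - q 0)

theorem contDiff_painleveCubic : ContDiff ℝ ∞ painleveCubic :=
  ((contDiff_apply ℝ ℝ 1).mul ((contDiff_apply ℝ ℝ 1).sub contDiff_const)).mul
    ((contDiff_apply ℝ ℝ 1).sub (contDiff_apply ℝ ℝ 0))

theorem partialDeriv_one_painleveCubic (q : Plane) : partialDeriv 1 painleveCubic q
    = (q 1 - 1) * (q 1 - q 0) + q 1 * (q 1 - q 0) + q 1 * (q 1 - 1) :=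
  partialDeriv_one_eq (contDiff_painleveCubic.differentiable (by simp) q) (by
    have := ((hasDerivAt_id' (q 1)).fun_mul ((hasDerivAt_id' (q 1)).sub_const 1)).fun_mul
      ((hasDerivAt_id' (q 1)).sub_const (q 0))
    simp only [painleveCubic, Matrix.cons_val_one, Matrix.cons_val_zero, Matrix.cons_val_fin_one]
    exact this.congr_deriv (by ring))

theorem partialDeriv_zero_painleveCubic (q : Plane) :
    partialDeriv 0 painleveCubic q = -(q 1 * (q 1 - 1)) :=
  partialDeriv_zero_eq (contDiff_painleveCubic.differentiable (by simp) q) (by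
    have := ((hasDerivAt_id' (q 0)).const_sub (q 1)).const_mul (q 1 * (q 1 - 1))
    simp only [painleveCubic, Matrix.cons_val_one, Matrix.cons_val_zero, Matrix.cons_val_fin_one]
    exact this.congr_deriv (by ring))

open Polynomial (X C) in
open scoped Polynomial in
/-- The coefficient of the unknown function in the obstruction for the sixth Painlevé equation,
with denominators cleared; `u`, `v` stand for `1 / x`, `1 / (x - 1)`. -/
noncomputable def painleveVIObstruction (α β γ δ x u v : ℝ) : ℝ[X] :=
  2 * (C (2 * (α * u ^ 2 * v ^ 2)) * (X + (X - C 1) + (X - C x)) * X ^ 3 * (X - C 1) ^ 3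
      * (X - C x) ^ 5
    + C (β * u * v ^ 2) * (2 * X ^ 2 - 4 * X * (X - C 1) - 4 * X * (X - C x)
      + 6 * (X - C 1) * (X - C x)) * (X - C 1) ^ 3 * (X - C x) ^ 5
    + C (γ * u ^ 2 * v) * (2 * (X - C 1) ^ 2 - 4 * X * (X - C 1) - 4 * (X - C 1) * (X - C x)
      + 6 * X * (X - C x)) * X ^ 3 * (X - C x) ^ 5
    + C (δ * u * v) * (2 * (X - C x) ^ 2 - 4 * X * (X - C x) - 4 * (X - C 1) * (X - C x)
      + 6 * X * (X - C 1)) * X ^ 3 * (X - C 1) ^ 3 * (X - C x) ^ 2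
    - X ^ 3 * (X - C 1) ^ 3 * (X - C x) ^ 2 * (3 + C (u + v) * (X - C x)))

theorem eval_painleveVIObstruction (α β γ δ x u v y : ℝ) :
    (painleveVIObstruction α β γ δ x u v).eval y
    = 2 * (2 * (α * u ^ 2 * v ^ 2) * (y + (y - 1) + (y - x)) * y ^ 3 * (y - 1) ^ 3 * (y - x) ^ 5
      + (β * u * v ^ 2) * (2 * y ^ 2 - 4 * y * (y - 1) - 4 * y * (y - x) + 6 * (y - 1) * (y - x))
        * (y - 1) ^ 3 * (y - x) ^ 5
      + (γ * u ^ 2 * v) * (2 * (y - 1) ^ 2 - 4 * y * (y - 1) - 4 * (y - 1) * (y - x)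
        + 6 * y * (y - x)) * y ^ 3 * (y - x) ^ 5
      + (δ * u * v) * (2 * (y - x) ^ 2 - 4 * y * (y - x) - 4 * (y - 1) * (y - x) + 6 * y * (y - 1))
        * y ^ 3 * (y - 1) ^ 3 * (y - x) ^ 2
      - y ^ 3 * (y - 1) ^ 3 * (y - x) ^ 2 * (3 + (u + v) * (y - x))) := by
  simp only [painleveVIObstruction, Polynomial.eval_mul, Polynomial.eval_add, Polynomial.eval_sub,
    Polynomial.eval_pow, Polynomial.eval_C, Polynomial.eval_X, Polynomial.eval_ofNat]

open Polynomial (X C) in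
open scoped Polynomial in
-- At `y = 0` only the `β`-term survives and at `y = 1` only the `γ`-term. After division by the
-- common factor, the value at `x` gives `δ = 1/2`; the values at `0` and `1` then give `α (1 + x) =
-- 0` and `α (2 - x) = 0`, whose sum is `3α = 0`.
theorem eq_of_painleveVIObstruction_eq_zero {α β γ δ x u v : ℝ} (hu : u * x = 1)
    (hv : v * (x - 1) = 1) (h : painleveVIObstruction α β γ δ x u v = 0) :
    α = 0 ∧ β = 0 ∧ γ = 0 ∧ δ = 1 / 2 := by
  have hx : x ≠ 0 := right_ne_zero_of_mul_eq_one hu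
  have hx1 : x - 1 ≠ 0 := right_ne_zero_of_mul_eq_one hv
  have hx1' : 1 - x ≠ 0 := by rwa [← neg_sub, neg_ne_zero]
  have hu0 : u ≠ 0 := left_ne_zero_of_mul_eq_one hu
  have hv0 : v ≠ 0 := left_ne_zero_of_mul_eq_one hv
  have hβ : β = 0 := by
    have := eval_painleveVIObstruction α β γ δ x u v 0
    rw [h, Polynomial.eval_zero] at this
    simpa [hx, hu0, hv0] using this
  have hγ : γ = 0 := by
    have := eval_painleveVIObstruction α β γ δ x u v 1
    rw [h, Polynomial.eval_zero] at this
    simpa [hx, hu0, hv0, hx1'] using this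
  have h2 : (2 : ℝ[X]) * ((X - C x) ^ 2 * (X ^ 3 * (X - C 1) ^ 3)) * (C (2 * (α * u ^ 2 * v ^ 2))
      * (X + (X - C 1) + (X - C x)) * (X - C x) ^ 3
      + C (δ * u * v) * (2 * (X - C x) ^ 2 - 4 * X * (X - C x) - 4 * (X - C 1) * (X - C x)
        + 6 * X * (X - C 1)) - (3 + C (u + v) * (X - C x))) = 0 := by
    rw [← h, painleveVIObstruction, hβ, hγ]
    simp only [zero_mul, Polynomial.C_0]
    ring
  have h3 := (mul_eq_zero.1 h2).resolve_left (mul_ne_zero two_ne_zero (mul_ne_zero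
    (pow_ne_zero 2 (Polynomial.X_sub_C_ne_zero x)) (mul_ne_zero
      (pow_ne_zero 3 Polynomial.X_ne_zero) (pow_ne_zero 3 (Polynomial.X_sub_C_ne_zero 1)))))
  have h4 : ∀ y, 2 * (α * u ^ 2 * v ^ 2) * (y + (y - 1) + (y - x)) * (y - x) ^ 3
      + δ * u * v * (2 * (y - x) ^ 2 - 4 * y * (y - x) - 4 * (y - 1) * (y - x) + 6 * y * (y - 1))
      - (3 + (u + v) * (y - x)) = 0 := fun y => by
    have := congrArg (Polynomial.eval y) h3
    simpa only [Polynomial.eval_mul, Polynomial.eval_add, Polynomial.eval_sub, Polynomial.eval_pow,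
      Polynomial.eval_C, Polynomial.eval_X, Polynomial.eval_ofNat, Polynomial.eval_zero] using this
  have hδ : δ = 1 / 2 := by
    have h5 : 6 * δ * ((u * x) * (v * (x - 1))) = 3 := by linear_combination h4 x
    rw [hu, hv] at h5
    linarith
  refine ⟨?_, hβ, hγ, hδ⟩
  have h6 : α * (1 + x) * (2 * u ^ 2 * v ^ 2 * x ^ 3) = 0 := by
    have := h4 0
    rw [hδ] at this
    linear_combination this - (v * (x - 2) + 1) * hu - 2 * hv
  have h7 : α * (2 - x) * (2 * u ^ 2 * v ^ 2 * (1 - x) ^ 3) = 0 := by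
    have := h4 1
    rw [hδ] at this
    linear_combination this - (u * (x + 1) + 1) * hv - 2 * hu
  have h8 := (mul_eq_zero.1 h6).resolve_right (by positivity)
  have h9 := (mul_eq_zero.1 h7).resolve_right (by positivity)
  linarith

open Polynomial (X C) in
open scoped Polynomial in
open smoothFunctions in
set_option maxHeartbeats 1000000 in
-- For `P = y (y - 1)(y - x)` the equation of `σ` has right-hand side `K + A / (y - x)`. No nonzero
-- rational function solves it, so outside the exceptional parameters, where `Q ≠ 0`, both `A` and
-- `σ` vanish at some point.
theorem painleveVI_of_isMetrisableAt {α β γ δ : ℝ} {p : Plane}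
    (h : (painleveVI α β γ δ).IsMetrisableAt p) : α = 0 ∧ β = 0 ∧ γ = 0 ∧ δ = 1 / 2 := by
  have hx0 : ∀ q ∈ (painleveVI α β γ δ).dom, q 0 ≠ 0 := fun q hq => hq.1
  have ht0 : ∀ q ∈ (painleveVI α β γ δ).dom, q 0 - 1 ≠ 0 := fun q hq => sub_ne_zero.2 hq.2.1
  have hy0 : ∀ q ∈ (painleveVI α β γ δ).dom, q 1 ≠ 0 := fun q hq => hq.2.2.1
  have hw0 : ∀ q ∈ (painleveVI α β γ δ).dom, q 1 - 1 ≠ 0 := fun q hq => sub_ne_zero.2 hq.2.2.2.1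
  have hz0 : ∀ q ∈ (painleveVI α β γ δ).dom, q 1 - q 0 ≠ 0 :=
    fun q hq => sub_ne_zero.2 hq.2.2.2.2
  have hc : ∀ i, ContDiff ℝ ∞ fun q : Plane => q i := fun i => contDiff_apply ℝ ℝ i
  have hix := (hc 0).contDiffOn.inv hx0
  have hit := ((hc 0).sub (contDiff_const (c := (1 : ℝ)))).contDiffOn.inv ht0
  have hiy := (hc 1).contDiffOn.inv hy0
  have hiw := ((hc 1).sub (contDiff_const (c := (1 : ℝ)))).contDiffOn.inv hw0
  have hiz := ((hc 1).sub (hc 0)).contDiffOn.inv hz0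
  have hρ := (contDiffOn_const (c := (1 / 3 : ℝ))).mul (hix.add hit)
  obtain ⟨U, hU, a, k, σ, τ, hp, sys, nd⟩ := exists_liouvilleSystem_of_isMetrisableAt h
    (P := painleveCubic) (N := fun q => (q 1 - q 0)⁻¹)
    (ρ := fun q => 1 / 3 * ((q 0)⁻¹ + (q 0 - 1)⁻¹))
    (B := fun q => α * (q 0)⁻¹ ^ 2 * (q 0 - 1)⁻¹ ^ 2 + β * (q 0)⁻¹ * (q 0 - 1)⁻¹ ^ 2 * (q 1)⁻¹ ^ 2
      + γ * (q 0)⁻¹ ^ 2 * (q 0 - 1)⁻¹ * (q 1 - 1)⁻¹ ^ 2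
      + δ * (q 0)⁻¹ * (q 0 - 1)⁻¹ * (q 1 - q 0)⁻¹ ^ 2)
    contDiff_painleveCubic.contDiffOn hiz hρ
    (((((contDiffOn_const.mul (hix.pow 2)).mul (hit.pow 2))).add
      (((contDiffOn_const.mul hix).mul (hit.pow 2)).mul (hiy.pow 2))).add
      (((contDiffOn_const.mul (hix.pow 2)).mul hit).mul (hiw.pow 2)) |>.add
      (((contDiffOn_const.mul hix).mul hit).mul (hiz.pow 2)))
    (fun q hq => mul_ne_zero (mul_ne_zero (hy0 q hq) (hw0 q hq)) (hz0 q hq))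
    (fun q hq => by
      rw [partialDeriv_zero_painleveCubic, painleveCubic]
      have := hz0 q hq
      field_simp)
    (fun q hq => partialDeriv_one_eq
      ((hρ.contDiffAt ((isOpen_dom_painleveVI α β γ δ).mem_nhds
          hq)).differentiableAt (by simp))
      (by simpa using hasDerivAt_const (q 1) (1 / 3 * ((q 0)⁻¹ + (q 0 - 1)⁻¹))))
    (fun q hq v => by
      have h1 := hx0 q hq
      have h2 := ht0 q hq
      have h3 := hy0 q hq
      have h4 := hw0 q hq
      have h5 := hz0 q hq
      rw [partialDeriv_one_painleveCubic, painleveCubic]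
      simp only [painleveVI]
      field_simp
      ring)
  obtain ⟨ix, eix, dix⟩ := exists_inv (f := (coord 0 : smoothFunctions U))
    fun q => hx0 q (hU q.2)
  obtain ⟨it, eit, dit⟩ := exists_inv (f := (coord 0 - 1 : smoothFunctions U))
    fun q => by simpa [eval_coord] using ht0 q (hU q.2)
  obtain ⟨iy, eiy, diy⟩ := exists_inv (f := (coord 1 : smoothFunctions U))
    fun q => hy0 q (hU q.2)
  obtain ⟨iw, eiw, diw⟩ := exists_inv (f := (coord 1 - 1 : smoothFunctions U))
    fun q => by simpa [eval_coord] using hw0 q (hU q.2)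
  obtain ⟨iz, eiz, diz⟩ := exists_inv (f := (coord 1 - coord 0 : smoothFunctions U))
    fun q => by simpa [eval_coord] using hz0 q (hU q.2)
  have eP : ∀ h, mk painleveCubic h
      = (coord 1 * (coord 1 - 1) * (coord 1 - coord 0) : smoothFunctions U) := fun _ => rfl
  have eN : ∀ h, mk (fun q : Plane => (q 1 - q 0)⁻¹) h = iz := fun _ => ext_eval fun q => by
    simp [eval_mk, eval_coord, eiz]
  have eρ : ∀ h, mk (fun q : Plane => 1 / 3 * ((q 0)⁻¹ + (q 0 - 1)⁻¹)) h
      = (algebraMap ℝ (smoothFunctions U) (1 / 3) * (ix + it)) := fun _ => ext_eval fun q => by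
    simp [eval_mk, eval_coord, eix, eit, map_ofNat]
  have eB : ∀ h, mk (fun q => α * (q 0)⁻¹ ^ 2 * (q 0 - 1)⁻¹ ^ 2
      + β * (q 0)⁻¹ * (q 0 - 1)⁻¹ ^ 2 * (q 1)⁻¹ ^ 2
      + γ * (q 0)⁻¹ ^ 2 * (q 0 - 1)⁻¹ * (q 1 - 1)⁻¹ ^ 2
      + δ * (q 0)⁻¹ * (q 0 - 1)⁻¹ * (q 1 - q 0)⁻¹ ^ 2) h
      = (algebraMap ℝ (smoothFunctions U) α * ix ^ 2 * it ^ 2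
        + algebraMap ℝ _ β * ix * it ^ 2 * iy ^ 2 + algebraMap ℝ _ γ * ix ^ 2 * it * iw ^ 2
        + algebraMap ℝ _ δ * ix * it * iz ^ 2) := fun _ => ext_eval fun q => by
    simp [eval_mk, eval_coord, eiy, eix, eiz, eit, eiw, map_ofNat]
  rw [eP, eN, eρ, eB] at sys
  have obs := sys.obstruction
    (D := fun f => 2 * (coord 1 * (coord 1 - 1) * (coord 1 - coord 0)) * der 1 f
    + der 1 (coord 1 * (coord 1 - 1) * (coord 1 - coord 0)) * f) (fun _ => rfl) rfl
  obtain ⟨c, d, hseg, s, s', A, K, K₁, K₂, hcd, line⟩ := sys.exists_line hp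
  have d00 : der 0 (coord 0 : smoothFunctions U) = 1 := der_coord 0 0
  have d01 : der 0 (coord 1 : smoothFunctions U) = 0 := der_coord 0 1
  have d10 : der 1 (coord 0 : smoothFunctions U) = 0 := der_coord 1 0
  have d11 : der 1 (coord 1 : smoothFunctions U) = 1 := der_coord 1 1
  have xa := sys.xa
  simp [dix, dit, diy, diw, diz, d00, d01, d10, d11, xa, pow_succ, Derivation.apply_ofNat] at obs
  obtain ⟨x, hx⟩ : ∃ x, p 0 = x := ⟨_, rfl⟩
  have hxne : x ≠ 0 := hx ▸ hx0 _ (hU hp)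
  have htne : x - 1 ≠ 0 := hx ▸ ht0 _ (hU hp)
  obtain ⟨u, hu⟩ : ∃ u, x⁻¹ = u := ⟨_, rfl⟩
  obtain ⟨v, hv⟩ : ∃ v, (x - 1)⁻¹ = v := ⟨_, rfl⟩
  -- `r` and `r'` are the values of `ρ` and `ρ_x` on the line. In `key`, `w` and `z` replace `y - 1`
  -- and `y - x`, so that denominators are cleared as if by independent variables.
  obtain ⟨r, hr⟩ : ∃ r, r = 1 / 3 * (u + v) := ⟨_, rfl⟩
  obtain ⟨r', hr'⟩ : ∃ r', r' = -(1 / 3 * (u ^ 2 + v ^ 2)) := ⟨_, rfl⟩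
  have key : ∀ y ∈ Ioo c d, ∀ w z, w = y - 1 → z = y - x →
      (2 * (2 * (α * u ^ 2 * v ^ 2) * (y + w + z) * y ^ 3 * w ^ 3 * z ^ 5
        + (β * u * v ^ 2) * (2 * y ^ 2 - 4 * y * w - 4 * y * z + 6 * w * z) * w ^ 3 * z ^ 5
        + (γ * u ^ 2 * v) * (2 * w ^ 2 - 4 * y * w - 4 * w * z + 6 * y * z) * y ^ 3 * z ^ 5
        + (δ * u * v) * (2 * z ^ 2 - 4 * y * z - 4 * w * z + 6 * y * w) * y ^ 3 * w ^ 3 * z ^ 2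
        - y ^ 3 * w ^ 3 * z ^ 2 * (3 + (u + v) * z))) * s y
      + ((4 * K * z ^ 2 + A * z) * (α * u ^ 2 * v ^ 2 * (w * z + y * z + y * w) * y ^ 2 * w ^ 2 * z ^ 2
          + β * u * v ^ 2 * (-3 * w * z + y * z + y * w) * w ^ 2 * z ^ 2
          + γ * u ^ 2 * v * (w * z - 3 * y * z + y * w) * y ^ 2 * z ^ 2
          + δ * u * v * (w * z + y * z - 3 * y * w) * y ^ 2 * w ^ 2)
        + A * (α * u ^ 2 * v ^ 2 * (w * z + y * z - y * w) * y ^ 2 * w ^ 2 * z ^ 3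
          + β * u * v ^ 2 * (-3 * w * z + y * z - y * w) * w ^ 2 * z ^ 3
          + γ * u ^ 2 * v * (w * z - 3 * y * z - y * w) * y ^ 2 * z ^ 3
          - 3 * δ * u * v * (w * z + y * z - 5 * y * w) * y ^ 2 * w ^ 2 * z
          - 2 * β * u ^ 2 * v ^ 2 * (-3 * w * z + y * z + y * w) * w ^ 2 * z ^ 4
          - 2 * γ * u ^ 2 * v ^ 2 * (w * z - 3 * y * z + y * w) * y ^ 2 * z ^ 4
          - 2 * δ * u * v * (u + v) * (w * z + y * z - 3 * y * w) * y ^ 2 * w ^ 2 * z ^ 2)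
        - y ^ 2 * w ^ 2 * (2 * (K₂ * z ^ 4 + 4 * A * z + 2 * (4 * r * A - K) * z ^ 2
            + 4 * r' * A * z ^ 3 + 4 * r * A * z ^ 2 + 4 * r * (4 * r * A - K) * z ^ 3)
          + 2 * r * (K₁ * z ^ 4 + 2 * A * z ^ 2 + 4 * r * A * z ^ 3)
          - 2 * (1 + 2 * r * z + (r' + 2 * r ^ 2) * z ^ 2) * (K * z ^ 2 + A * z))) = 0 := by
    intro y hy w z hw hz
    have e := congrArg (eval ⟨_, hseg y hy⟩) obs
    have hyne : y ≠ 0 := hy0 _ (hU (hseg y hy))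
    have hwne : w ≠ 0 := hw ▸ hw0 _ (hU (hseg y hy))
    have hzne : z ≠ 0 := by rw [hz, ← hx]; exact hz0 _ (hU (hseg y hy))
    obtain ⟨-, l1, l2, l3, l4, l5, l6⟩ := line y hy
    simp only [eval_coord, eiy, eix, eiz, eit, eiw, l1, l2, l3, l4, l5, l6, map_add, map_sub,
      map_neg, map_mul, map_ofNat, AlgHom.commutes, Algebra.algebraMap_self, RingHom.id_apply,
      map_zero, map_one, Matrix.cons_val_zero, Matrix.cons_val_one] at e
    simp only [hx, hu, hv, ← hw, ← hz] at e
    clear line obs sys xa dix dit diy diw diz eiy eix eiz eit eiw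
    subst hr hr'
    linear_combination (norm := (field_simp; ring)) y ^ 2 * w ^ 2 * z ^ 4 * e
  have hode : ∀ y ∈ Ioo c d, (y - x) * (2 * (y * (y - 1) * (y - x)) * s' y
      + ((y - 1) * (y - x) + y * (y - x) + y * (y - 1)) * s y) = K * (y - x) + A := by
    intro y hy
    have e := congrArg (eval ⟨_, hseg y hy⟩) sys.yσ
    have hzne : y - x ≠ 0 := by rw [← hx]; exact hz0 _ (hU (hseg y hy))
    obtain ⟨-, l1, l2, l3, l4, l5, l6⟩ := line y hy
    simp [d10, d11, eval_coord, eiz, l1, l2, l3, l4, map_ofNat] at e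
    rw [hx] at e
    linear_combination (norm := (field_simp; ring)) (y - x) * e
  by_contra hcon
  set W : ℝ[X] := X - C 1 with hW
  set Z : ℝ[X] := X - C x with hZ
  obtain ⟨R, hR⟩ : ∃ R : ℝ[X], R = (C (4 * K) * Z ^ 2 + C A * Z)
          * (C (α * u ^ 2 * v ^ 2) * (W * Z + X * Z + X * W) * X ^ 2 * W ^ 2 * Z ^ 2
          + C (β * u * v ^ 2) * (-3 * W * Z + X * Z + X * W) * W ^ 2 * Z ^ 2
          + C (γ * u ^ 2 * v) * (W * Z - 3 * X * Z + X * W) * X ^ 2 * Z ^ 2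
          + C (δ * u * v) * (W * Z + X * Z - 3 * X * W) * X ^ 2 * W ^ 2)
        + C A * (C (α * u ^ 2 * v ^ 2) * (W * Z + X * Z - X * W) * X ^ 2 * W ^ 2 * Z ^ 3
          + C (β * u * v ^ 2) * (-3 * W * Z + X * Z - X * W) * W ^ 2 * Z ^ 3
          + C (γ * u ^ 2 * v) * (W * Z - 3 * X * Z - X * W) * X ^ 2 * Z ^ 3
          - C (3 * δ * u * v) * (W * Z + X * Z - 5 * X * W) * X ^ 2 * W ^ 2 * Z
          - C (2 * β * u ^ 2 * v ^ 2) * (-3 * W * Z + X * Z + X * W) * W ^ 2 * Z ^ 4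
          - C (2 * γ * u ^ 2 * v ^ 2) * (W * Z - 3 * X * Z + X * W) * X ^ 2 * Z ^ 4
          - C (2 * δ * u * v * (u + v)) * (W * Z + X * Z - 3 * X * W) * X ^ 2 * W ^ 2 * Z ^ 2)
        - X ^ 2 * W ^ 2 * (2 * (C K₂ * Z ^ 4 + C (4 * A) * Z + C (2 * (4 * r * A - K)) * Z ^ 2
            + C (4 * r' * A) * Z ^ 3 + C (4 * r * A) * Z ^ 2 + C (4 * r * (4 * r * A - K)) * Z ^ 3)
          + C (2 * r) * (C K₁ * Z ^ 4 + C (2 * A) * Z ^ 2 + C (4 * r * A) * Z ^ 3)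
          - 2 * (1 + C (2 * r) * Z + C (r' + 2 * r ^ 2) * Z ^ 2) * (C K * Z ^ 2 + C A * Z)) :=
    ⟨_, rfl⟩
  have eW : ∀ y, W.eval y = y - 1 := fun y => by simp [hW]
  have eZ : ∀ y, Z.eval y = y - x := fun y => by simp [hZ]
  obtain ⟨Q, hQ⟩ : ∃ Q, Q = painleveVIObstruction α β γ δ x u v := ⟨_, rfl⟩
  have hQ0 : Q ≠ 0 := fun h => hcon (eq_of_painleveVIObstruction_eq_zero
    (hu ▸ inv_mul_cancel₀ hxne) (hv ▸ inv_mul_cancel₀ htne) (hQ ▸ h))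
  have hp' : ∀ y, (Z * (X * (X - C 1)) : ℝ[X]).derivative.eval y
      = (y - 1) * (y - x) + y * (y - x) + y * (y - 1) := by
    intro y
    simp only [hZ, Polynomial.derivative_mul, Polynomial.derivative_X,
      Polynomial.derivative_X_sub_C, Polynomial.eval_mul, Polynomial.eval_X, Polynomial.eval_sub,
      Polynomial.eval_C, Polynomial.eval_add, Polynomial.eval_one]
    ring
  have hWr := Polynomial.mul_sq_eq_mul_halfWronskian (p := Z * (X * (X - C 1))) (V := Z)
    (W := C K * Z + C A) (Q := Q) (R := R) hcd (σ := s) (σ' := s') (fun y hy => (line y hy).1)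
    (fun y hy => by
      rw [hp']
      simp only [Polynomial.eval_mul, Polynomial.eval_X, Polynomial.eval_sub, Polynomial.eval_C,
        Polynomial.eval_add, eZ]
      linear_combination hode y hy)
    (fun y hy => by
      rw [hQ, eval_painleveVIObstruction]
      simp only [hR, Polynomial.eval_mul, Polynomial.eval_add, Polynomial.eval_sub,
        Polynomial.eval_pow, Polynomial.eval_C, Polynomial.eval_X, eW, eZ, Polynomial.eval_ofNat, Polynomial.eval_neg,
        Polynomial.eval_one]
      linear_combination key y hy _ _ rfl rfl)
  have hdeg : (C K * Z + C A).natDegree ≤ 1 := by rw [hZ]; compute_degree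
  obtain ⟨hW1, hR1⟩ := Polynomial.eq_zero_of_halfWronskian_elliptic_real hxne
    (sub_ne_zero.1 htne) hdeg hQ0 hWr
  have hA : A = 0 := by simpa [hZ] using congrArg (Polynomial.eval x) hW1
  obtain ⟨y, hy, hQy⟩ := Polynomial.exists_eval_ne_zero_on_Ioo hQ0 hcd
  obtain ⟨-, l1, -, l3, -⟩ := line y hy
  refine nd ⟨_, hseg y hy⟩ ⟨l3.trans hA, l1.trans ?_⟩
  have hs : Q.eval y * s y = 0 := by
    have h1 := congrArg (Polynomial.eval y) hR1
    rw [hQ, eval_painleveVIObstruction]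
    simp only [hR, Polynomial.eval_mul, Polynomial.eval_add, Polynomial.eval_sub,
        Polynomial.eval_pow, Polynomial.eval_C, Polynomial.eval_X, eW, eZ, Polynomial.eval_ofNat, Polynomial.eval_neg,
        Polynomial.eval_one, Polynomial.eval_zero] at h1
    linear_combination key y hy _ _ rfl rfl - h1
  exact (mul_eq_zero.1 hs).resolve_left hQy

/-! ### Building metrics and straightening coordinates -/

namespace SecondOrderODE

open smoothFunctions

/-- A metric `ξ² κ dx² + κ² (m dx + n dy)²`, where `m dx + n dy` is closed and `1 / κ` varies along
it, has the solutions of a second order equation as geodesics. -/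
theorem isMetrisableAt_of_coframe {R : SecondOrderODE} {U : Opens Plane} {p : Plane} (hp : p ∈ U)
    (hdom : (U : Set Plane) ⊆ R.dom) {ξ m n κ f : smoothFunctions U} (hξ : ∀ q, eval q ξ ≠ 0)
    (hn : ∀ q, eval q n ≠ 0) (hκ : ∀ q, eval q κ ≠ 0) (yξ : der 1 ξ = 0)
    (xn : der 0 n = der 1 m) (xκ : der 0 κ = 2 * f * m * κ ^ 2) (yκ : der 1 κ = 2 * f * n * κ ^ 2)
    (h : ∀ (q : U) (v : ℝ), eval q ξ * (eval q (der 0 m) + 2 * eval q (der 1 m) * v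
        + eval q (der 1 n) * v ^ 2 + eval q n * R.rhs (q.1 0) (q.1 1) v)
      - eval q (der 0 ξ) * (eval q m + eval q n * v) = eval q ξ ^ 3 * eval q f) :
    R.IsMetrisableAt p := by
  -- With `dX = ξ dx` and `dY = m dx + n dy` the metric is `κ dX² + κ² dY²`, and `h` says `d²Y/dX² =
  -- f`. Clairaut's integral together with conservation of speed gives `(dY/dX)² + 1/κ = const`; as
  -- `d(1/κ) = -2f dY`, this differentiates to the required equation.
  set E := ξ ^ 2 * κ + m ^ 2 * κ ^ 2 with hE
  set F := m * n * κ ^ 2 with hF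
  set G := n ^ 2 * κ ^ 2 with hG
  have hg : IsPseudoRiemannianMetricOn (U : Set Plane)
      fun q => !![extend E q, extend F q; extend F q, extend G q] := by
    refine ⟨fun i j => ?_, fun q _ => Matrix.IsSymm.ext fun i j => ?_, fun q hq => ?_⟩
    · fin_cases i <;> fin_cases j
      exacts [contDiffOn_extend E, contDiffOn_extend F, contDiffOn_extend F, contDiffOn_extend G]
    · fin_cases i <;> fin_cases j <;> rfl
    · lift q to U using hq
      rw [Matrix.det_fin_two_of, extend_apply, extend_apply, extend_apply]
      have : eval q E * eval q G - eval q F * eval q F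
          = eval q ξ ^ 2 * eval q n ^ 2 * eval q κ ^ 3 := by
        simp only [hE, hF, hG, map_add, map_mul, map_pow]
        ring
      rw [this]
      exact mul_ne_zero (mul_ne_zero (pow_ne_zero 2 (hξ q)) (pow_ne_zero 2 (hn q)))
        (pow_ne_zero 3 (hκ q))
  refine IsMetrisableAt.of_geodesicRHS U.isOpen hp hdom hg fun q hq v => ?_
  lift q to U using hq
  obtain ⟨h0, h1⟩ := hg.geodesicRHS_mul_det U.isOpen q.2 (extend_apply E q) (extend_apply F q)
    (extend_apply G q) (Ex := eval q (der 0 E)) (Ey := eval q (der 1 E)) (Fx := eval q (der 0 F))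
    (Fy := eval q (der 1 F)) (Gx := eval q (der 0 G)) (Gy := eval q (der 1 G))
    rfl rfl rfl rfl rfl rfl v
  refine mul_right_cancel₀ h0 (Eq.trans ?_ h1.symm)
  simp only [hE, hF, hG, Derivation.leibniz, Derivation.leibniz_pow, map_add, map_mul, map_pow, yξ,
    xn, xκ, yκ, smul_eq_mul, nsmul_eq_mul, map_natCast, map_ofNat, map_zero, Nat.add_one_sub_one,
    pow_one]
  push_cast
  linear_combination eval q ξ * eval q n * eval q κ ^ 3 * h q v

variable {U : Opens Plane}

theorem _root_.smoothFunctions.hasDerivAt_extend_graphCurve (f : smoothFunctions U) {y : ℝ → ℝ}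
    {x v : ℝ} (hU : graphCurve y x ∈ U) (h : HasDerivAt y v x) :
    HasDerivAt (fun x => extend f (graphCurve y x))
      (extend (der 0 f) (graphCurve y x) + extend (der 1 f) (graphCurve y x) * v) x := by
  have h1 := ((contDiffOn_extend f).differentiableAt_of_mem U.isOpen hU).hasFDerivAt.comp_hasDerivAt
    x (hasDerivAt_graphCurve h)
  have h2 : (![1, v] : Plane) = Pi.single 0 1 + v • Pi.single 1 1 := by
    ext i; fin_cases i <;> simp
  rw [h2, map_add, map_smul, smul_eq_mul, mul_comm v] at h1
  rw [extend_apply _ ⟨_, hU⟩, extend_apply _ ⟨_, hU⟩]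
  exact h1

theorem _root_.ContinuousLinearMap.det_plane (A : Plane →L[ℝ] Plane) :
    A.det = A (Pi.single 0 1) 0 * A (Pi.single 1 1) 1
      - A (Pi.single 1 1) 0 * A (Pi.single 0 1) 1 := by
  rw [ContinuousLinearMap.det, ← LinearMap.det_toMatrix', Matrix.det_fin_two]
  simp [LinearMap.toMatrix'_apply]

/-- A smooth change of coordinates `(x, y) ↦ (X(x), Y(x, y))` which turns a second order equation
into `d²Y/dX² = 0`. -/
theorem isFlatAt_of_coordinates {R : SecondOrderODE} {p : Plane} (hp : p ∈ U)
    (hdom : (U : Set Plane) ⊆ R.dom) {X Y : smoothFunctions U} (yX : der 1 X = 0)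
    (hξ : ∀ q, eval q (der 0 X) ≠ 0) (hn : ∀ q, eval q (der 1 Y) ≠ 0)
    (h : ∀ (q : U) (v : ℝ), eval q (der 0 X) * (eval q (der 0 (der 0 Y))
        + 2 * eval q (der 1 (der 0 Y)) * v + eval q (der 1 (der 1 Y)) * v ^ 2
        + eval q (der 1 Y) * R.rhs (q.1 0) (q.1 1) v)
      - eval q (der 0 (der 0 X)) * (eval q (der 0 Y) + eval q (der 1 Y) * v) = 0) :
    R.IsFlatAt p := by
  set Φ : Plane → Plane := fun q => ![extend X q, extend Y q] with hΦ
  have hsm : ContDiffOn ℝ ∞ Φ U := by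
    refine contDiffOn_pi.2 fun i => ?_
    fin_cases i
    exacts [contDiffOn_extend X, contDiffOn_extend Y]
  have hdet : ∀ q ∈ U, (fderiv ℝ Φ q).det ≠ 0 := fun q hq => by
    have hd : ∀ i, DifferentiableAt ℝ (fun q => Φ q i) q := fun i =>
      differentiableAt_pi.1 ((hsm.differentiableOn (by simp)).differentiableAt
        (U.isOpen.mem_nhds hq)) i
    have e : ∀ i w, fderiv ℝ Φ q w i = fderiv ℝ (fun q => Φ q i) q w := fun i w => by
      rw [fderiv_pi hd]; rfl
    rw [ContinuousLinearMap.det_plane, e, e, e, e]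
    have h1 : fderiv ℝ (fun q => Φ q 0) q (Pi.single 1 1) = 0 :=
      (congrArg (eval ⟨q, hq⟩) yX).trans (map_zero _)
    rw [h1, zero_mul, sub_zero]
    exact mul_ne_zero (hξ ⟨q, hq⟩) (hn ⟨q, hq⟩)
  -- Injectivity near `p` comes from a local left inverse, by the inverse function theorem.
  obtain ⟨V, hV, hVo, hpV⟩ : ∃ V : Set Plane, InjOn Φ V ∧ IsOpen V ∧ p ∈ V := by
    have h1 : HasStrictFDerivAt Φ (fderiv ℝ Φ p) p :=
      (hsm.contDiffAt (U.isOpen.mem_nhds hp)).hasStrictFDerivAt (by simp)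
    rw [← ContinuousLinearMap.coe_toContinuousLinearEquivOfDetNeZero _ (hdet p hp)] at h1
    obtain ⟨V, hV, hVo, hpV⟩ := eventually_nhds_iff.1 h1.eventually_left_inverse
    exact ⟨V, fun a ha b hb hab => by rw [← hV a ha, ← hV b hb, hab], hVo, hpV⟩
  refine ⟨U ∩ V, Φ, U.isOpen.inter hVo, ⟨hp, hpV⟩, inter_subset_left.trans hdom,
    hsm.mono inter_subset_left, hV.mono inter_subset_right, fun q hq => hdet q hq.1,
    fun a b y hy hyU => ?_⟩
  have hyd := fun x (hx : x ∈ Ioo a b) => hy.hasDerivAt_of_two isOpen_Ioo hx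
  have hydd := fun x (hx : x ∈ Ioo a b) => hy.hasDerivAt_deriv_of_two isOpen_Ioo hx
  set ev : smoothFunctions U → ℝ → ℝ := fun f x => extend f (graphCurve y x) with hev
  have hder : ∀ f, ∀ x ∈ Ioo a b, HasDerivAt (ev f)
      (ev (der 0 f) x + ev (der 1 f) x * deriv y x) x :=
    fun f x hx => hasDerivAt_extend_graphCurve f (hyU x hx).1 (hyd x hx)
  have hev0 : ∀ x ∈ Ioo a b, ev (0 : smoothFunctions U) x = 0 := fun x hx =>
    (extend_apply _ ⟨_, (hyU x hx).1⟩).trans (map_zero _)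
  have hξ' : ∀ x ∈ Ioo a b, ev (der 0 X) x ≠ 0 := fun x hx => by
    rw [hev]
    dsimp only
    rw [extend_apply _ ⟨_, (hyU x hx).1⟩]
    exact hξ _
  have hn' : ∀ x ∈ Ioo a b, ev (der 1 Y) x ≠ 0 := fun x hx => by
    rw [hev]
    dsimp only
    rw [extend_apply _ ⟨_, (hyU x hx).1⟩]
    exact hn _
  have yξ : der 1 (der 0 X) = 0 := by rw [der_comm, yX, map_zero]
  have hX : ∀ x ∈ Ioo a b, HasDerivAt (ev X) (ev (der 0 X) x) x := fun x hx => by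
    simpa [yX, hev0 x hx] using hder X x hx
  have hXX : ∀ x ∈ Ioo a b, HasDerivAt (ev (der 0 X)) (ev (der 0 (der 0 X)) x) x := fun x hx => by
    simpa [yξ, hev0 x hx] using hder (der 0 X) x hx
  set T₁ : ℝ → ℝ := fun x => ev (der 0 Y) x + ev (der 1 Y) x * deriv y x with hT₁
  set T₂ : ℝ → ℝ := fun x => ev (der 0 (der 0 Y)) x + 2 * ev (der 1 (der 0 Y)) x * deriv y x
    + ev (der 1 (der 1 Y)) x * deriv y x ^ 2 + ev (der 1 Y) x * deriv (deriv y) x with hT₂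
  have hYY : ∀ x ∈ Ioo a b, HasDerivAt T₁ (T₂ x) x := fun x hx => by
    refine ((hder (der 0 Y) x hx).add ((hder (der 1 Y) x hx).mul (hydd x hx))).congr_deriv ?_
    rw [der_comm 0 1, hT₂]
    ring
  have key : R.IsSolution (Ioo a b) y ↔
      ∀ x ∈ Ioo a b, ev (der 0 X) x * T₂ x - ev (der 0 (der 0 X)) x * T₁ x = 0 := by
    rw [IsSolution, and_iff_right hy]
    refine forall₂_congr fun x hx => ?_
    have e := h ⟨_, (hyU x hx).1⟩ (deriv y x)
    simp only [← extend_apply] at e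
    rw [show graphCurve y x 0 = x from rfl, show graphCurve y x 1 = y x from rfl] at e
    have e' : ev (der 0 X) x * T₂ x - ev (der 0 (der 0 X)) x * T₁ x
        = ev (der 0 X) x * ev (der 1 Y) x
          * (deriv (deriv y) x - R.rhs x (y x) (deriv y x)) := by
      linear_combination e
    rw [e', mul_eq_zero, or_iff_right (mul_ne_zero (hξ' x hx) (hn' x hx)), sub_eq_zero]
  rw [key]
  constructor
  · intro hs
    rcases (Ioo a b).eq_empty_or_nonempty with he | ⟨x₀, hx₀⟩
    -- Over an empty interval any line will do.
    · exact ⟨![1, 0], 0, fun h => one_ne_zero (congrFun h 0), by simp [he]⟩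
    have hconst : ∀ f : ℝ → ℝ, (∀ x ∈ Ioo a b, HasDerivAt f 0 x) → ∀ x ∈ Ioo a b, f x = f x₀ :=
      fun f hf x hx => isOpen_Ioo.is_const_of_deriv_eq_zero isPreconnected_Ioo
        (fun t ht => (hf t ht).differentiableAt.differentiableWithinAt)
        (fun t ht => (hf t ht).deriv) hx hx₀
    -- The quotient is the slope `dY/dX` along the curve; the equation says that it is constant.
    have h1 := hconst (fun x => T₁ x / ev (der 0 X) x) fun x hx =>
      ((hYY x hx).div (hXX x hx) (hξ' x hx)).congr_deriv (by
        rw [div_eq_zero_iff]; left; linear_combination hs x hx)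
    set k := T₁ x₀ / ev (der 0 X) x₀ with hk
    refine ⟨![-k, 1], ev Y x₀ - k * ev X x₀, fun h => one_ne_zero (congrFun h 1), fun x hx => ?_⟩
    have h2 := hconst (fun x => ev Y x - k * ev X x) (fun x hx =>
      ((hder Y x hx).sub ((hX x hx).const_mul k)).congr_deriv (by
        have := (div_eq_iff (hξ' x hx)).1 (h1 x hx)
        linear_combination this)) x hx
    simp only [hΦ, Matrix.cons_val_zero, Matrix.cons_val_one]
    linear_combination h2
  · rintro ⟨N, r, hN, hr⟩ x hx
    have hzero : ∀ f f' : ℝ → ℝ, ∀ c, (∀ x ∈ Ioo a b, HasDerivAt f (f' x) x) →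
        (∀ x ∈ Ioo a b, f x = c) → ∀ x ∈ Ioo a b, f' x = 0 := fun f f' c hf hc x hx =>
      (hf x hx).unique ((hasDerivAt_const x c).congr_of_eventuallyEq
        (Filter.eventuallyEq_of_mem (isOpen_Ioo.mem_nhds hx) hc))
    have h1 := hzero (fun x => N 0 * ev X x + N 1 * ev Y x)
      (fun x => N 0 * ev (der 0 X) x + N 1 * T₁ x) r
      (fun x hx => ((hX x hx).const_mul _).add ((hder Y x hx).const_mul _)) hr
    have h2 := hzero _ (fun x => N 0 * ev (der 0 (der 0 X)) x + N 1 * T₂ x) 0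
      (fun x hx => ((hXX x hx).const_mul _).add ((hYY x hx).const_mul _)) h1 x hx
    have h3 := h1 x hx
    -- Otherwise `X` would be constant along the graph, although its `x`-derivative does not vanish.
    have hN1 : N 1 ≠ 0 := fun h0 => hN (by
      rw [h0] at h3
      ext i
      fin_cases i
      · simpa [hξ' x hx] using h3
      · exact h0)
    refine (mul_eq_zero.1 (?_ : N 1 * _ = 0)).resolve_left hN1
    linear_combination ev (der 0 X) x * h2 - ev (der 0 (der 0 X)) x * h3

end SecondOrderODE

/-! ### Smooth primitives and functions of one coordinate -/

theorem contDiff_vec : ContDiff ℝ ∞ fun p : ℝ × ℝ => (![p.1, p.2] : Plane) := by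
  refine contDiff_pi.2 fun i => ?_
  fin_cases i
  exacts [contDiff_fst, contDiff_snd]

theorem mem_ball_plane {p q : Plane} {ε : ℝ} (hε : 0 < ε) :
    q ∈ Metric.ball p ε ↔ q 0 ∈ Metric.ball (p 0) ε ∧ q 1 ∈ Metric.ball (p 1) ε := by
  simp [Metric.mem_ball, dist_pi_lt_iff hε, Fin.forall_fin_two]

open MeasureTheory in
open scoped Convolution in
/-- A smooth function of two variables has a smooth primitive with respect to the second
variable. -/
theorem exists_primitive {φ : Plane → ℝ} {p : Plane} {ε : ℝ} (hε : 0 < ε)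
    (hφ : ContDiffOn ℝ ∞ φ (Metric.ball p ε)) :
    ∃ u : Plane → ℝ, ContDiffOn ℝ ∞ u (Metric.ball p (ε / 4)) ∧
      (∀ q ∈ Metric.ball p (ε / 4), partialDeriv 1 u q = φ q) ∧ ∀ x, u ![x, p 1] = 0 := by
  -- The cutoff equals one where the primitive is needed and vanishes outside radius `ε / 2`, so `b
  -- φ`, continued by zero in the second variable, is smooth there without restriction.
  let b : ContDiffBump (p 1) := ⟨ε / 4, ε / 2, by positivity, by linarith⟩
  set g : ℝ → ℝ → ℝ := fun x t => b t * φ ![x, t] with hg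
  have hgs : ContDiffOn ℝ ∞ (Function.uncurry g) (Metric.ball (p 0) ε ×ˢ univ) := by
    rintro ⟨x, t⟩ ⟨hx, -⟩
    refine ContDiffAt.contDiffWithinAt ?_
    by_cases ht : t ∈ Metric.ball (p 1) ε
    · have h1 : ContDiffAt ℝ ∞ φ ![x, t] :=
        hφ.contDiffAt (Metric.isOpen_ball.mem_nhds ((mem_ball_plane hε).2 ⟨hx, ht⟩))
      exact (b.contDiff.contDiffAt.comp (x, t) contDiffAt_snd).mul
        (h1.comp (x, t) contDiff_vec.contDiffAt)
    · have h1 : t ∉ tsupport b := by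
        rw [b.tsupport_eq]
        intro h
        refine ht (Metric.mem_ball.2 ((Metric.mem_closedBall.1 h).trans_lt ?_))
        change ε / 2 < ε
        linarith
      have h2 : ∀ᶠ z : ℝ × ℝ in nhds (x, t), b z.2 = 0 :=
        continuousAt_snd.eventually (notMem_tsupport_iff_eventuallyEq.1 h1)
      refine (contDiffAt_const (c := (0 : ℝ))).congr_of_eventuallyEq (h2.mono fun z hz => ?_)
      simp [Function.uncurry, hg, hz]
  have hg0 : ∀ x t, x ∈ Metric.ball (p 0) ε → t ∉ Metric.closedBall (p 1) (ε / 2) → g x t = 0 := by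
    intro x t _ ht
    simp only [hg, b.zero_of_le_dist (le_of_lt (not_le.1 ht)), zero_mul]
  -- Convolution with the Heaviside function integrates from `-∞` to `y` and depends smoothly on the
  -- parameter. Subtracting its value at `p 1` gives the integral from `p 1`.
  set f : ℝ → ℝ := indicator (Ici 0) 1 with hf
  have hfl : LocallyIntegrable f :=
    (locallyIntegrable_const (1 : ℝ)).indicator measurableSet_Ici
  have hconv := contDiffOn_convolution_right_with_param (n := ⊤) (μ := volume)
    (ContinuousLinearMap.lsmul ℝ ℝ) Metric.isOpen_ball
    (isCompact_closedBall (p 1) (ε / 2)) hg0 hfl hgs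
  have hgc : ∀ x ∈ Metric.ball (p 0) ε, Continuous (g x) := fun x hx => by
    rw [← continuousOn_univ]
    exact hgs.continuousOn.comp (f := fun t => (x, t)) (by fun_prop) fun t _ => ⟨hx, mem_univ _⟩
  have hval : ∀ x y, (f ⋆[ContinuousLinearMap.lsmul ℝ ℝ, volume] g x) y = ∫ t in Iic y, g x t := by
    intro x y
    rw [convolution_lsmul_swap, ← integral_indicator measurableSet_Iic]
    refine integral_congr_ae (Filter.Eventually.of_forall fun t => ?_)
    by_cases h : t ≤ y <;> simp [hf, indicator, h]
  have hint : ∀ x ∈ Metric.ball (p 0) ε, Integrable (g x) := fun x hx =>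
    (hgc x hx).integrable_of_hasCompactSupport
      (HasCompactSupport.intro (isCompact_closedBall (p 1) (ε / 2)) fun t ht => hg0 x t hx ht)
  have hmem : ∀ q ∈ Metric.ball p (ε / 4), q 0 ∈ Metric.ball (p 0) ε := fun q hq =>
    Metric.ball_subset_ball (by linarith) ((mem_ball_plane (by positivity)).1 hq).1
  have hu : ContDiffOn ℝ ∞ (fun q : Plane => ∫ t in (p 1)..(q 1), g (q 0) t)
      (Metric.ball p (ε / 4)) := by
    have hc : ∀ i, ContDiff ℝ ∞ fun q : Plane => q i := fun i => contDiff_apply ℝ ℝ i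
    have h1 := hconv.comp (f := fun q : Plane => (q 0, q 1)) ((hc 0).prodMk (hc 1)).contDiffOn
      fun q (hq : q ∈ Metric.ball p (ε / 4)) => ⟨hmem q hq, mem_univ _⟩
    have h2 := hconv.comp (f := fun q : Plane => (q 0, p 1))
      ((hc 0).prodMk contDiff_const).contDiffOn
      fun q (hq : q ∈ Metric.ball p (ε / 4)) => ⟨hmem q hq, mem_univ _⟩
    refine (h1.sub h2).congr fun q hq => ?_
    simp only [Function.comp_apply, hval]
    exact (intervalIntegral.integral_Iic_sub_Iic (hint _ (hmem q hq)).integrableOn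
      (hint _ (hmem q hq)).integrableOn).symm
  refine ⟨_, hu, fun q hq => ?_, fun x => by simp⟩
  refine partialDeriv_one_eq (hu.differentiableAt_of_mem Metric.isOpen_ball hq) ?_
  have h1 : φ q = g (q 0) (q 1) := by
    simp only [hg]
    rw [b.one_of_mem_closedBall, one_mul, vec_eta]
    exact Metric.ball_subset_closedBall ((mem_ball_plane (by positivity)).1 hq).2
  rw [h1]
  simpa using (hgc _ (hmem q hq)).integral_hasStrictDerivAt (p 1) (q 1) |>.hasDerivAt

namespace smoothFunctions

variable {U : Opens Plane}

theorem exists_ofFst {F : ℝ → ℝ} {I : Set ℝ} (hI : IsOpen I) (hF : ContDiffOn ℝ ∞ F I)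
    (hU : ∀ q ∈ U, q 0 ∈ I) : ∃ f : smoothFunctions U, (∀ q : U, eval q f = F (q.1 0)) ∧
      (∀ q : U, eval q (der 0 f) = deriv F (q.1 0)) ∧ der 1 f = 0 := by
  have h : ContDiffOn ℝ ∞ (fun q : Plane => F (q 0)) U :=
    hF.comp (contDiff_apply ℝ ℝ 0).contDiffOn hU
  refine ⟨mk _ h, fun q => rfl, fun q => ?_, ext_eval fun q => ?_⟩
  · rw [eval_der_mk]
    refine partialDeriv_zero_eq (h.differentiableAt_of_mem U.isOpen q.2) ?_
    simpa using ((hF.contDiffAt (hI.mem_nhds (hU q q.2))).differentiableAt (by simp)).hasDerivAt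
  · rw [eval_der_mk, map_zero]
    refine partialDeriv_one_eq (h.differentiableAt_of_mem U.isOpen q.2) ?_
    simpa using hasDerivAt_const (q.1 1) (F (q.1 0))

/-- The box with centre `p`. -/
def box (p : Plane) (ε : ℝ) : Opens Plane := ⟨Metric.ball p ε, Metric.isOpen_ball⟩

/-- Identities involving a `y`-primitive can be checked on their `y`-derivatives and on the
horizontal line through the centre, where the primitive vanishes. -/
theorem eq_zero_of_der_one_eq_zero {p : Plane} {ε : ℝ} (hε : 0 < ε)
    {f : smoothFunctions (box p ε)} (hf : der 1 f = 0)
    (h : ∀ q : box p ε, q.1 1 = p 1 → eval q f = 0) : f = 0 := by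
  refine ext_eval fun q => ?_
  have hq := (mem_ball_plane hε).1 q.2
  have hseg : ∀ y ∈ Ioo (p 1 - ε) (p 1 + ε), (![q.1 0, y] : Plane) ∈ box p ε := fun y hy =>
    (mem_ball_plane hε).2 ⟨hq.1, by rwa [← Real.ball_eq_Ioo] at hy⟩
  have h1 : q.1 1 ∈ Ioo (p 1 - ε) (p 1 + ε) := by rw [← Real.ball_eq_Ioo]; exact hq.2
  have h2 : p 1 ∈ Ioo (p 1 - ε) (p 1 + ε) := ⟨by linarith, by linarith⟩
  have h4 := eval_eq_of_der_eq_zero hf hseg h1 h2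
  rw [h ⟨_, hseg _ h2⟩ rfl] at h4
  have h3 : (⟨_, hseg _ h1⟩ : box p ε) = q := Subtype.ext (vec_eta q.1)
  rw [← h3, h4, map_zero]

theorem eval_der_zero_eq_zero {p : Plane} {ε : ℝ} {f : smoothFunctions (box p ε)}
    (h : ∀ q : box p ε, q.1 1 = p 1 → eval q f = 0) (q : box p ε) (hq : q.1 1 = p 1) :
    eval q (der 0 f) = 0 := by
  refine partialDeriv_zero_eq ((contDiffOn_extend f).differentiableAt_of_mem (box p ε).isOpen q.2) ?_
  refine (hasDerivAt_const (q.1 0) (0 : ℝ)).congr_of_eventuallyEq ?_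
  have hc : ContinuousAt (fun t => (![t, q.1 1] : Plane)) (q.1 0) :=
    (hasDerivAt_vec_fst (q.1 0) (q.1 1)).continuousAt
  have := hc.eventually (p := fun r => r ∈ box p ε)
    (by simp only [vec_eta]; exact (box p ε).isOpen.mem_nhds q.2)
  filter_upwards [this] with t ht
  exact (extend_apply f ⟨_, ht⟩).trans (h _ hq)

end smoothFunctions

/-! ### Metrics and flat coordinates for the third and fifth equations -/

theorem exists_opens_const_add_ne_zero {D : Set Plane} (hD : IsOpen D) {p : Plane} (hp : p ∈ D)
    {f : Plane → ℝ} (hf : ContDiffOn ℝ ∞ f D) :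
    ∃ (c : ℝ) (U : Opens Plane), p ∈ U ∧ (U : Set Plane) ⊆ D ∧ ∀ q ∈ U, c + f q ≠ 0 :=
  -- The free additive constant of the potential makes `c + f` equal to `1` at `p`, hence nonzero
  -- nearby.
  ⟨1 - f p, ⟨D ∩ (fun q => 1 - f p + f q) ⁻¹' {0}ᶜ,
    (continuousOn_const.add hf.continuousOn).isOpen_inter_preimage hD isOpen_compl_singleton⟩,
    ⟨hp, by simp⟩, inter_subset_left, fun _ hq => hq.2⟩

theorem isOpen_dom_painleveIII (α β γ δ : ℝ) : IsOpen (painleveIII α β γ δ).dom :=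
  (isOpen_ne_fun (continuous_apply 0) continuous_const).inter
    (isOpen_ne_fun (continuous_apply 1) continuous_const)

open smoothFunctions SecondOrderODE

/-- In `X = log x`, `Y = log (y / x)` the equation is `d²Y/dX² = β e^(-Y) + δ e^(-2Y)`, autonomous
with energy function `1/κ = c + 2β e^(-Y) + δ e^(-2Y)`. Only the differentials of `X` and `Y` enter,
so signs of `x` and `y` play no role. -/
theorem isMetrisableAt_painleveIII_of_left (β δ : ℝ) {p : Plane}
    (hp : p ∈ (painleveIII 0 β 0 δ).dom) : (painleveIII 0 β 0 δ).IsMetrisableAt p := by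
  have hc : ∀ i, ContDiff ℝ ∞ fun q : Plane => q i := fun i => contDiff_apply ℝ ℝ i
  have hiy := (hc 1).contDiffOn.inv fun q (hq : q ∈ (painleveIII 0 β 0 δ).dom) => hq.2
  obtain ⟨c, U, hpU, hU, hne⟩ := exists_opens_const_add_ne_zero (isOpen_dom_painleveIII 0 β 0 δ) hp
    (f := fun q => 2 * β * q 0 * (q 1)⁻¹ + δ * q 0 ^ 2 * (q 1)⁻¹ ^ 2)
    (((contDiff_const.mul (hc 0)).contDiffOn.mul hiy).add
      ((contDiff_const.mul ((hc 0).pow 2)).contDiffOn.mul (hiy.pow 2)))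
  have hx0 : ∀ q : U, q.1 0 ≠ 0 := fun q => (hU q.2).1
  have hy0 : ∀ q : U, q.1 1 ≠ 0 := fun q => (hU q.2).2
  obtain ⟨iy, eiy, diy⟩ := exists_inv (f := (coord 1 : smoothFunctions U)) hy0
  obtain ⟨ix, eix, dix⟩ := exists_inv (f := (coord 0 : smoothFunctions U)) hx0
  set h : smoothFunctions U := algebraMap ℝ _ c + (2 * algebraMap ℝ _ β * coord 0 * iy
    + algebraMap ℝ _ δ * coord 0 ^ 2 * iy ^ 2) with hh
  obtain ⟨κ, eκ, dκ⟩ := exists_inv (f := h) fun q => by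
    simpa [hh, map_ofNat, eval_coord, eiy] using hne q q.2
  have d00 : der 0 (coord 0 : smoothFunctions U) = 1 := der_coord 0 0
  have d01 : der 0 (coord 1 : smoothFunctions U) = 0 := der_coord 0 1
  have d10 : der 1 (coord 0 : smoothFunctions U) = 0 := der_coord 1 0
  have d11 : der 1 (coord 1 : smoothFunctions U) = 1 := der_coord 1 1
  have hxx : coord 0 * ix = 1 := ext_eval fun q => by simp [eval_coord, eix, hx0]
  refine isMetrisableAt_of_coframe hpU hU (ξ := ix) (m := -ix) (n := iy) (κ := κ)
    (f := algebraMap ℝ _ β * coord 0 * iy + algebraMap ℝ _ δ * coord 0 ^ 2 * iy ^ 2)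
    (fun q => by simpa [eix, eval_coord] using hx0 q)
    (fun q => by simpa [eiy, eval_coord] using hy0 q) (fun q => by
      rw [eκ]
      exact inv_ne_zero (by simpa [hh, map_ofNat, eval_coord, eiy] using hne q q.2)) (by simp [dix, d10])
    (by simp [dix, diy, d01, d10]) ?_ ?_ fun q v => ?_
  · rw [dκ, hh]
    simp [Derivation.leibniz_pow, Derivation.apply_ofNat, map_ofNat, dix, diy, d00, d01]
    linear_combination -2 * κ ^ 2 * iy * (algebraMap ℝ _ β + algebraMap ℝ _ δ * coord 0 * iy) * hxx
  · rw [dκ, hh]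
    simp [Derivation.leibniz_pow, Derivation.apply_ofNat, map_ofNat, dix, diy, d10, d11]
    ring
  · have h1 := hx0 q
    have h2 := hy0 q
    simp [dix, diy, d00, d01, d10, d11, eix, eiy, eval_coord, painleveIII]
    field_simp
    ring

/-- The same with `Y = log (x y)`: the equation is `d²Y/dX² = α e^Y + γ e^(2Y)`. The substitution `y
↦ 1/y` exchanges the two cases. -/
theorem isMetrisableAt_painleveIII_of_right (α γ : ℝ) {p : Plane}
    (hp : p ∈ (painleveIII α 0 γ 0).dom) : (painleveIII α 0 γ 0).IsMetrisableAt p := by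
  have hc : ∀ i, ContDiff ℝ ∞ fun q : Plane => q i := fun i => contDiff_apply ℝ ℝ i
  obtain ⟨c, U, hpU, hU, hne⟩ := exists_opens_const_add_ne_zero (isOpen_dom_painleveIII α 0 γ 0) hp
    (f := fun q => -(2 * α * q 0 * q 1 + γ * q 0 ^ 2 * q 1 ^ 2))
    (((contDiff_const.mul (hc 0)).mul (hc 1)).add
      ((contDiff_const.mul ((hc 0).pow 2)).mul ((hc 1).pow 2))).neg.contDiffOn
  have hx0 : ∀ q : U, q.1 0 ≠ 0 := fun q => (hU q.2).1
  have hy0 : ∀ q : U, q.1 1 ≠ 0 := fun q => (hU q.2).2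
  obtain ⟨iy, eiy, diy⟩ := exists_inv (f := (coord 1 : smoothFunctions U)) hy0
  obtain ⟨ix, eix, dix⟩ := exists_inv (f := (coord 0 : smoothFunctions U)) hx0
  set h : smoothFunctions U := algebraMap ℝ _ c - (2 * algebraMap ℝ _ α * coord 0 * coord 1
    + algebraMap ℝ _ γ * coord 0 ^ 2 * coord 1 ^ 2) with hh
  obtain ⟨κ, eκ, dκ⟩ := exists_inv (f := h) fun q => by
    simpa [hh, map_ofNat, eval_coord, sub_eq_add_neg] using hne q q.2
  have d00 : der 0 (coord 0 : smoothFunctions U) = 1 := der_coord 0 0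
  have d01 : der 0 (coord 1 : smoothFunctions U) = 0 := der_coord 0 1
  have d10 : der 1 (coord 0 : smoothFunctions U) = 0 := der_coord 1 0
  have d11 : der 1 (coord 1 : smoothFunctions U) = 1 := der_coord 1 1
  have hxx : coord 0 * ix = 1 := ext_eval fun q => by simp [eval_coord, eix, hx0]
  have hyy : coord 1 * iy = 1 := ext_eval fun q => by simp [eval_coord, eiy, hy0]
  refine isMetrisableAt_of_coframe hpU hU (ξ := ix) (m := ix) (n := iy) (κ := κ)
    (f := algebraMap ℝ _ α * coord 0 * coord 1 + algebraMap ℝ _ γ * coord 0 ^ 2 * coord 1 ^ 2)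
    (fun q => by simpa [eix, eval_coord] using hx0 q)
    (fun q => by simpa [eiy, eval_coord] using hy0 q) (fun q => by
      rw [eκ]
      exact inv_ne_zero (by simpa [hh, map_ofNat, eval_coord, sub_eq_add_neg] using hne q q.2))
    (by simp [dix, d10]) (by simp [dix, diy, d01, d10]) ?_ ?_ fun q v => ?_
  · rw [dκ, hh]
    simp [Derivation.leibniz_pow, Derivation.apply_ofNat, map_ofNat, dix, diy, d00, d01]
    linear_combination -2 * κ ^ 2 * coord 1 *
      (algebraMap ℝ _ α + algebraMap ℝ _ γ * coord 0 * coord 1) * hxx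
  · rw [dκ, hh]
    simp [Derivation.leibniz_pow, Derivation.apply_ofNat, map_ofNat, dix, diy, d10, d11]
    linear_combination -2 * κ ^ 2 * coord 0 *
      (algebraMap ℝ _ α + algebraMap ℝ _ γ * coord 0 * coord 1) * hyy
  · have h1 := hx0 q
    have h2 := hy0 q
    simp [dix, diy, d00, d01, d10, d11, eix, eiy, eval_coord, painleveIII]
    field_simp
    ring

theorem exists_log_fst {U : Opens Plane} (hx : ∀ q : U, q.1 0 ≠ 0) {f : smoothFunctions U}
    (hf : ∀ q, eval q f = (eval q (coord 0))⁻¹) :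
    ∃ X : smoothFunctions U, der 0 X = f ∧ der 1 X = 0 := by
  obtain ⟨X, -, h1, h2⟩ := exists_ofFst (U := U) (F := Real.log) isOpen_compl_singleton
    Real.contDiffOn_log fun q hq => hx ⟨q, hq⟩
  exact ⟨X, ext_eval fun q => by rw [h1, Real.deriv_log, hf, eval_coord], h2⟩

theorem isFlatAt_painleveIII_zero {p : Plane} (hp : p ∈ (painleveIII 0 0 0 0).dom) :
    (painleveIII 0 0 0 0).IsFlatAt p := by
  set U : Opens Plane := ⟨_, isOpen_dom_painleveIII 0 0 0 0⟩ with hU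
  have hx0 : ∀ q : U, q.1 0 ≠ 0 := fun q => q.2.1
  have hy0 : ∀ q : U, q.1 1 ≠ 0 := fun q => q.2.2
  obtain ⟨iy, eiy, diy⟩ := exists_inv (f := (coord 1 : smoothFunctions U)) hy0
  obtain ⟨ix, eix, dix⟩ := exists_inv (f := (coord 0 : smoothFunctions U)) hx0
  have d00 : der 0 (coord 0 : smoothFunctions U) = 1 := der_coord 0 0
  have d01 : der 0 (coord 1 : smoothFunctions U) = 0 := der_coord 0 1
  have d10 : der 1 (coord 0 : smoothFunctions U) = 0 := der_coord 1 0
  have d11 : der 1 (coord 1 : smoothFunctions U) = 1 := der_coord 1 1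
  obtain ⟨X, xX, yX⟩ := exists_log_fst hx0 eix
  have hlog : ContDiffOn ℝ ∞ (fun q : Plane => Real.log (q 1)) U :=
    (contDiff_apply ℝ ℝ 1).contDiffOn.log fun q hq => hy0 ⟨q, hq⟩
  have xY : der 0 (mk _ hlog) = 0 := ext_eval fun q => by
    rw [eval_der_mk, map_zero]
    exact partialDeriv_zero_eq (hlog.differentiableAt_of_mem U.isOpen q.2)
      (by simpa using hasDerivAt_const (q.1 0) (Real.log (q.1 1)))
  have yY : der 1 (mk _ hlog) = iy := ext_eval fun q => by
    rw [eval_der_mk, eiy, eval_coord]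
    exact partialDeriv_one_eq (hlog.differentiableAt_of_mem U.isOpen q.2)
      (by simpa using Real.hasDerivAt_log (hy0 q))
  refine isFlatAt_of_coordinates (U := U) hp subset_rfl (Y := mk _ hlog) yX
    (fun q => by simpa [xX, eix, eval_coord] using hx0 q)
    (fun q => by simpa [yY, eiy, eval_coord] using hy0 q) fun q v => ?_
  have h1 := hx0 q
  have h2 := hy0 q
  simp [xX, xY, yY, dix, diy, d00, d01, d10, d11, eix, eiy, eval_coord, painleveIII]
  field_simp
  ring

theorem isOpen_signed (s : ℝ) (α β γ δ : ℝ) :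
    IsOpen ((painleveV α β γ δ).dom ∩ {q | 0 < s * q 1}) :=
  (isOpen_dom_painleveV α β γ δ).inter
    (isOpen_lt continuous_const (continuous_const.mul (continuous_apply 1)))

/-- Away from the fixed singularities, `1 / (√|y| (y - 1))` is smooth. -/
theorem exists_painleveV_coframe {U : Opens Plane} {s : ℝ} (hs : s ^ 2 = 1)
    (hy : ∀ q ∈ U, 0 < s * q 1) (hz : ∀ q ∈ U, q 1 - 1 ≠ 0) :
    ∃ n : smoothFunctions U, (∀ q, eval q n = (√(s * q.1 1) * (q.1 1 - 1))⁻¹) ∧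
      (∀ q, eval q n ≠ 0) ∧ der 0 n = 0 ∧
      (∀ q, eval q n ^ 2 * (q.1 1 * (q.1 1 - 1) ^ 2) = s) ∧
      ∀ q, eval q (der 1 n) = -(1 / (2 * q.1 1) + 1 / (q.1 1 - 1)) * eval q n := by
  have hc : ContDiff ℝ ∞ fun q : Plane => s * q 1 := contDiff_const.mul (contDiff_apply ℝ ℝ 1)
  have hsm : ContDiffOn ℝ ∞ (fun q : Plane => (√(s * q 1) * (q 1 - 1))⁻¹) U :=
    ((hc.contDiffOn.sqrt fun q hq => (hy q hq).ne').mul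
      ((contDiff_apply ℝ ℝ 1).sub contDiff_const).contDiffOn).inv fun q hq =>
        mul_ne_zero (Real.sqrt_pos.2 (hy q hq)).ne' (hz q hq)
  refine ⟨mk _ hsm, fun q => rfl, fun q => ?_, ext_eval fun q => ?_, fun q => ?_, fun q => ?_⟩
  · exact inv_ne_zero (mul_ne_zero (Real.sqrt_pos.2 (hy q q.2)).ne' (hz q q.2))
  · rw [eval_der_mk, map_zero]
    exact partialDeriv_zero_eq (hsm.differentiableAt_of_mem U.isOpen q.2)
      (by simpa using hasDerivAt_const (q.1 0) (√(s * q.1 1) * (q.1 1 - 1))⁻¹)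
  · have h1 := hz q q.2
    have h2 := hy q q.2
    have h3 : q.1 1 ≠ 0 := right_ne_zero_of_mul h2.ne'
    have h4 : s ≠ 0 := left_ne_zero_of_mul h2.ne'
    rw [eval_mk, inv_pow, mul_pow, Real.sq_sqrt h2.le]
    field_simp
    rw [hs]
  · have h1 := hz q q.2
    have h2 := hy q q.2
    have h3 : q.1 1 ≠ 0 := right_ne_zero_of_mul h2.ne'
    have h4 := (Real.sqrt_pos.2 h2).ne'
    have h5 := Real.sq_sqrt h2.le
    rw [eval_der_mk, eval_mk]
    refine partialDeriv_one_eq (hsm.differentiableAt_of_mem U.isOpen q.2) ?_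
    have h := ((((hasDerivAt_id' (q.1 1)).const_mul s).sqrt h2.ne').fun_mul
      ((hasDerivAt_id' (q.1 1)).sub_const 1)).fun_inv (mul_ne_zero h4 h1)
    simp only [Matrix.cons_val_one, Matrix.cons_val_fin_one]
    refine h.congr_deriv ?_
    field_simp
    rw [h5]
    ring

/-- With `dX = dx / x` and `dY = n dy`, where `n = 1 / (√|y| (y - 1))`, the equation is autonomous:
`f = n (y - 1)² (α y + β / y)`. Since `n² y (y - 1)²` is the sign `s` of `y`, the energy integrates
to `c - 2s (α y - β / y)`. -/
theorem isMetrisableAt_painleveV (α β : ℝ) {p : Plane} (hp : p ∈ (painleveV α β 0 0).dom) :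
    (painleveV α β 0 0).IsMetrisableAt p := by
  obtain ⟨s, hs, hsp⟩ : ∃ s : ℝ, s ^ 2 = 1 ∧ 0 < s * p 1 := by
    rcases lt_or_gt_of_ne hp.2.1 with h | h
    exacts [⟨-1, by norm_num, by linarith⟩, ⟨1, by norm_num, by linarith⟩]
  have hc : ∀ i, ContDiff ℝ ∞ fun q : Plane => q i := fun i => contDiff_apply ℝ ℝ i
  have hiy := (hc 1).contDiffOn.inv
    fun q (hq : q ∈ (painleveV α β 0 0).dom ∩ {q | 0 < s * q 1}) => hq.1.2.1
  obtain ⟨c, U, hpU, hU, hne⟩ := exists_opens_const_add_ne_zero (isOpen_signed s α β 0 0) ⟨hp, hsp⟩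
    (f := fun q => -(2 * s * α * q 1 - 2 * s * β * (q 1)⁻¹))
    ((contDiff_const.mul (hc 1)).contDiffOn.sub (contDiffOn_const.mul hiy)).neg
  have hx0 : ∀ q : U, q.1 0 ≠ 0 := fun q => (hU q.2).1.1
  have hy0 : ∀ q : U, q.1 1 ≠ 0 := fun q => (hU q.2).1.2.1
  have hz0 : ∀ q : U, q.1 1 - 1 ≠ 0 := fun q => sub_ne_zero.2 (hU q.2).1.2.2
  obtain ⟨n, -, n0, xn, n2, yn⟩ := exists_painleveV_coframe (U := U) hs (fun q hq => (hU hq).2)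
    fun q hq => hz0 ⟨q, hq⟩
  obtain ⟨iy, eiy, diy⟩ := exists_inv (f := (coord 1 : smoothFunctions U)) hy0
  obtain ⟨ix, eix, dix⟩ := exists_inv (f := (coord 0 : smoothFunctions U)) hx0
  set h : smoothFunctions U := algebraMap ℝ _ c - (algebraMap ℝ _ (2 * s * α) * coord 1
    - algebraMap ℝ _ (2 * s * β) * iy) with hh
  obtain ⟨κ, eκ, dκ⟩ := exists_inv (f := h) fun q => by
    simpa [hh, map_ofNat, eval_coord, eiy, sub_eq_add_neg] using hne q q.2
  have d00 : der 0 (coord 0 : smoothFunctions U) = 1 := der_coord 0 0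
  have d01 : der 0 (coord 1 : smoothFunctions U) = 0 := der_coord 0 1
  have d10 : der 1 (coord 0 : smoothFunctions U) = 0 := der_coord 1 0
  have d11 : der 1 (coord 1 : smoothFunctions U) = 1 := der_coord 1 1
  refine isMetrisableAt_of_coframe hpU (hU.trans inter_subset_left) (ξ := ix) (m := 0) (n := n)
    (κ := κ) (f := n * (coord 1 - 1) ^ 2 * (algebraMap ℝ _ α * coord 1 + algebraMap ℝ _ β * iy))
    (fun q => by simpa [eix, eval_coord] using hx0 q) n0 (fun q => by
      rw [eκ]
      exact inv_ne_zero (by simpa [hh, map_ofNat, eval_coord, eiy, sub_eq_add_neg] using hne q q.2))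
    (by simp [dix, d10]) (by simp [xn]) ?_ ?_ fun q v => ?_
  · rw [dκ, hh]
    simp [diy, d01]
  · rw [dκ, hh]
    refine ext_eval fun q => ?_
    have h2 := hy0 q
    have h3 := n2 q
    simp [diy, d11, eiy, eval_coord, map_ofNat, Derivation.apply_ofNat]
    field_simp
    linear_combination (-eval q κ ^ 2 * (α * q.1 1 ^ 2 + β)) * h3
  · have h1 := hx0 q
    have h2 := hy0 q
    have h3 := hz0 q
    simp [xn, yn, dix, diy, d00, d01, d10, d11, eix, eiy, eval_coord, painleveV]
    field_simp
    ring

theorem isFlatAt_painleveV_zero {p : Plane} (hp : p ∈ (painleveV 0 0 0 0).dom) :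
    (painleveV 0 0 0 0).IsFlatAt p := by
  obtain ⟨s, hs, hsp⟩ : ∃ s : ℝ, s ^ 2 = 1 ∧ 0 < s * p 1 := by
    rcases lt_or_gt_of_ne hp.2.1 with h | h
    exacts [⟨-1, by norm_num, by linarith⟩, ⟨1, by norm_num, by linarith⟩]
  obtain ⟨ε, hε, hball⟩ := Metric.isOpen_iff.1 (isOpen_signed s 0 0 0 0) p ⟨hp, hsp⟩
  have hφ : ContDiffOn ℝ ∞ (fun q : Plane => (√(s * q 1) * (q 1 - 1))⁻¹) (Metric.ball p ε) := by
    obtain ⟨n, en, -⟩ := exists_painleveV_coframe (U := box p ε) hs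
      (fun q hq => (hball hq).2) fun q hq => sub_ne_zero.2 (hball hq).1.2.2
    exact (contDiffOn_extend n).congr fun q hq =>
      (en ⟨q, hq⟩).symm.trans (extend_apply n ⟨q, hq⟩).symm
  obtain ⟨u, hu, huy, hu0⟩ := exists_primitive hε hφ
  have hε4 : 0 < ε / 4 := by positivity
  set U := box p (ε / 4) with hU
  have hu : ContDiffOn ℝ ∞ u U := hu
  have hdom : ∀ q : U, q.1 ∈ (painleveV 0 0 0 0).dom ∩ {q | 0 < s * q 1} :=
    fun q => hball (Metric.ball_subset_ball (by linarith) q.2)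
  have hx0 : ∀ q : U, q.1 0 ≠ 0 := fun q => (hdom q).1.1
  have hy0 : ∀ q : U, q.1 1 ≠ 0 := fun q => (hdom q).1.2.1
  have hz0 : ∀ q : U, q.1 1 - 1 ≠ 0 := fun q => sub_ne_zero.2 (hdom q).1.2.2
  obtain ⟨n, en, n0, xn, -, yn⟩ := exists_painleveV_coframe (U := U) hs
    (fun q hq => (hdom ⟨q, hq⟩).2) fun q hq => hz0 ⟨q, hq⟩
  obtain ⟨ix, eix, dix⟩ := exists_inv (f := (coord 0 : smoothFunctions U)) hx0
  have d00 : der 0 (coord 0 : smoothFunctions U) = 1 := der_coord 0 0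
  obtain ⟨X, xX, yX⟩ := exists_log_fst hx0 eix
  have yY : der 1 (mk u hu : smoothFunctions U) = n := ext_eval fun q => by
    rw [eval_der_mk, huy q q.2, en]
  -- The integrand does not involve `x`, so `∂_x` of its primitive has zero `y`-derivative; it also
  -- vanishes on the base line `y = p 1`.
  have xY : der 0 (mk u hu : smoothFunctions U) = 0 := by
    refine eq_zero_of_der_one_eq_zero hε4 (by rw [der_comm, yY, xn])
      (eval_der_zero_eq_zero fun q hq => ?_)
    rw [eval_mk, ← vec_eta q.1, hq, hu0]
  refine isFlatAt_of_coordinates (U := U) (Metric.mem_ball_self hε4)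
    (fun q hq => (hdom ⟨q, hq⟩).1) (Y := mk u hu) yX
    (fun q => by simpa [xX, eix, eval_coord] using hx0 q) (fun q => by rw [yY]; exact n0 q)
    fun q v => ?_
  have h1 := hx0 q
  have h2 := hy0 q
  have h3 := hz0 q
  simp [xX, xY, yY, xn, yn, dix, d00, eix, eval_coord, painleveV]
  field_simp
  ring

/-! ### The flat case of the sixth equation -/

open smoothFunctions SecondOrderODE

/-- A second order equation with straightening coordinates is metrised by the flat metric. -/
theorem SecondOrderODE.isMetrisableAt_of_coordinates {R : SecondOrderODE} {U : Opens Plane}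
    {p : Plane} (hp : p ∈ U) (hdom : (U : Set Plane) ⊆ R.dom) {X Y : smoothFunctions U}
    (yX : der 1 X = 0) (hξ : ∀ q, eval q (der 0 X) ≠ 0) (hn : ∀ q, eval q (der 1 Y) ≠ 0)
    (h : ∀ (q : U) (v : ℝ), eval q (der 0 X) * (eval q (der 0 (der 0 Y))
        + 2 * eval q (der 1 (der 0 Y)) * v + eval q (der 1 (der 1 Y)) * v ^ 2
        + eval q (der 1 Y) * R.rhs (q.1 0) (q.1 1) v)
      - eval q (der 0 (der 0 X)) * (eval q (der 0 Y) + eval q (der 1 Y) * v) = 0) :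
    R.IsMetrisableAt p :=
  isMetrisableAt_of_coframe hp hdom (ξ := der 0 X) (m := der 0 Y) (n := der 1 Y) (κ := 1) (f := 0)
    hξ hn (fun q => by simp) (by rw [der_comm, yX, map_zero]) (der_comm 0 1 Y) (by simp) (by simp)
    fun q v => by rw [h, map_zero, mul_zero]

theorem exists_solution_linear {I : Set ℝ} (hI : IsOpen I) {r s c : ℝ → ℝ}
    (hr : ContDiffOn ℝ ∞ r I) (hs : ContDiffOn ℝ ∞ s I) (hc : ContDiffOn ℝ ∞ c I) {x₀ : ℝ}
    (hx₀ : x₀ ∈ I) (y₀ v₀ : ℝ) :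
    ∃ (y : ℝ → ℝ) (ε : ℝ), 0 < ε ∧ y x₀ = y₀ ∧ deriv y x₀ = v₀ ∧
      ContDiffOn ℝ ∞ y (Metric.ball x₀ ε) ∧ ∀ x ∈ Metric.ball x₀ ε,
        deriv (deriv y) x + r x * deriv y x + s x * y x + c x = 0 := by
  have hF : ContDiffOn ℝ ∞
      (fun p : ℝ × ℝ × ℝ => -(r p.1 * p.2.2 + s p.1 * p.2.1 + c p.1)) {p | p.1 ∈ I} := by
    have h1 : ContDiffOn ℝ ∞ (fun p : ℝ × ℝ × ℝ => p.1) {p | p.1 ∈ I} := contDiff_fst.contDiffOn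
    have h2 : MapsTo (fun p : ℝ × ℝ × ℝ => p.1) {p | p.1 ∈ I} I := fun p hp => hp
    exact ((((hr.comp h1 h2).mul contDiff_snd.snd.contDiffOn).add
      ((hs.comp h1 h2).mul contDiff_snd.fst.contDiffOn)).add (hc.comp h1 h2)).neg
  obtain ⟨y, ε, hε, h0, h1, hy, hsol⟩ := exists_solution_second_order (hI.preimage continuous_fst) hF
    (x₀ := x₀) (y₀ := y₀) (v₀ := v₀) hx₀
  refine ⟨y, ε, hε, h0, h1, by rwa [Real.ball_eq_Ioo], fun x hx => ?_⟩
  rw [Real.ball_eq_Ioo] at hx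
  rw [(hsol x hx).2]
  ring

namespace smoothFunctions

variable {U : Opens Plane}

theorem exists_ofFst_two {F : ℝ → ℝ} {I : Set ℝ} (hI : IsOpen I) (hF : ContDiffOn ℝ ∞ F I)
    (hU : ∀ q ∈ U, q 0 ∈ I) : ∃ f : smoothFunctions U, (∀ q : U, eval q f = F (q.1 0)) ∧
      (∀ q : U, eval q (der 0 f) = deriv F (q.1 0)) ∧
      (∀ q : U, eval q (der 0 (der 0 f)) = deriv (deriv F) (q.1 0)) ∧ der 1 f = 0 := by
  obtain ⟨f, h1, h2, h3⟩ := exists_ofFst hI hF hU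
  obtain ⟨f', h1', h2', -⟩ := exists_ofFst hI
    ((contDiffOn_succ_iff_deriv_of_isOpen (n := ∞) hI).1 (by simpa using hF)).2.2 hU
  have : der 0 f = f' := ext_eval fun q => by rw [h2, h1']
  exact ⟨f, h1, h2, fun q => by rw [this, h2'], h3⟩

/-- The function `1 / √|P|` and its derivatives. -/
theorem exists_inv_sqrt {P : Plane → ℝ} {s : ℝ} (hP : ContDiffOn ℝ ∞ P U)
    (hs : ∀ q ∈ U, 0 < s * P q) : ∃ n : smoothFunctions U,
      (∀ q : U, eval q n = (√(s * P q))⁻¹) ∧ (∀ q, eval q n ≠ 0) ∧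
      ∀ i, ∀ q : U, 2 * P q * eval q (der i n) = -(partialDeriv i P q * eval q n) := by
  have hsm : ContDiffOn ℝ ∞ (fun q : Plane => (√(s * P q))⁻¹) U :=
    ((contDiffOn_const.mul hP).sqrt fun q hq => (hs q hq).ne').inv fun q hq =>
      (Real.sqrt_pos.2 (hs q hq)).ne'
  refine ⟨mk _ hsm, fun q => rfl, fun q => inv_ne_zero (Real.sqrt_pos.2 (hs q q.2)).ne',
    fun i q => ?_⟩
  have hn : eval q (mk _ hsm) ≠ 0 := inv_ne_zero (Real.sqrt_pos.2 (hs q q.2)).ne'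
  have hs0 : s ≠ 0 := left_ne_zero_of_mul (hs q q.2).ne'
  -- Differentiating `s n² P = 1` yields the derivatives of `n` without handling the square root.
  have h1 : algebraMap ℝ (smoothFunctions U) s * (mk _ hsm ^ 2 * mk P hP) = 1 :=
    ext_eval fun q => by
      have h2 := hs q q.2
      simp only [map_mul, map_pow, AlgHom.commutes, Algebra.algebraMap_self, RingHom.id_apply,
        eval_mk, inv_pow, map_one, Real.sq_sqrt h2.le]
      have h3 : P q ≠ 0 := right_ne_zero_of_mul h2.ne'
      have h4 : s ≠ 0 := left_ne_zero_of_mul h2.ne'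
      field_simp
  have h2 := congrArg (fun f => eval q (der i f)) h1
  simp only [Derivation.leibniz, Derivation.leibniz_pow, smul_eq_mul, Derivation.map_algebraMap,
    Derivation.map_one_eq_zero, nsmul_eq_mul, map_add, map_mul, map_zero, map_pow, map_natCast,
    mul_zero, add_zero, AlgHom.commutes, Algebra.algebraMap_self, RingHom.id_apply,
    Nat.add_one_sub_one, pow_one, eval_der_mk i P, eval_mk P] at h2
  have h3 := (mul_eq_zero.1 h2).resolve_left hs0
  refine mul_left_cancel₀ hn ?_
  push_cast at h3
  linear_combination h3

end smoothFunctions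

/-- Coordinates `(X(x), Y(x, y))` straightening the flat case of the sixth Painlevé equation. -/
theorem exists_coordinates_painleveVI {p : Plane} (hp : p ∈ (painleveVI 0 0 0 (1 / 2)).dom) :
    ∃ (U : Opens Plane) (X Y : smoothFunctions U), p ∈ U ∧
      (U : Set Plane) ⊆ (painleveVI 0 0 0 (1 / 2)).dom ∧ der 1 X = 0 ∧
      (∀ q, eval q (der 0 X) ≠ 0) ∧ (∀ q, eval q (der 1 Y) ≠ 0) ∧
      ∀ (q : U) (v : ℝ), eval q (der 0 X) * (eval q (der 0 (der 0 Y))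
        + 2 * eval q (der 1 (der 0 Y)) * v + eval q (der 1 (der 1 Y)) * v ^ 2
        + eval q (der 1 Y) * (painleveVI 0 0 0 (1 / 2)).rhs (q.1 0) (q.1 1) v)
      - eval q (der 0 (der 0 X)) * (eval q (der 0 Y) + eval q (der 1 Y) * v) = 0 := by
  set D := (painleveVI 0 0 0 (1 / 2)).dom with hD
  have hP0 : ∀ q ∈ D, painleveCubic q ≠ 0 := fun q hq =>
    mul_ne_zero (mul_ne_zero hq.2.2.1 (sub_ne_zero.2 hq.2.2.2.1)) (sub_ne_zero.2 hq.2.2.2.2)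
  obtain ⟨s, hsp⟩ : ∃ s : ℝ, 0 < s * painleveCubic p := by
    rcases lt_or_gt_of_ne (hP0 p hp) with h | h
    exacts [⟨-1, by linarith⟩, ⟨1, by linarith⟩]
  have hopen : IsOpen (D ∩ {q | 0 < s * painleveCubic q}) :=
    (isOpen_dom_painleveVI 0 0 0 (1 / 2)).inter
      (isOpen_lt continuous_const (continuous_const.mul contDiff_painleveCubic.continuous))
  obtain ⟨ε, hε, hball⟩ := Metric.isOpen_iff.1 hopen p ⟨hp, hsp⟩
  have hφ : ContDiffOn ℝ ∞ (fun q => (√(s * painleveCubic q))⁻¹) (Metric.ball p ε) := by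
    obtain ⟨n, en, -⟩ := exists_inv_sqrt (U := box p ε) contDiff_painleveCubic.contDiffOn
      fun q hq => (hball hq).2
    exact (contDiffOn_extend n).congr fun q hq =>
      (en ⟨q, hq⟩).symm.trans (extend_apply n ⟨q, hq⟩).symm
  obtain ⟨u, hu, huy, hu0⟩ := exists_primitive hε hφ
  set I := Metric.ball (p 0) ε with hI
  have hIm : MapsTo (fun x => (![x, p 1] : Plane)) I (Metric.ball p ε) := fun x hx =>
    (mem_ball_plane hε).2 ⟨hx, by simpa using hε⟩
  have hI0 : ∀ x ∈ I, x ≠ 0 := fun x hx => (hball (hIm hx)).1.1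
  have hI1 : ∀ x ∈ I, x - 1 ≠ 0 := fun x hx => sub_ne_zero.2 (hball (hIm hx)).1.2.1
  have hIz : ∀ x ∈ I, p 1 - x ≠ 0 := fun x hx => sub_ne_zero.2 (hball (hIm hx)).1.2.2.2.2
  have hid : ContDiffOn ℝ ∞ (fun x : ℝ => x) I := contDiff_fun_id.contDiffOn
  have hix := hid.inv hI0
  have hit := (hid.sub contDiffOn_const).inv hI1
  have hvec : ContDiffOn ℝ ∞ (fun x => (![x, p 1] : Plane)) I :=
    (contDiff_vec.comp (contDiff_fun_id.prodMk contDiff_const)).contDiffOn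
  have hr : ContDiffOn ℝ ∞ (fun x : ℝ => x⁻¹ + (x - 1)⁻¹) I := hix.add hit
  have hs : ContDiffOn ℝ ∞ (fun x : ℝ => 1 / 4 * x⁻¹ * (x - 1)⁻¹) I :=
    (contDiffOn_const.mul hix).mul hit
  -- The elliptic integral `v` starts at `p 1` instead of a branch point, so its Picard–Fuchs
  -- equation acquires a boundary term `H(x)`, which `F` below compensates.
  set H : ℝ → ℝ := fun x => (√(s * painleveCubic ![x, p 1]))⁻¹
    * (1 / 2 * x⁻¹ * (x - 1)⁻¹ * (p 1 * (p 1 - 1)) * (p 1 - x)⁻¹) with hH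
  have hHs : ContDiffOn ℝ ∞ H I := (hφ.comp hvec hIm).mul
    ((((contDiffOn_const.mul hix).mul hit).mul contDiffOn_const).mul
      ((contDiffOn_const.sub hid).inv hIz))
  have hpI : p 0 ∈ I := Metric.mem_ball_self hε
  obtain ⟨F, εF, hεF, -, -, hF, eF⟩ :=
    exists_solution_linear Metric.isOpen_ball hr hs hHs hpI 0 0
  -- `ω₁`, `ω₂` are independent solutions of the homogeneous Picard–Fuchs equation `ω'' + (1/x +
  -- 1/(x-1)) ω' + ω / (4x(x-1)) = 0`, with Wronskian `1` at `p 0`.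
  obtain ⟨ω₁, ε₁, hε₁, ω₁0, ω₁1, hω₁, eω₁⟩ :=
    exists_solution_linear Metric.isOpen_ball hr hs (contDiffOn_const (c := 0)) hpI 1 0
  obtain ⟨ω₂, ε₂, hε₂, ω₂0, ω₂1, hω₂, eω₂⟩ :=
    exists_solution_linear Metric.isOpen_ball hr hs (contDiffOn_const (c := 0)) hpI 0 1
  have hd : ∀ {F : ℝ → ℝ} {ε : ℝ}, 0 < ε → ContDiffOn ℝ ∞ F (Metric.ball (p 0) ε) →
      ContinuousAt F (p 0) ∧ ContinuousAt (deriv F) (p 0) := fun {F ε} hε hF =>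
    have hm := Metric.isOpen_ball.mem_nhds (Metric.mem_ball_self (x := p 0) hε)
    ⟨(hF.contDiffAt hm).continuousAt, (((contDiffOn_succ_iff_deriv_of_isOpen (n := ∞)
      Metric.isOpen_ball).1 (by simpa using hF)).2.2.contDiffAt hm).continuousAt⟩
  have hev : ∀ᶠ x in nhds (p 0), ω₁ x ≠ 0 ∧ deriv ω₂ x * ω₁ x - ω₂ x * deriv ω₁ x ≠ 0 := by
    refine ((hd hε₁ hω₁).1.eventually_ne (by rw [ω₁0]; exact one_ne_zero)).and
      (ContinuousAt.eventually_ne (((hd hε₂ hω₂).2.mul (hd hε₁ hω₁).1).sub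
        ((hd hε₂ hω₂).1.mul (hd hε₁ hω₁).2)) ?_)
    simp [ω₁0, ω₁1, ω₂0, ω₂1]
  obtain ⟨ε', hε', hne⟩ := Metric.eventually_nhds_iff_ball.1 hev
  obtain ⟨η, hη, hη1, hη2, hη3, hη4, hη5⟩ :
      ∃ η, 0 < η ∧ η ≤ ε / 4 ∧ η ≤ εF ∧ η ≤ ε₁ ∧ η ≤ ε₂ ∧ η ≤ ε' :=
    ⟨min (ε / 4) (min εF (min ε₁ (min ε₂ ε'))), by positivity, by simp, by simp, by simp, by simp,
      by simp⟩
  have hu' : ContDiffOn ℝ ∞ u (box p η) := hu.mono (Metric.ball_subset_ball hη1)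
  have hdom : ∀ q : box p η, q.1 ∈ D ∩ {q | 0 < s * painleveCubic q} :=
    fun q => hball (Metric.ball_subset_ball (by linarith) q.2)
  have hUx : ∀ {ε : ℝ}, η ≤ ε → ∀ q ∈ box p η, q 0 ∈ Metric.ball (p 0) ε := fun h q hq =>
    Metric.ball_subset_ball h ((mem_ball_plane hη).1 hq).1
  have hx0 : ∀ q : box p η, q.1 0 ≠ 0 := fun q => (hdom q).1.1
  have ht0 : ∀ q : box p η, q.1 0 - 1 ≠ 0 := fun q => sub_ne_zero.2 (hdom q).1.2.1
  have hy0 : ∀ q : box p η, q.1 1 ≠ 0 := fun q => (hdom q).1.2.2.1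
  have hw0 : ∀ q : box p η, q.1 1 - 1 ≠ 0 := fun q => sub_ne_zero.2 (hdom q).1.2.2.2.1
  have hz0 : ∀ q : box p η, q.1 1 - q.1 0 ≠ 0 := fun q => sub_ne_zero.2 (hdom q).1.2.2.2.2
  obtain ⟨ix, eix, dix⟩ := exists_inv (f := (coord 0 : smoothFunctions (box p η))) hx0
  obtain ⟨it, eit, dit⟩ := exists_inv (f := (coord 0 - 1 : smoothFunctions (box p η)))
    fun q => by simpa [eval_coord] using ht0 q
  obtain ⟨iy, eiy, diy⟩ := exists_inv (f := (coord 1 : smoothFunctions (box p η))) hy0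
  obtain ⟨iw, eiw, diw⟩ := exists_inv (f := (coord 1 - 1 : smoothFunctions (box p η)))
    fun q => by simpa [eval_coord] using hw0 q
  obtain ⟨iz, eiz, diz⟩ := exists_inv (f := (coord 1 - coord 0 : smoothFunctions (box p η)))
    fun q => by simpa [eval_coord] using hz0 q
  have d00 : der 0 (coord 0 : smoothFunctions (box p η)) = 1 := der_coord 0 0
  have d01 : der 0 (coord 1 : smoothFunctions (box p η)) = 0 := der_coord 0 1
  have d10 : der 1 (coord 0 : smoothFunctions (box p η)) = 0 := der_coord 1 0
  have d11 : der 1 (coord 1 : smoothFunctions (box p η)) = 1 := der_coord 1 1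
  obtain ⟨n, en, n0, dn⟩ := exists_inv_sqrt (U := box p η) contDiff_painleveCubic.contDiffOn
    fun q hq => (hdom ⟨q, hq⟩).2
  have xn : der 0 n = algebraMap ℝ _ (1 / 2) * (n * iz) := ext_eval fun q => by
    have h1 := dn 0 q
    rw [partialDeriv_zero_painleveCubic, painleveCubic] at h1
    have h2 := hy0 q
    have h3 := hw0 q
    have h4 := hz0 q
    simp only [map_mul, AlgHom.commutes, Algebra.algebraMap_self, RingHom.id_apply, eiz, map_sub,
      eval_coord]
    field_simp
    refine mul_left_cancel₀ (mul_ne_zero h2 h3) ?_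
    linear_combination h1
  have yn : der 1 n = -algebraMap ℝ _ (1 / 2) * (n * (iy + iw + iz)) := ext_eval fun q => by
    have h1 := dn 1 q
    rw [partialDeriv_one_painleveCubic, painleveCubic] at h1
    have h2 := hy0 q
    have h3 := hw0 q
    have h4 := hz0 q
    simp only [map_mul, map_neg, map_add, AlgHom.commutes, Algebra.algebraMap_self,
      RingHom.id_apply, eiy, eiw, eiz, map_sub, eval_coord, map_one]
    field_simp
    linear_combination h1
  obtain ⟨v, hv⟩ : ∃ v : smoothFunctions (box p η), v = mk u hu' := ⟨_, rfl⟩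
  have yv : der 1 v = n := ext_eval fun q => by
    rw [hv, eval_der_mk, huy _ (Metric.ball_subset_ball hη1 q.2), en]
  have v0 : ∀ q : box p η, q.1 1 = p 1 → eval q v = 0 := fun q hq => by
    rw [hv, eval_mk, ← vec_eta q.1, hq, hu0]
  obtain ⟨h, eh, -, yh⟩ := exists_ofFst (U := box p η) Metric.isOpen_ball hHs (hUx (by linarith))
  -- The inhomogeneous Picard–Fuchs equation for the incomplete elliptic integral. Its
  -- `y`-derivative is a rational identity times `n`, and on `y = p 1` only the boundary term and
  -- `h` remain.
  have hsum : der 0 (der 0 v) + (ix + it) * der 0 v + algebraMap ℝ _ (1 / 4) * ix * it * v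
      + algebraMap ℝ _ (1 / 2) * ix * it * coord 1 * (coord 1 - 1) * iz * n - h = 0 := by
    refine eq_zero_of_der_one_eq_zero hη ?_ fun q hq => ?_
    · refine ext_eval fun q => ?_
      have yxv : der 1 (der 0 v) = algebraMap ℝ _ (1 / 2) * (n * iz) := by
        rw [der_comm, yv, xn]
      have yxxv : der 1 (der 0 (der 0 v)) = der 0 (algebraMap ℝ _ (1 / 2) * (n * iz)) := by
        rw [der_comm, yxv]
      simp [AlgHom.commutes, Algebra.algebraMap_self, RingHom.id_apply,
        Derivation.map_algebraMap, yxxv, yxv, yv, yh, xn, yn, dix, dit, diz, d00, d01, d10, d11, eix, eit, eiy, eiw, eiz,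
        eval_coord, Derivation.leibniz_pow]
      have h1 := hx0 q
      have h2 := ht0 q
      have h3 := hy0 q
      have h4 := hw0 q
      have h5 := hz0 q
      field_simp
      ring
    · have h1 := eval_der_zero_eq_zero v0
      have h2 := eval_der_zero_eq_zero h1
      have h3 : (![q.1 0, p 1] : Plane) = q := by rw [← hq, vec_eta]
      simp [AlgHom.commutes, Algebra.algebraMap_self, RingHom.id_apply,
        Derivation.map_algebraMap, v0 q hq, h1 q hq, h2 q hq, eh, hH, h3, hq, en, eix, eit, eiz, eval_coord]
      ring
  have hvxx : ∀ q : box p η, eval q (der 0 (der 0 v)) = eval q h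
      - (1 / 2 * (q.1 0)⁻¹ * (q.1 0 - 1)⁻¹ * q.1 1 * (q.1 1 - 1) * (q.1 1 - q.1 0)⁻¹ * eval q n)
      - ((q.1 0)⁻¹ + (q.1 0 - 1)⁻¹) * eval q (der 0 v)
      - 1 / 4 * (q.1 0)⁻¹ * (q.1 0 - 1)⁻¹ * eval q v := fun q => by
    have h1 := congrArg (eval q) hsum
    simp only [map_sub, map_add, map_mul, AlgHom.commutes, Algebra.algebraMap_self, map_zero,
      RingHom.id_apply, eix, eit, eiz, eval_coord, map_one] at h1
    linear_combination h1
  obtain ⟨f, ef, exf, exxf, yf⟩ := exists_ofFst_two (U := box p η) Metric.isOpen_ball hF (hUx hη2)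
  obtain ⟨w₁, ew₁, exw₁, exxw₁, yw₁⟩ :=
    exists_ofFst_two (U := box p η) Metric.isOpen_ball hω₁ (hUx hη3)
  obtain ⟨w₂, ew₂, exw₂, exxw₂, yw₂⟩ :=
    exists_ofFst_two (U := box p η) Metric.isOpen_ball hω₂ (hUx hη4)
  have hw₁0 : ∀ q : box p η, eval q w₁ ≠ 0 := fun q => by
    rw [ew₁]
    exact (hne _ (hUx hη5 q q.2)).1
  have hwr : ∀ q : box p η, eval q (der 0 w₂) * eval q w₁ - eval q w₂ * eval q (der 0 w₁) ≠ 0 :=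
    fun q => by
      rw [ew₁, ew₂, exw₁, exw₂]
      exact (hne _ (hUx hη5 q q.2)).2
  obtain ⟨i, ei, di⟩ := exists_inv (f := w₁) hw₁0
  have yxv : der 1 (der 0 v) = der 0 n := by rw [der_comm, yv]
  have yxf : der 1 (der 0 f) = 0 := by rw [der_comm, yf, map_zero]
  have yxw₁ : der 1 (der 0 w₁) = 0 := by rw [der_comm, yw₁, map_zero]
  -- Along solutions `v + f` satisfies the homogeneous equation, so it is a combination of `ω₁` and
  -- `ω₂`; division by `ω₁` makes it affine in `X = ω₂ / ω₁`.
  refine ⟨box p η, w₂ * i, (v + f) * i, Metric.mem_ball_self hη, fun q hq => (hdom ⟨q, hq⟩).1,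
    by simp [di, yw₁, yw₂], fun q => ?_, fun q => ?_, fun q t => ?_⟩
  · have h1 : eval q (der 0 (w₂ * i)) = (eval q (der 0 w₂) * eval q w₁
        - eval q w₂ * eval q (der 0 w₁)) / eval q w₁ ^ 2 := by
      simp [di, ei]
      have := hw₁0 q
      field_simp
      ring
    rw [h1]
    exact div_ne_zero (hwr q) (pow_ne_zero 2 (hw₁0 q))
  · simpa [di, yv, yf, yw₁, ei, n0] using hw₁0 q
  · have eF' := eF _ (hUx hη2 q q.2)
    have e1' := eω₁ _ (hUx hη3 q q.2)
    have e2' := eω₂ _ (hUx hη4 q q.2)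
    rw [← exxf, ← exf, ← ef, ← eh] at eF'
    rw [← exxw₁, ← exw₁, ← ew₁] at e1'
    rw [← exxw₂, ← exw₂, ← ew₂] at e2'
    have h1 := hx0 q
    have h2 := ht0 q
    have h3 := hy0 q
    have h4 := hw0 q
    have h5 := hz0 q
    have h6 := hw₁0 q
    have exn : eval q (der 0 n) = 1 / 2 * (eval q n * (q.1 1 - q.1 0)⁻¹) := by
      simp [AlgHom.commutes, Algebra.algebraMap_self, RingHom.id_apply,
        Derivation.map_algebraMap, xn, eiz, eval_coord]
    have eyn : eval q (der 1 n) = -(1 / 2) * (eval q n * ((q.1 1)⁻¹ + (q.1 1 - 1)⁻¹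
        + (q.1 1 - q.1 0)⁻¹)) := by
      simp [AlgHom.commutes, Algebra.algebraMap_self, RingHom.id_apply,
        Derivation.map_algebraMap, yn, eiy, eiw, eiz, eval_coord]
    simp [di, yv, yf, yw₁, yw₂, yxv, yxf, yxw₁, Derivation.leibniz_pow, ei, hvxx q, exn, eyn,
      painleveVI, map_ofNat]
    -- `T` is the derivative of `Y` along the direction `(1, t)`, and `w` is the Wronskian of `ω₁`,
    -- `ω₂`; they are the multipliers with which the three linear equations combine.
    obtain ⟨T, hT⟩ : ∃ T, T = (eval q (der 0 v) + eval q (der 0 f) + eval q n * t) / eval q w₁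
        - (eval q v + eval q f) * eval q (der 0 w₁) / eval q w₁ ^ 2 := ⟨_, rfl⟩
    obtain ⟨w, hw⟩ : ∃ w, w = eval q (der 0 w₂) * eval q w₁ - eval q w₂ * eval q (der 0 w₁) :=
      ⟨_, rfl⟩
    linear_combination (norm := (rw [hT, hw]; field_simp; ring)) w / eval q w₁ ^ 3 * eF'
      + (eval q w₂ / eval q w₁ ^ 2 * T - w / eval q w₁ ^ 4 * (eval q v + eval q f)) * e1'
      - T / eval q w₁ * e2'

theorem isFlatAt_painleveVI {p : Plane} (hp : p ∈ (painleveVI 0 0 0 (1 / 2)).dom) :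
    (painleveVI 0 0 0 (1 / 2)).IsFlatAt p := by
  obtain ⟨U, X, Y, hpU, hU, yX, hX, hY, h⟩ := exists_coordinates_painleveVI hp
  exact isFlatAt_of_coordinates hpU hU yX hX hY h

theorem isMetrisableAt_painleveVI {p : Plane} (hp : p ∈ (painleveVI 0 0 0 (1 / 2)).dom) :
    (painleveVI 0 0 0 (1 / 2)).IsMetrisableAt p := by
  obtain ⟨U, X, Y, hpU, hU, yX, hX, hY, h⟩ := exists_coordinates_painleveVI hp
  exact isMetrisableAt_of_coordinates hpU hU yX hX hY h

theorem theorem1p3 :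
    (∀ p ∈ painleveI.dom, ¬ painleveI.IsMetrisableAt p) ∧
    (∀ α : ℝ, ∀ p ∈ (painleveII α).dom, ¬ (painleveII α).IsMetrisableAt p) ∧
    (∀ α β γ δ : ℝ, ∀ p ∈ (painleveIII α β γ δ).dom,
      (painleveIII α β γ δ).IsMetrisableAt p ↔ (α = 0 ∧ γ = 0) ∨ (β = 0 ∧ δ = 0)) ∧
    (∀ α β : ℝ, ∀ p ∈ (painleveIV α β).dom, ¬ (painleveIV α β).IsMetrisableAt p) ∧
    (∀ α β γ δ : ℝ, ∀ p ∈ (painleveV α β γ δ).dom,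
      (painleveV α β γ δ).IsMetrisableAt p ↔ γ = 0 ∧ δ = 0) ∧
    (∀ α β γ δ : ℝ, ∀ p ∈ (painleveVI α β γ δ).dom,
      (painleveVI α β γ δ).IsMetrisableAt p ↔ α = 0 ∧ β = 0 ∧ γ = 0 ∧ δ = 1 / 2) ∧
    (∀ p ∈ (painleveIII 0 0 0 0).dom, (painleveIII 0 0 0 0).IsFlatAt p) ∧
    (∀ p ∈ (painleveV 0 0 0 0).dom, (painleveV 0 0 0 0).IsFlatAt p) ∧
    (∀ p ∈ (painleveVI 0 0 0 (1 / 2)).dom, (painleveVI 0 0 0 (1 / 2)).IsFlatAt p) := by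
  refine ⟨fun p _ => not_isMetrisableAt_painleveI, fun α p _ => not_isMetrisableAt_painleveII α,
    fun α β γ δ p hp => ⟨painleveIII_of_isMetrisableAt, ?_⟩,
    fun α β p _ => not_isMetrisableAt_painleveIV α β,
    fun α β γ δ p hp => ⟨painleveV_of_isMetrisableAt, ?_⟩,
    fun α β γ δ p hp => ⟨painleveVI_of_isMetrisableAt, ?_⟩,
    fun p hp => isFlatAt_painleveIII_zero hp, fun p hp => isFlatAt_painleveV_zero hp,
    fun p hp => isFlatAt_painleveVI hp⟩
  · rintro (⟨rfl, rfl⟩ | ⟨rfl, rfl⟩)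
    exacts [isMetrisableAt_painleveIII_of_left β δ hp, isMetrisableAt_painleveIII_of_right α γ hp]
  · rintro ⟨rfl, rfl⟩
    exact isMetrisableAt_painleveV α β hp
  · rintro ⟨rfl, rfl, rfl, rfl⟩
    exact isMetrisableAt_painleveVI hp
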